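/- Let $\beta\in\{1,2,4\}$, $\theta=\beta/2$, and let $\mathbb F_\beta$ be $\mathbb R$, $\mathbb C$ or the quaternions $\mathbb H$, respectively. Let $\mathbb U_\beta(L)$ be the compact group of $L\times L$ matrices $V$ over $\mathbb F_\beta$ with $VV^*=V^*V=1$ (the orthogonal, unitary or symplectic group). The squared singular values of a matrix $X$ with $N$ columns over $\mathbb F_\beta$ are the $N$ eigenvalues of $X^*X$, with multiplicity, in decreasing order: the unique $x_1\ge\dots\ge x_N$ with $X^*X=V\,\mathrm{diag}(x_1,\dots,x_N)\,V^*$ for some $V\in\mathbb U_\beta(N)$. For $\alpha>0$ and integers $M\ge 0$, $N\ge 1$, put $m=\min(M,N)$ and let $\mathbb P_\theta^{\alpha,M,N}$ (the $\beta$-Jacobi ensemble) be the law of the vector $(1,\dots,1,x_1,\dots,x_m)$, with $N-m$ leading ones, where $1\ge x_1\ge\dots\ge x_m\ge 0$ have joint density proportional to $$\prod_{1\le i<j\le m}|x_i-x_j|^{2\theta}\ \prod_{i=1}^{m}x_i^{\theta\alpha-1}(1-x_i)^{\theta|M-N|+\theta-1}.$$ (For $M=0$ it is the point mass at $(1,\dots,1)$.)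 Iterated products $\boxtimes_\beta$: random vectors $(z^{(T)})_{T\ge1}$ are a version of $\bigl(x^{(1)}\boxtimes_\beta\cdots\boxtimes_\beta x^{(T)}\bigr)_{T\ge 1}$ if there are independent random $N\times N$ matrices $A_1,A_2,\dots$ over $\mathbb F_\beta$, each with a law invariant under right multiplication by $\mathbb U_\beta(N)$, such that almost surely, for every $T$, $x^{(T)}$ is the vector of squared singular values of $A_T$ and $z^{(T)}$ is the vector of squared singular values of $A_1A_2\cdots A_T$. **Theorem.** Let $N$, $N_1,N_2,\dots$, $L_1,L_2,\dots$ be positive integers, $N_0:=N$, with $N\le N_T$ and $\max(N_{T-1},N_T)\le L_T$ for all $T\ge1$. Let $U_1,U_2,\dots$ be independent, $U_T$ Haar distributed on $\mathbb U_\beta(L_T)$; let $X_T$ be an $N_T\times N_{T-1}$ submatrix of $U_T$ (any fixed choice of rows and columns), $Y_T:=X_T\cdots X_1$, and let $y^{(T)}\in\mathbb R^N$ be the vector of squared singular values of $Y_T$. Let $x^{(1)},x^{(2)},\dots$ be independent with $x^{(T)}\sim\mathbb P_\theta^{\alpha_T,M_T,N}$, where $\alpha_T=N_T-N+1$ and $M_T=L_T-N_T$.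 Then, jointly in $T$, $$\bigl(y^{(T)}\bigr)_{T\ge1}\ \overset{d}{=}\ \bigl(x^{(1)}\boxtimes_\beta\cdots\boxtimes_\beta x^{(T)}\bigr)_{T\ge1}.$$ That is, a version $(z^{(T)})_{T\ge1}$ of the right-hand side exists for some such sequence $(x^{(T)})_{T\ge1}$ on some probability space, and for every such sequence and every version, the sequence $(z^{(T)})_{T\ge1}$ has the same law on $(\mathbb R^N)^{\{1,2,\dots\}}$ as $(y^{(T)})_{T\ge1}$. -/

import Mathlib

open MeasureTheory ProbabilityTheory
open scoped Matrix Quaternion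

/-- `𝕂` is the scalar (skew) field with Dyson index `β`: up to an isomorphism of real algebras
with involution it is `ℝ`, `ℂ` or the quaternions `ℍ` for `β = 1, 2, 4` respectively. -/
def IsDysonField (𝕂 : Type) [NormedDivisionRing 𝕂] [NormedAlgebra ℝ 𝕂] [StarRing 𝕂]
    (β : ℕ) : Prop :=
  (β = 1 ∧ Nonempty (𝕂 ≃⋆ₐ[ℝ] ℝ)) ∨ (β = 2 ∧ Nonempty (𝕂 ≃⋆ₐ[ℝ] ℂ)) ∨
    (β = 4 ∧ Nonempty (𝕂 ≃⋆ₐ[ℝ] ℍ[ℝ]))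

/-- The compact group of `n × n` matrices `V` over `𝕂` with `V V* = V* V = 1`: the orthogonal,
unitary or (compact) symplectic group when `𝕂` is `ℝ`, `ℂ` or `ℍ`. -/
abbrev UGroup (𝕂 : Type) [NormedDivisionRing 𝕂] [StarRing 𝕂] (n : ℕ) :
    Submonoid (Matrix (Fin n) (Fin n) 𝕂) :=
  unitary (Matrix (Fin n) (Fin n) 𝕂)

/-- The Borel (entrywise) `σ`-algebra on matrices. -/
instance matrixMeasurableSpace (𝕂 : Type) [MeasurableSpace 𝕂] (m n : ℕ) :
    MeasurableSpace (Matrix (Fin m) (Fin n) 𝕂) :=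
  inferInstanceAs (MeasurableSpace (Fin m → Fin n → 𝕂))

/-- `x = (x₁ ≥ ⋯ ≥ x_N)` is the ordered vector of the (real) eigenvalues, with multiplicity, of
the Hermitian matrix `A`: `A = V diag(x) V*` with `V` unitary. -/
def IsOrderedEigenvalues {𝕂 : Type} [NormedDivisionRing 𝕂] [NormedAlgebra ℝ 𝕂] [StarRing 𝕂]
    {N : ℕ} (A : Matrix (Fin N) (Fin N) 𝕂) (x : Fin N → ℝ) : Prop :=
  Antitone x ∧ ∃ V ∈ UGroup 𝕂 N,
    A = V * Matrix.diagonal (fun i => algebraMap ℝ 𝕂 (x i)) * star V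

open Classical in
/-- The squared singular values of an `m × N` matrix `X`: the `N` eigenvalues of `X* X` in
decreasing order. By the spectral theorem for Hermitian matrices over `ℝ`, `ℂ`, `ℍ` this vector
exists and is unique, so the default value is never taken there. -/
noncomputable def sqSingularValues {𝕂 : Type} [NormedDivisionRing 𝕂] [NormedAlgebra ℝ 𝕂]
    [StarRing 𝕂] {m N : ℕ} (X : Matrix (Fin m) (Fin N) 𝕂) : Fin N → ℝ :=
  if h : ∃ x : Fin N → ℝ, IsOrderedEigenvalues (Xᴴ * X) x then h.choose else 0

/-- The product `X_T ⋯ X_1` of rectangular matrices; `X t` is the factor number `t + 1`, of size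
`n (t + 1) × n t`. The empty product (`T = 0`) is the identity. -/
def leftProd {𝕂 : Type} [NormedDivisionRing 𝕂] {n : ℕ → ℕ}
    (X : ∀ t, Matrix (Fin (n (t + 1))) (Fin (n t)) 𝕂) :
    ∀ T, Matrix (Fin (n T)) (Fin (n 0)) 𝕂
  | 0 => 1
  | T + 1 => X T * leftProd X T

/-- The product `A 0 * A 1 * ⋯ * A T` of square matrices. -/
def rightProd {𝕂 : Type} [NormedDivisionRing 𝕂] {N : ℕ}
    (A : ℕ → Matrix (Fin N) (Fin N) 𝕂) : ℕ → Matrix (Fin N) (Fin N) 𝕂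
  | 0 => A 0
  | T + 1 => rightProd A T * A (T + 1)

/-- The unnormalised density of the `β`-Jacobi ensemble (`β = 2θ`) in the `m = min M N`
particles which are not frozen at `1`. -/
noncomputable def jacobiWeight (θ α : ℝ) (M N : ℕ) (x : Fin (min M N) → ℝ) : ℝ :=
  (∏ i, ∏ j ∈ Finset.Ioi i, |x i - x j| ^ (2 * θ)) *
    ∏ i, x i ^ (θ * α - 1) * (1 - x i) ^ (θ * |(M : ℝ) - N| + θ - 1)

/-- The measure with density `jacobiWeight` with respect to Lebesgue measure on
`{1 ≥ x₁ ≥ ⋯ ≥ x_m ≥ 0}`, `m = min M N`. -/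
noncomputable def jacobiUnnormalized (θ α : ℝ) (M N : ℕ) : Measure (Fin (min M N) → ℝ) :=
  (volume.restrict {x | Antitone x ∧ ∀ i, x i ∈ Set.Icc (0 : ℝ) 1}).withDensity
    (fun x => ENNReal.ofReal (jacobiWeight θ α M N x))

/-- `(x₁, …, x_m) ↦ (1, …, 1, x₁, …, x_m)`, with `N - m` ones, `m = min M N`. -/
def padOnes (M N : ℕ) (x : Fin (min M N) → ℝ) : Fin N → ℝ :=
  fun i => if h : (i : ℕ) < N - min M N then 1 else x ⟨i - (N - min M N), by omega⟩

/-- The `N`-particle `β`-Jacobi ensemble with parameters `α`, `M`, `β = 2θ`: the probability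
measure on ordered vectors `(1, …, 1, x₁, …, x_m)` with density proportional to
`jacobiWeight`. For `M = 0` it is the point mass at `(1, …, 1)`. -/
noncomputable def jacobiEnsemble (θ α : ℝ) (M N : ℕ) : Measure (Fin N → ℝ) :=
  ((jacobiUnnormalized θ α M N Set.univ)⁻¹ • jacobiUnnormalized θ α M N).map (padOnes M N)

/-- `z T = x 0 ⊠ x 1 ⊠ ⋯ ⊠ x T` for all `T` jointly, where `⊠` is the random operation attached
to `𝕂`: there are independent `N × N` random matrices `A 0, A 1, …` over `𝕂`, each with a law
invariant under right multiplication by `UGroup 𝕂 N`, such that `x T` is the vector of squared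
singular values of `A T` and `z T` that of `A 0 * A 1 * ⋯ * A T`. (The partial product
`A 0 * ⋯ * A T` is again right-invariant, has squared singular values `z T`, and is independent of
`A (T + 1)`, so that `z (T + 1) = z T ⊠ x (T + 1)`.) -/
def IsIteratedBoxtimes (𝕂 : Type) [NormedDivisionRing 𝕂] [NormedAlgebra ℝ 𝕂] [StarRing 𝕂]
    [MeasurableSpace 𝕂] {N : ℕ} {Ω : Type*} [MeasurableSpace Ω] (P : Measure Ω)
    (x z : ℕ → Ω → Fin N → ℝ) : Prop :=
  ∃ A : ℕ → Ω → Matrix (Fin N) (Fin N) 𝕂,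
    (∀ T, Measurable (A T)) ∧ iIndepFun A P ∧
    (∀ T, ∀ V ∈ UGroup 𝕂 N, P.map (fun ω => A T ω * V) = P.map (A T)) ∧
    (∀ T, ∀ᵐ ω ∂P, x T ω = sqSingularValues (A T ω)) ∧
    (∀ T, ∀ᵐ ω ∂P, z T ω = sqSingularValues (rightProd (fun t => A t ω) T))

/-! Both sequences are the same Markov chain on ordered vectors. From the current vector r, a step
draws x from the Jacobi law with the current parameters and an independent Haar unitary V of size N,
and passes to the squared singular values of diag(√x) V diag(√r) (`stepMap`). The laws of the
initial segments of this chain are `prefixLaw`, and they determine the law of the sequence.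

For the products of truncations, write Y_T = W D V' by singular value decomposition. Right
invariance of the Haar law of U_{T+1} absorbs W, so that only the first N of the chosen columns of
X_{T+1} meet D. Right invariance under unitaries acting on these N columns then places a Haar
unitary between the corner and D. Hence, given the whole past, the law of the next vector depends
only on the last one and on the law of the singular values of an N_{T+1} × N corner
(`map_sqSingularValues_corner_mul`). For the products A_1 ⋯ A_T, right invariance holds jointly with
the singular values of the earlier products, so a Haar unitary may be inserted before A_{T+1};
taking adjoints gives the same step (`map_prefix_rightProd`). A version exists because one may take
A_T = diag(√x) V with V Haar.

It remains to find the law of the squared singular values of an n × N corner X of a Haar unitary of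
size L (`map_corner_haarU_eq_jacobiEnsemble`). If N + n ≤ L, this is an induction on N. Let Z be the
part of the chosen rows outside the columns of X. Rotating these remaining columns by a Haar unitary
of size L - N, and using X X* + Z Z* = 1, the new column in the left singular basis of X is a Haar
column q whose coordinates are multiplied by √(1 - x_j), or by 1 beyond the first N. The Gram matrix
of the enlarged corner is a bordered diagonal matrix, and its eigenvalues t solve ∑ p_j / (t - a_j)
= 0 with poles 1, x_1, …, x_N, 0, where the weights p_j are the squared norms of blocks of q
(`sqSingularValues_borderedMatrix`). These weights are Dirichlet with parameters θ times the block
sizes (`exists_map_column_haarU_eq`). The map from interlacing roots to weights has as Jacobian a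
quotient of Vandermonde products (`lintegral_openSimplex_eq`), and integrating out x is once more an
integral of Dixon–Anderson type; a Jacobi density with one more particle remains
(`lintegral_selberg_succ`). If N > L - n, then X* X = 1 - Z Z* for a smaller complementary corner Z,
which explains the frozen ones and reduces to the first case by x ↦ 1 - x.

No normalising constant is computed: laws are found up to a factor, and total mass one fixes it. The
three fields are treated together, from star x * x = ‖x‖² and finite dimension alone; the spectral
theorem for Gram matrices, the singular value decomposition, and the uniqueness and continuity of
singular values are derived from these without determinants over the field. -/

set_option linter.unusedSectionVars false

/-! ### The scalar fields -/

/-- The norm of `𝕂` is the composition norm of the involution, and `𝕂` is finite-dimensional. -/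
class IsCompositionField (𝕂 : Type) [NormedDivisionRing 𝕂] [NormedAlgebra ℝ 𝕂] [StarRing 𝕂] :
    Prop where
  star_mul_self_eq : ∀ x : 𝕂, star x * x = algebraMap ℝ 𝕂 (‖x‖ ^ 2)
  finiteDimensional : FiniteDimensional ℝ 𝕂

namespace IsCompositionField

section transfer

variable {𝕂 𝔽 : Type} [NormedDivisionRing 𝕂] [NormedAlgebra ℝ 𝕂] [StarRing 𝕂]
  [NormedDivisionRing 𝔽] [NormedAlgebra ℝ 𝔽] [StarRing 𝔽]

/-- Finite dimension gives some bound C. Both norms are multiplicative, so applying the bound to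
powers gives (‖φ x‖ / ‖x‖)^k ≤ C for every k, which excludes a ratio above one. -/
theorem norm_map_le [FiniteDimensional ℝ 𝕂] (φ : 𝕂 →ₐ[ℝ] 𝔽) (x : 𝕂) : ‖φ x‖ ≤ ‖x‖ := by
  obtain ⟨C, hC0, hC⟩ := (LinearMap.toContinuousLinearMap φ.toLinearMap).bound
  have hC' : ∀ y, ‖φ y‖ ≤ C * ‖y‖ := fun y => hC y
  by_contra! h
  rcases eq_or_ne x 0 with rfl | hx
  · simp at h
  have hx0 : 0 < ‖x‖ := norm_pos_iff.2 hx
  obtain ⟨k, hk⟩ := pow_unbounded_of_one_lt C ((one_lt_div hx0).2 h)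
  have := hC' (x ^ k)
  rw [map_pow, norm_pow, norm_pow] at this
  rw [div_pow, lt_div_iff₀ (by positivity)] at hk
  linarith

/-- The isomorphism is not assumed isometric; `norm_map_le` for it and for its inverse makes it so,
and the identity can then be transported. -/
theorem of_starAlgEquiv (h : IsCompositionField 𝔽) (φ : 𝕂 ≃⋆ₐ[ℝ] 𝔽) : IsCompositionField 𝕂 := by
  have := h.finiteDimensional
  let e : 𝕂 ≃ₐ[ℝ] 𝔽 := AlgEquiv.ofRingEquiv (f := (φ : 𝕂 ≃+* 𝔽)) (fun r => by
    rw [Algebra.algebraMap_eq_smul_one, Algebra.algebraMap_eq_smul_one]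
    change φ (r • 1) = r • 1
    rw [map_smul, map_one])
  have hfd : FiniteDimensional ℝ 𝕂 := LinearEquiv.finiteDimensional e.symm.toLinearEquiv
  have hn : ∀ x, ‖φ x‖ = ‖x‖ := fun x => le_antisymm (norm_map_le e.toAlgHom x) (by
    have := norm_map_le e.symm.toAlgHom (e x)
    exact (congrArg norm (e.symm_apply_apply x)).symm.le.trans this)
  refine ⟨fun x => e.injective ?_, hfd⟩
  change φ (star x * x) = _
  rw [map_mul, map_star, h.star_mul_self_eq, hn]
  exact (e.commutes _).symm

end transfer

theorem real : IsCompositionField ℝ :=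
  ⟨fun x => by simp [pow_two], inferInstance⟩

theorem complex : IsCompositionField ℂ :=
  ⟨fun x => by simp [Complex.conj_mul'], inferInstance⟩

theorem quaternion : IsCompositionField ℍ[ℝ] :=
  ⟨fun x => by
    rw [Quaternion.star_mul_self, Quaternion.normSq_eq_norm_mul_self, pow_two]; rfl, inferInstance⟩

variable {𝕂 : Type} [NormedDivisionRing 𝕂] [NormedAlgebra ℝ 𝕂] [StarRing 𝕂]

theorem of_isDysonField {β : ℕ} (h : IsDysonField 𝕂 β) : IsCompositionField 𝕂 := by
  rcases h with ⟨_, ⟨φ⟩⟩ | ⟨_, ⟨φ⟩⟩ | ⟨_, ⟨φ⟩⟩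
  · exact real.of_starAlgEquiv φ
  · exact complex.of_starAlgEquiv φ
  · exact quaternion.of_starAlgEquiv φ

end IsCompositionField

theorem IsDysonField.finrank_eq {𝕂 : Type} [NormedDivisionRing 𝕂] [NormedAlgebra ℝ 𝕂]
    [StarRing 𝕂] {β : ℕ} (h : IsDysonField 𝕂 β) : Module.finrank ℝ 𝕂 = β := by
  have key : ∀ {𝔽 : Type} [NormedDivisionRing 𝔽] [NormedAlgebra ℝ 𝔽] [StarRing 𝔽]
      (φ : 𝕂 ≃⋆ₐ[ℝ] 𝔽), Module.finrank ℝ 𝕂 = Module.finrank ℝ 𝔽 := by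
    intro 𝔽 _ _ _ φ
    exact LinearEquiv.finrank_eq
      { toFun := φ, invFun := φ.symm, map_add' := map_add φ, map_smul' := map_smul φ,
        left_inv := φ.left_inv, right_inv := φ.right_inv }
  rcases h with ⟨rfl, ⟨φ⟩⟩ | ⟨rfl, ⟨φ⟩⟩ | ⟨rfl, ⟨φ⟩⟩
  · rw [key φ, Module.finrank_self]
  · rw [key φ, Complex.finrank_real_complex]
  · rw [key φ, Quaternion.finrank_eq_four]

/-! ### Consequences of star x * x = ‖x‖² -/

section basic

variable {𝕂 : Type} [NormedDivisionRing 𝕂] [NormedAlgebra ℝ 𝕂] [StarRing 𝕂]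
  [hK : IsCompositionField 𝕂]

instance IsCompositionField.instFiniteDimensional : FiniteDimensional ℝ 𝕂 := hK.finiteDimensional

theorem star_mul_self_eq (x : 𝕂) : star x * x = algebraMap ℝ 𝕂 (‖x‖ ^ 2) := hK.star_mul_self_eq x

/-- The involution is not assumed real linear. A nonnegative real is star y * y with y its square
root, hence self-adjoint. -/
theorem star_algebraMap_real (r : ℝ) : star (algebraMap ℝ 𝕂 r) = algebraMap ℝ 𝕂 r := by
  have h : ∀ s : ℝ, 0 ≤ s → star (algebraMap ℝ 𝕂 s) = algebraMap ℝ 𝕂 s := by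
    intro s hs
    have := star_mul_self_eq (algebraMap ℝ 𝕂 (√s))
    rw [norm_algebraMap', Real.norm_eq_abs, sq_abs, Real.sq_sqrt hs] at this
    rw [← this, star_mul, star_star]
  rcases le_total 0 r with hr | hr
  · exact h r hr
  · have := h (-r) (by linarith)
    rwa [map_neg, star_neg, neg_inj] at this

theorem norm_star_eq (x : 𝕂) : ‖star x‖ = ‖x‖ := by
  rcases eq_or_ne x 0 with rfl | hx
  · simp
  have := congrArg norm (star_mul_self_eq x)
  rw [norm_mul, norm_algebraMap', Real.norm_eq_abs, abs_of_nonneg (by positivity), pow_two] at this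
  exact mul_right_cancel₀ (norm_ne_zero_iff.2 hx) this

theorem mul_star_self_eq (x : 𝕂) : x * star x = algebraMap ℝ 𝕂 (‖x‖ ^ 2) := by
  have := star_mul_self_eq (star x)
  rwa [star_star, norm_star_eq] at this

instance IsCompositionField.instContinuousStar : ContinuousStar 𝕂 := by
  refine ⟨AddMonoidHomClass.continuous_of_bound (starAddEquiv : 𝕂 ≃+ 𝕂) 1 fun x => ?_⟩
  simp [norm_star_eq]

instance IsCompositionField.instProper : ProperSpace 𝕂 := FiniteDimensional.proper ℝ 𝕂

end basic

/-! ### Unitary reflections, and matrices with equal Gram matrices -/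

section reflection

variable {𝕂 : Type} [NormedDivisionRing 𝕂] [NormedAlgebra ℝ 𝕂] [StarRing 𝕂]
  [hK : IsCompositionField 𝕂] {ι κ : Type*} [Fintype ι] [Fintype κ]

theorem conjTranspose_mul_self_apply_self (X : Matrix ι κ 𝕂) (j : κ) :
    (Xᴴ * X) j j = algebraMap ℝ 𝕂 (∑ i, ‖X i j‖ ^ 2) := by
  simp [Matrix.mul_apply, star_mul_self_eq]

theorem conjTranspose_mul_self_eq_zero_iff {X : Matrix ι κ 𝕂} : Xᴴ * X = 0 ↔ X = 0 := by
  refine ⟨fun h => ?_, fun h => by simp [h]⟩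
  ext i j
  have h1 := conjTranspose_mul_self_apply_self X j
  rw [h, Matrix.zero_apply, eq_comm, map_eq_zero,
    Finset.sum_eq_zero_iff_of_nonneg (fun _ _ => by positivity)] at h1
  simpa using h1 i (Finset.mem_univ i)

variable [DecidableEq ι]

theorem mem_unitary_of_conjTranspose_mul_self {W : Matrix ι ι 𝕂} (h : Wᴴ * W = 1) :
    W ∈ unitary (Matrix ι ι 𝕂) :=
  Unitary.mem_iff.2 ⟨h, mul_eq_one_comm.1 h⟩

theorem mem_unitary_of_mul_conjTranspose {W : Matrix ι ι 𝕂} (h : W * Wᴴ = 1) :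
    W ∈ unitary (Matrix ι ι 𝕂) :=
  Unitary.mem_iff.2 ⟨mul_eq_one_comm.1 h, h⟩

/-- A (generalised) unitary reflection takes a vector to any other vector of the same length. -/
theorem exists_unitary_reflection (c d : Matrix ι Unit 𝕂) (h : cᴴ * c = dᴴ * d) :
    ∃ W ∈ unitary (Matrix ι ι 𝕂), W * d = c ∧
      ∀ e : Matrix ι Unit 𝕂, (d - c)ᴴ * e = 0 → W * e = e := by
  rcases eq_or_ne d c with rfl | hdc
  · exact ⟨1, one_mem _, by simp, by simp⟩
  set v := d - c with hv
  -- The reflection is W = 1 - v S⁻¹ v* with v = d - c and S = v* d. Equality of the lengths of c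
  -- and d amounts to v* v = S + S*, which is what makes W unitary. The scalar S need not be real,
  -- so 2 / (v* v) would not do.
  set S : Matrix Unit Unit 𝕂 := vᴴ * d with hS
  have hvv : vᴴ * v = S + Sᴴ := by
    simp only [hS, hv, Matrix.conjTranspose_sub, Matrix.conjTranspose_mul, Matrix.sub_mul,
      Matrix.mul_sub, h, Matrix.conjTranspose_conjTranspose]
    abel
  have hS0 : S () () ≠ 0 := by
    intro h0
    have hS' : S = 0 := by ext i j; exact h0
    rw [hS', Matrix.conjTranspose_zero, add_zero, conjTranspose_mul_self_eq_zero_iff] at hvv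
    exact hdc (sub_eq_zero.1 hvv)
  set T : Matrix Unit Unit 𝕂 := Matrix.of fun _ _ => (S () ())⁻¹ with hT
  have hTS : T * S = 1 := by
    ext i j
    simp [Matrix.mul_apply, hT, inv_mul_cancel₀ hS0]
  have hTS' : Sᴴ * Tᴴ = 1 := by rw [← Matrix.conjTranspose_mul, hTS, Matrix.conjTranspose_one]
  refine ⟨1 - v * T * vᴴ, mem_unitary_of_mul_conjTranspose ?_, ?_, fun e he => ?_⟩
  · have h1 : v * T * vᴴ * (v * T * vᴴ)ᴴ = v * Tᴴ * vᴴ + v * T * vᴴ := by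
      calc v * T * vᴴ * (v * T * vᴴ)ᴴ = v * (T * (vᴴ * v) * Tᴴ) * vᴴ := by
            simp only [Matrix.conjTranspose_mul, Matrix.conjTranspose_conjTranspose,
              Matrix.mul_assoc]
        _ = v * ((T * S) * Tᴴ + T * (Sᴴ * Tᴴ)) * vᴴ := by
            rw [hvv, Matrix.mul_add, Matrix.add_mul, Matrix.mul_assoc T Sᴴ]
        _ = _ := by
            rw [hTS, hTS', Matrix.one_mul, Matrix.mul_one, Matrix.mul_add, Matrix.add_mul]
    have h2 : (v * T * vᴴ)ᴴ = v * Tᴴ * vᴴ := by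
      simp only [Matrix.conjTranspose_mul, Matrix.conjTranspose_conjTranspose, Matrix.mul_assoc]
    rw [Matrix.conjTranspose_sub (1 : Matrix ι ι 𝕂), Matrix.conjTranspose_one, Matrix.sub_mul,
      Matrix.mul_sub,
      Matrix.mul_sub, h1, h2]
    simp only [Matrix.mul_one, Matrix.one_mul]
    abel
  · rw [Matrix.sub_mul, Matrix.one_mul, Matrix.mul_assoc, ← hS, Matrix.mul_assoc, hTS,
      Matrix.mul_one, hv, sub_sub_cancel]
  · rw [Matrix.sub_mul, Matrix.one_mul, Matrix.mul_assoc, he, Matrix.mul_zero, sub_zero]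

/-- The column `j` of a matrix, as a one-column matrix. -/
def colMatrix {κ : Type*} (X : Matrix ι κ 𝕂) (j : κ) : Matrix ι Unit 𝕂 := X.submatrix id fun _ => j

theorem colMatrix_mul {κ : Type*} (W : Matrix ι ι 𝕂) (X : Matrix ι κ 𝕂) (j : κ) :
    colMatrix (W * X) j = W * colMatrix X j := by
  ext i k; simp [colMatrix, Matrix.mul_apply]

theorem conjTranspose_colMatrix_mul {κ : Type*} (X Y : Matrix ι κ 𝕂) (j k : κ) :
    (colMatrix X j)ᴴ * colMatrix Y k = (Xᴴ * Y).submatrix (fun _ => j) (fun _ => k) := by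
  ext i l; simp [colMatrix, Matrix.mul_apply]

/-- The columns of Y are moved onto those of X one at a time. The reflection used for column k
leaves the columns already in place fixed, because the two Gram matrices agree. -/
theorem exists_unitary_mul_eq {N : ℕ} {X Y : Matrix ι (Fin N) 𝕂} (h : Xᴴ * X = Yᴴ * Y) :
    ∃ W ∈ unitary (Matrix ι ι 𝕂), X = W * Y := by
  have key : ∀ k : ℕ, k ≤ N → ∃ W ∈ unitary (Matrix ι ι 𝕂), ∀ j : Fin N, (j : ℕ) < k →
      colMatrix (W * Y) j = colMatrix X j := by
    intro k
    induction k with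
    | zero => exact fun _ => ⟨1, one_mem _, fun j hj => absurd hj (by omega)⟩
    | succ k ih =>
      intro hk
      obtain ⟨W, hW, hWY⟩ := ih (by omega)
      have hWY2 : (W * Y)ᴴ * (W * Y) = Xᴴ * X := by
        rw [Matrix.conjTranspose_mul, Matrix.mul_assoc, ← Matrix.mul_assoc Wᴴ,
          ← Matrix.star_eq_conjTranspose W, (Unitary.mem_iff.1 hW).1, Matrix.one_mul, h]
      obtain ⟨R, hR, hRd, hRe⟩ := exists_unitary_reflection (colMatrix X ⟨k, hk⟩)
        (colMatrix (W * Y) ⟨k, hk⟩) (by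
          rw [conjTranspose_colMatrix_mul, conjTranspose_colMatrix_mul, hWY2])
      refine ⟨R * W, mul_mem hR hW, fun j hj => ?_⟩
      rw [Matrix.mul_assoc, colMatrix_mul]
      rcases Nat.lt_succ_iff_lt_or_eq.1 hj with hj | hj
      -- An earlier column has the same inner product with the current column k and with its target,
      -- so it is orthogonal to their difference and the reflection fixes it.
      · rw [← hWY j hj]
        refine hRe _ ?_
        rw [Matrix.conjTranspose_sub, Matrix.sub_mul, conjTranspose_colMatrix_mul, hWY j hj,
          conjTranspose_colMatrix_mul, sub_eq_zero, ← hWY2, ← conjTranspose_colMatrix_mul,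
          hWY j hj]
      · have : j = ⟨k, hk⟩ := Fin.ext hj
        rw [this, hRd]
  obtain ⟨W, hW, hWY⟩ := key N le_rfl
  refine ⟨W, hW, ?_⟩
  ext i j
  exact (congrFun (congrFun (hWY j j.2) i) ()).symm

theorem exists_unitary_eq_mul {N : ℕ} {X Y : Matrix (Fin N) ι 𝕂} (h : X * Xᴴ = Y * Yᴴ) :
    ∃ W ∈ unitary (Matrix ι ι 𝕂), X = Y * W := by
  obtain ⟨W, hW, hXY⟩ := exists_unitary_mul_eq (X := Xᴴ) (Y := Yᴴ) (by simpa using h)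
  refine ⟨Wᴴ, Unitary.star_mem hW, ?_⟩
  rw [← Matrix.conjTranspose_conjTranspose X, hXY]
  simp

end reflection

/-! ### Compactness of the unitary group and its Haar measure -/

section topology

variable {𝕂 : Type} [NormedDivisionRing 𝕂] [NormedAlgebra ℝ 𝕂] [StarRing 𝕂]
  [hK : IsCompositionField 𝕂]

theorem UGroup.norm_apply_le_one {n : ℕ} {V : Matrix (Fin n) (Fin n) 𝕂} (hV : V ∈ UGroup 𝕂 n)
    (i j : Fin n) : ‖V i j‖ ≤ 1 := by
  have h := conjTranspose_mul_self_apply_self V j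
  rw [← Matrix.star_eq_conjTranspose, (Unitary.mem_iff.1 hV).1, Matrix.one_apply_eq,
    ← map_one (algebraMap ℝ 𝕂)] at h
  have h1 : ‖V i j‖ ^ 2 ≤ 1 := by
    rw [(algebraMap ℝ 𝕂).injective h]
    exact Finset.single_le_sum (f := fun i => ‖V i j‖ ^ 2) (fun _ _ => by positivity)
      (Finset.mem_univ i)
  exact (sq_le_one_iff₀ (norm_nonneg _)).1 h1

instance UGroup.instCompactSpace (n : ℕ) : CompactSpace (UGroup 𝕂 n) := by
  refine isCompact_iff_compactSpace (s := (UGroup 𝕂 n : Set (Matrix (Fin n) (Fin n) 𝕂))).1 ?_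
  have hc : IsCompact (Set.univ.pi fun _ : Fin n => Set.univ.pi fun _ : Fin n =>
      Metric.closedBall (0 : 𝕂) 1) :=
    isCompact_univ_pi fun _ => isCompact_univ_pi fun _ => isCompact_closedBall _ _
  refine hc.of_isClosed_subset (isClosed_unitary (R := Matrix (Fin n) (Fin n) 𝕂)) ?_
  intro V hV i _ j _
  simpa using UGroup.norm_apply_le_one hV i j

variable [MeasurableSpace 𝕂] [BorelSpace 𝕂]

instance matrixBorelSpace (m n : ℕ) : BorelSpace (Matrix (Fin m) (Fin n) 𝕂) :=
  inferInstanceAs (BorelSpace (Fin m → Fin n → 𝕂))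

instance matrixSecondCountable (m n : ℕ) :
    SecondCountableTopology (Matrix (Fin m) (Fin n) 𝕂) :=
  inferInstanceAs (SecondCountableTopology (Fin m → Fin n → 𝕂))

instance UGroup.instSecondCountable (n : ℕ) : SecondCountableTopology (UGroup 𝕂 n) :=
  inferInstanceAs (SecondCountableTopology (UGroup 𝕂 n : Set (Matrix (Fin n) (Fin n) 𝕂)))

variable (𝕂) in
/-- The Haar probability measure on `UGroup 𝕂 n`. -/
noncomputable def haarU (n : ℕ) : Measure (UGroup 𝕂 n) := Measure.haarMeasure ⊤

instance (n : ℕ) : (haarU 𝕂 n).IsHaarMeasure := inferInstanceAs (Measure.haarMeasure ⊤).IsHaarMeasure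

instance (n : ℕ) : IsProbabilityMeasure (haarU 𝕂 n) :=
  ⟨Measure.haarMeasure_self (K₀ := (⊤ : TopologicalSpace.PositiveCompacts (UGroup 𝕂 n)))⟩

theorem eq_haarU {n : ℕ} (μ : Measure (UGroup 𝕂 n)) [μ.IsHaarMeasure] [IsProbabilityMeasure μ] :
    μ = haarU 𝕂 n := Measure.isHaarMeasure_eq_of_isProbabilityMeasure _ _

theorem measurePreserving_mul_left_haarU {n : ℕ} (g : UGroup 𝕂 n) :
    MeasurePreserving (fun u => g * u) (haarU 𝕂 n) (haarU 𝕂 n) :=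
  measurePreserving_mul_left _ g

/-- A right translate of the Haar probability measure is again a left Haar probability measure, and
there is only one. -/
theorem measurePreserving_mul_right_haarU {n : ℕ} (g : UGroup 𝕂 n) :
    MeasurePreserving (fun u => u * g) (haarU 𝕂 n) (haarU 𝕂 n) := by
  refine ⟨measurable_mul_const g, ?_⟩
  have h1 : ((haarU 𝕂 n).map fun u => u * g).IsHaarMeasure := inferInstance
  have h2 : IsProbabilityMeasure ((haarU 𝕂 n).map fun u => u * g) :=
    Measure.isProbabilityMeasure_map (measurable_mul_const g).aemeasurable
  exact eq_haarU _

theorem measurePreserving_inv_haarU (n : ℕ) :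
    MeasurePreserving (fun u => u⁻¹) (haarU 𝕂 n) (haarU 𝕂 n) := by
  refine ⟨measurable_inv, ?_⟩
  have h0 : (haarU 𝕂 n).IsMulRightInvariant := ⟨fun g => (measurePreserving_mul_right_haarU g).map_eq⟩
  have h2 : IsProbabilityMeasure ((haarU 𝕂 n).map fun u => u⁻¹) :=
    Measure.isProbabilityMeasure_map measurable_inv.aemeasurable
  have h1 : ((haarU 𝕂 n).map fun u => u⁻¹).IsMulLeftInvariant :=
    inferInstanceAs (haarU 𝕂 n).inv.IsMulLeftInvariant
  have h3 : ((haarU 𝕂 n).map fun u => u⁻¹).IsHaarMeasure :=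
    Measure.isHaarMeasure_of_isCompact_nonempty_interior _ Set.univ isCompact_univ (by simp)
      (by simp) (by simp)
  exact eq_haarU _

end topology

/-! ### Block matrices and the variational step of the spectral theorem -/

section spectral

variable {𝕂 : Type} [NormedDivisionRing 𝕂] [NormedAlgebra ℝ 𝕂] [StarRing 𝕂]
  [hK : IsCompositionField 𝕂]

/-- The block diagonal matrix with blocks `A`, `B`, along a splitting of the index type. -/
def blockDiag {ι₁ ι₂ ι : Type*} (e : ι₁ ⊕ ι₂ ≃ ι) (A : Matrix ι₁ ι₁ 𝕂) (B : Matrix ι₂ ι₂ 𝕂) :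
    Matrix ι ι 𝕂 := (Matrix.fromBlocks A 0 0 B).submatrix e.symm e.symm

section blockDiag

variable {ι₁ ι₂ ι κ : Type*} [Fintype ι₁] [Fintype ι₂] [Fintype ι] [DecidableEq ι₁]
  [DecidableEq ι₂] [DecidableEq ι] (e : ι₁ ⊕ ι₂ ≃ ι)

theorem blockDiag_mul (A A' : Matrix ι₁ ι₁ 𝕂) (B B' : Matrix ι₂ ι₂ 𝕂) :
    blockDiag e A B * blockDiag e A' B' = blockDiag e (A * A') (B * B') := by
  simp [blockDiag, Matrix.submatrix_mul_equiv, Matrix.fromBlocks_multiply]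

theorem blockDiag_one : blockDiag e (1 : Matrix ι₁ ι₁ 𝕂) 1 = 1 := by
  simp [blockDiag]

theorem blockDiag_conjTranspose (A : Matrix ι₁ ι₁ 𝕂) (B : Matrix ι₂ ι₂ 𝕂) :
    (blockDiag e A B)ᴴ = blockDiag e Aᴴ Bᴴ := by
  simp [blockDiag, Matrix.conjTranspose_submatrix, Matrix.fromBlocks_conjTranspose]

theorem blockDiag_mem_unitary {A : Matrix ι₁ ι₁ 𝕂} {B : Matrix ι₂ ι₂ 𝕂}
    (hA : A ∈ unitary (Matrix ι₁ ι₁ 𝕂)) (hB : B ∈ unitary (Matrix ι₂ ι₂ 𝕂)) :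
    blockDiag e A B ∈ unitary (Matrix ι ι 𝕂) := by
  rw [Unitary.mem_iff] at *
  simp only [Matrix.star_eq_conjTranspose] at *
  simp [blockDiag_conjTranspose, blockDiag_mul, hA, hB, blockDiag_one]

theorem submatrix_mul_blockDiag_inl {ρ γ : Type*} (U : Matrix ι ι 𝕂) (A : Matrix ι₁ ι₁ 𝕂)
    (B : Matrix ι₂ ι₂ 𝕂) (f : ρ → ι) (g : γ → ι₁) :
    (U * blockDiag e A B).submatrix f (fun j => e (Sum.inl (g j))) =
      U.submatrix f (fun j => e (Sum.inl j)) * A.submatrix id g := by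
  ext i j
  simp [Matrix.mul_apply, blockDiag, ← e.sum_comp]

theorem submatrix_mul_blockDiag_inr {ρ γ : Type*} (U : Matrix ι ι 𝕂) (A : Matrix ι₁ ι₁ 𝕂)
    (B : Matrix ι₂ ι₂ 𝕂) (f : ρ → ι) (g : γ → ι₂) :
    (U * blockDiag e A B).submatrix f (fun j => e (Sum.inr (g j))) =
      U.submatrix f (fun j => e (Sum.inr j)) * B.submatrix id g := by
  ext i j
  simp [Matrix.mul_apply, blockDiag, ← e.sum_comp]

end blockDiag

/-- The real diagonal matrix with entries `x`. -/
noncomputable def realDiag (𝕂 : Type) [NormedDivisionRing 𝕂] [NormedAlgebra ℝ 𝕂] {ι : Type*} [DecidableEq ι]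
    (x : ι → ℝ) : Matrix ι ι 𝕂 := Matrix.diagonal fun i => algebraMap ℝ 𝕂 (x i)

theorem realDiag_conjTranspose {ι : Type*} [DecidableEq ι] (x : ι → ℝ) :
    (realDiag 𝕂 x)ᴴ = realDiag 𝕂 x := by
  simp [realDiag, Matrix.diagonal_conjTranspose, Pi.star_def, star_algebraMap_real]

theorem realDiag_mul {ι : Type*} [Fintype ι] [DecidableEq ι] (x y : ι → ℝ) :
    realDiag 𝕂 x * realDiag 𝕂 y = realDiag 𝕂 (fun i => x i * y i) := by
  simp [realDiag, Matrix.diagonal_mul_diagonal]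

theorem exists_unitary_apply_eq {n : ℕ} (u : Fin n → 𝕂) (hu : ∑ i, ‖u i‖ ^ 2 = 1) (j : Fin n) :
    ∃ W ∈ UGroup 𝕂 n, ∀ i, W i j = u i := by
  obtain ⟨W, hW, h, -⟩ := exists_unitary_reflection (Matrix.of fun i (_ : Unit) => u i)
    (colMatrix (1 : Matrix (Fin n) (Fin n) 𝕂) j) (by
    ext a b
    rw [conjTranspose_mul_self_apply_self (Matrix.of fun i (_ : Unit) => u i) a,
      conjTranspose_colMatrix_mul]
    simp [hu])
  refine ⟨W, hW, fun i => ?_⟩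
  rw [← colMatrix_mul, Matrix.mul_one] at h
  exact congrFun (congrFun h i) ()

/-- A unitary change of the columns which maximises the length of the first column makes this
column orthogonal to the others. -/
theorem exists_unitary_first_column_orthogonal {m N : ℕ} (X : Matrix (Fin m) (Fin (N + 1)) 𝕂) :
    ∃ V ∈ UGroup 𝕂 (N + 1), ∀ j : Fin N, ((X * V)ᴴ * (X * V)) 0 j.succ = 0 := by
  have hcont : Continuous fun V : UGroup 𝕂 (N + 1) =>
      ∑ i, ‖(X * (V : Matrix (Fin (N + 1)) (Fin (N + 1)) 𝕂)) i 0‖ ^ 2 := by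
    refine continuous_finsetSum _ fun i _ => ((Continuous.norm ?_).pow 2)
    exact (continuous_const.matrix_mul continuous_subtype_val).matrix_elem i 0
  obtain ⟨⟨V, hV⟩, -, hmax⟩ :=
    isCompact_univ.exists_isMaxOn ⟨1, Set.mem_univ _⟩ hcont.continuousOn
  refine ⟨V, hV, fun j => ?_⟩
  set Z := X * V with hZ
  set lam := ∑ i, ‖Z i 0‖ ^ 2 with hlam
  set g := (Zᴴ * Z) 0 j.succ with hg
  set b := ∑ i, ‖Z i j.succ‖ ^ 2 with hb
  have hlam0 : 0 ≤ lam := by positivity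
  have hb0 : 0 ≤ b := by positivity
  -- Every unit vector u is the first column of some unitary W, so V * W competes with the maximiser
  -- V.
  have hunit : ∀ u : Fin (N + 1) → 𝕂, ∑ k, ‖u k‖ ^ 2 = 1 →
      ∑ i, ‖∑ k, Z i k * u k‖ ^ 2 ≤ lam := by
    intro u hu
    obtain ⟨W, hW, hWu⟩ := exists_unitary_apply_eq u hu 0
    have h := hmax (Set.mem_univ (⟨V * W, mul_mem hV hW⟩ : UGroup 𝕂 (N + 1)))
    simp only [Set.mem_ofPred_eq, ← Matrix.mul_assoc, ← hZ] at h
    have hZW : ∀ i, (Z * W) i 0 = ∑ k, Z i k * u k := fun i => by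
      simp only [Matrix.mul_apply, hWu]
    simpa only [hZW] using h
  have hall : ∀ u : Fin (N + 1) → 𝕂, 0 < ∑ k, ‖u k‖ ^ 2 →
      ∑ i, ‖∑ k, Z i k * u k‖ ^ 2 ≤ lam * ∑ k, ‖u k‖ ^ 2 := by
    intro u hu
    set s := ∑ k, ‖u k‖ ^ 2 with hs
    have hs2 : ∀ x : 𝕂, ‖(√s)⁻¹ • x‖ ^ 2 = s⁻¹ * ‖x‖ ^ 2 := by
      intro x
      rw [norm_smul, mul_pow, Real.norm_eq_abs, sq_abs, inv_pow, Real.sq_sqrt hu.le]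
    have h := hunit (fun k => (√s)⁻¹ • u k) (by
      simp only [hs2, ← Finset.mul_sum, ← hs]
      exact inv_mul_cancel₀ hu.ne')
    simp only [mul_smul_comm, ← Finset.smul_sum, hs2, ← Finset.mul_sum] at h
    rw [inv_mul_le_iff₀ hu] at h
    linarith
  have hquad : ∀ r : ℝ, lam + 2 * r * ‖g‖ ^ 2 + r ^ 2 * ‖g‖ ^ 2 * b ≤ lam * (1 + r ^ 2 * ‖g‖ ^ 2) := by
    intro r
    -- A perturbation of the first basis vector. The factor star g makes the cross term the real
    -- number 2 r ‖g‖².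
    set u : Fin (N + 1) → 𝕂 := Fin.cons 1 (Pi.single j (r • star g)) with hu
    have hu1 : ∑ k, ‖u k‖ ^ 2 = 1 + r ^ 2 * ‖g‖ ^ 2 := by
      rw [Fin.sum_univ_succ, Finset.sum_eq_single j]
      · simp [hu, norm_smul, norm_star_eq, mul_pow]
      · intro k _ hk; simp [hu, Pi.single_eq_of_ne hk]
      · simp
    have hu2 : ∀ i, ∑ k, Z i k * u k = Z i 0 + r • (Z i j.succ * star g) := by
      intro i
      rw [Fin.sum_univ_succ, Finset.sum_eq_single j]
      · simp [hu]
      · intro k _ hk; simp [hu, Pi.single_eq_of_ne hk]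
      · simp
    have h := hall u (by rw [hu1]; positivity)
    rw [hu1] at h
    refine le_trans (le_of_eq ?_) h
    apply (algebraMap ℝ 𝕂).injective
    have hgs : ∑ i, star (Z i 0) * (Z i j.succ * star g) = algebraMap ℝ 𝕂 (‖g‖ ^ 2) := by
      rw [← mul_star_self_eq, hg, Matrix.mul_apply, Finset.sum_mul]
      simp [mul_assoc]
    have hgs' : ∑ i, star (Z i j.succ * star g) * Z i 0 = algebraMap ℝ 𝕂 (‖g‖ ^ 2) := by
      rw [← star_algebraMap_real, ← hgs, star_sum]
      simp
    have hterm : ∀ i, algebraMap ℝ 𝕂 (‖Z i 0 + r • (Z i j.succ * star g)‖ ^ 2) =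
        algebraMap ℝ 𝕂 (‖Z i 0‖ ^ 2) + (r • (star (Z i 0) * (Z i j.succ * star g)) +
          r • (star (Z i j.succ * star g) * Z i 0)) +
          algebraMap ℝ 𝕂 (r ^ 2 * ‖g‖ ^ 2 * ‖Z i j.succ‖ ^ 2) := by
      intro i
      have hb2 : ‖r • (Z i j.succ * star g)‖ ^ 2 = r ^ 2 * ‖g‖ ^ 2 * ‖Z i j.succ‖ ^ 2 := by
        rw [norm_smul, norm_mul, norm_star_eq, mul_pow, mul_pow, Real.norm_eq_abs, sq_abs]; ring
      rw [← hb2, ← star_mul_self_eq, ← star_mul_self_eq, ← star_mul_self_eq (r • _)]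
      have hst : star (r • (Z i j.succ * star g)) = r • star (Z i j.succ * star g) := by
        rw [Algebra.smul_def, star_mul, star_algebraMap_real, Algebra.smul_def, Algebra.commutes]
      rw [star_add, hst]
      simp only [add_mul, mul_add, smul_mul_assoc, mul_smul_comm, smul_add]
      abel
    simp only [hu2, map_sum, hterm, Finset.sum_add_distrib, ← Finset.smul_sum, hgs, hgs']
    rw [← map_sum, ← map_sum, ← Finset.mul_sum, ← hlam, ← hb, Algebra.smul_def, ← map_mul,
      ← map_add, ← map_add, ← map_add]
    congr 1
    ring
  by_contra hne
  have hg0 : 0 < ‖g‖ ^ 2 := by positivity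
  -- For this r one has lam r² ≤ r, so the bound lam r² ‖g‖² cannot dominate the first order gain 2
  -- r ‖g‖² unless g = 0.
  have h := hquad (1 / (lam + 1))
  have h1 : 0 < lam + 1 := by positivity
  have h2 : 0 ≤ (1 / (lam + 1)) ^ 2 * ‖g‖ ^ 2 * b := by positivity
  have h3 : 2 * (1 / (lam + 1)) * ‖g‖ ^ 2 ≤ lam * ((1 / (lam + 1)) ^ 2 * ‖g‖ ^ 2) := by nlinarith
  have h4 : lam * ((1 / (lam + 1)) ^ 2 * ‖g‖ ^ 2) =
      (lam / (lam + 1)) * (1 / (lam + 1) * ‖g‖ ^ 2) := by field_simp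
  have h5 : lam / (lam + 1) ≤ 1 := by rw [div_le_one h1]; linarith
  have h6 : 0 < 1 / (lam + 1) * ‖g‖ ^ 2 := by positivity
  nlinarith

end spectral

/-! ### Spectral theorem for Gram matrices, uniqueness, singular value decomposition -/

section eigenvalues

variable {𝕂 : Type} [NormedDivisionRing 𝕂] [NormedAlgebra ℝ 𝕂] [StarRing 𝕂]
  [hK : IsCompositionField 𝕂]

/-- Induction on the number of columns: once the first column is orthogonal to the others, the Gram
matrix splits into a real scalar and the Gram matrix of the remaining columns. -/
theorem exists_unitary_diagonalization {m : ℕ} :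
    ∀ {N : ℕ} (X : Matrix (Fin m) (Fin N) 𝕂), ∃ V ∈ UGroup 𝕂 N, ∃ x : Fin N → ℝ,
      Xᴴ * X = V * realDiag 𝕂 x * star V
  | 0, X => ⟨1, one_mem _, 0, by ext i; exact i.elim0⟩
  | N + 1, X => by
    obtain ⟨V, hV, hort⟩ := exists_unitary_first_column_orthogonal X
    set Z := X * V with hZ
    obtain ⟨V', hV', x, hx⟩ := exists_unitary_diagonalization (Z.submatrix id Fin.succ)
    let e : Fin 1 ⊕ Fin N ≃ Fin (N + 1) := finSumFinEquiv.trans (finCongr (add_comm 1 N))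
    have he1 : ∀ i : Fin 1, e (Sum.inl i) = 0 := by
      intro i; ext; simp [e]
    have he2 : ∀ i : Fin N, e (Sum.inr i) = i.succ := by
      intro i; ext; simp [e]
    set lam : ℝ := ∑ i, ‖Z i 0‖ ^ 2
    have hE := blockDiag_mem_unitary e (one_mem (unitary (Matrix (Fin 1) (Fin 1) 𝕂))) hV'
    have hG : Zᴴ * Z = blockDiag e (realDiag 𝕂 fun _ => lam) (V' * realDiag 𝕂 x * star V') := by
      rw [← hx, blockDiag, ← Matrix.submatrix_id_id (Zᴴ * Z), ← e.self_comp_symm,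
        ← Matrix.submatrix_submatrix]
      congr 1
      ext i j
      have hort' : ∀ j : Fin N, (Zᴴ * Z) j.succ 0 = 0 := by
        intro j
        have h : (Zᴴ * Z)ᴴ = Zᴴ * Z := by simp
        rw [← h, Matrix.conjTranspose_apply, hort, star_zero]
      rcases i with i | i <;> rcases j with j | j
      · have hij : i = j := Subsingleton.elim _ _
        subst hij
        simp only [Matrix.submatrix_apply, he1, conjTranspose_mul_self_apply_self]
        simp [realDiag, lam]
      · simp only [Matrix.submatrix_apply, he1, he2, hort]
        simp
      · simp only [Matrix.submatrix_apply, he1, he2, hort']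
        simp
      · simp only [Matrix.submatrix_apply, he2]
        simp [Matrix.mul_apply]
    refine ⟨V * blockDiag e 1 V', mul_mem hV hE, fun i => Sum.elim (fun _ => lam) x (e.symm i), ?_⟩
    have hD : realDiag 𝕂 (fun i => Sum.elim (fun _ => lam) x (e.symm i)) =
        blockDiag e (realDiag 𝕂 fun _ => lam) (realDiag 𝕂 x) := by
      rw [blockDiag, realDiag, realDiag, realDiag, Matrix.fromBlocks_diagonal,
        Matrix.submatrix_diagonal_equiv]
      congr 1
      ext i
      simp only [Function.comp_apply]
      rcases e.symm i with j | j <;> rfl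
    have hXZ : Xᴴ * X = V * (Zᴴ * Z) * star V := by
      rw [hZ, Matrix.conjTranspose_mul, ← Matrix.star_eq_conjTranspose V]
      have h1 := (Unitary.mem_iff.1 hV).2
      calc Xᴴ * X = (V * star V) * (Xᴴ * X) * (V * star V) := by rw [h1]; simp
        _ = _ := by simp only [Matrix.mul_assoc]
    rw [hXZ, hG, star_mul, Matrix.star_eq_conjTranspose (blockDiag _ _ _), blockDiag_conjTranspose,
      hD]
    simp only [Matrix.mul_assoc, ← Matrix.mul_assoc (blockDiag _ _ _), blockDiag_mul]
    simp [Matrix.star_eq_conjTranspose]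

theorem exists_isOrderedEigenvalues {m N : ℕ} (X : Matrix (Fin m) (Fin N) 𝕂) :
    ∃ x, IsOrderedEigenvalues (Xᴴ * X) x := by
  obtain ⟨V, hV, x, hx⟩ := exists_unitary_diagonalization X
  set σ := Tuple.sort (fun i => -x i) with hσ
  refine ⟨x ∘ σ, fun i j hij => ?_, V.submatrix id σ, ?_, ?_⟩
  · have := Tuple.monotone_sort (fun i => -x i) hij
    simp only [Function.comp_apply] at this ⊢
    linarith
  · refine mem_unitary_of_mul_conjTranspose ?_
    have := Matrix.submatrix_mul_equiv V Vᴴ (id : Fin N → Fin N) σ id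
    rw [Matrix.conjTranspose_submatrix, this, ← Matrix.star_eq_conjTranspose,
      (Unitary.mem_iff.1 hV).2]
    simp
  · have h1 : Matrix.diagonal (fun i => algebraMap ℝ 𝕂 ((x ∘ σ) i)) =
        (realDiag 𝕂 x).submatrix σ σ := by
      rw [realDiag, Matrix.submatrix_diagonal_equiv]; rfl
    rw [h1, hx, Matrix.star_eq_conjTranspose, Matrix.star_eq_conjTranspose,
      Matrix.conjTranspose_submatrix, Matrix.submatrix_mul_equiv, Matrix.submatrix_mul_equiv]
    simp

/-- Q = W* V intertwines the two diagonal matrices, so Q i j = 0 unless x j = y i, while the numbers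
‖Q i j‖² form a doubly stochastic matrix. No characteristic polynomial is involved, so the argument
covers ℍ. -/
theorem IsOrderedEigenvalues.sum_comp_eq {N : ℕ} {A : Matrix (Fin N) (Fin N) 𝕂} {x y : Fin N → ℝ}
    (hx : IsOrderedEigenvalues A x) (hy : IsOrderedEigenvalues A y) (f : ℝ → ℝ) :
    ∑ i, f (x i) = ∑ i, f (y i) := by
  obtain ⟨-, V, hV, hAV⟩ := hx
  obtain ⟨-, W, hW, hAW⟩ := hy
  set Q := star W * V with hQ
  have hQU : Q ∈ UGroup 𝕂 N := mul_mem (Unitary.star_mem hW) hV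
  have hQD : Q * realDiag 𝕂 x = realDiag 𝕂 y * Q := by
    have h := hAV.symm.trans hAW
    calc Q * realDiag 𝕂 x = star W * (V * realDiag 𝕂 x * star V) * V := by
          simp only [hQ, Matrix.mul_assoc, (Unitary.mem_iff.1 hV).1, Matrix.mul_one]
      _ = star W * (W * realDiag 𝕂 y * star W) * V := by rw [realDiag, realDiag, h]
      _ = (star W * W) * realDiag 𝕂 y * Q := by simp only [hQ, Matrix.mul_assoc]
      _ = _ := by rw [(Unitary.mem_iff.1 hW).1, Matrix.one_mul]
  have hij : ∀ i j, ‖Q i j‖ ^ 2 * f (x j) = ‖Q i j‖ ^ 2 * f (y i) := by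
    intro i j
    have h := congrFun (congrFun hQD i) j
    rw [realDiag, realDiag, Matrix.mul_diagonal, Matrix.diagonal_mul, ← Algebra.commutes,
      ← sub_eq_zero, ← sub_mul, ← map_sub, mul_eq_zero, map_eq_zero] at h
    rcases h with h | h
    · rw [sub_eq_zero.1 h]
    · simp [h]
  have hcol : ∀ j, ∑ i, ‖Q i j‖ ^ 2 = 1 := by
    intro j
    have h := conjTranspose_mul_self_apply_self Q j
    rw [← Matrix.star_eq_conjTranspose, (Unitary.mem_iff.1 hQU).1, Matrix.one_apply_eq,
      ← map_one (algebraMap ℝ 𝕂)] at h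
    exact ((algebraMap ℝ 𝕂).injective h).symm
  have hrow : ∀ i, ∑ j, ‖Q i j‖ ^ 2 = 1 := by
    intro i
    have h := conjTranspose_mul_self_apply_self Qᴴ i
    rw [Matrix.conjTranspose_conjTranspose, ← Matrix.star_eq_conjTranspose,
      (Unitary.mem_iff.1 hQU).2, Matrix.one_apply_eq, ← map_one (algebraMap ℝ 𝕂)] at h
    simpa [norm_star_eq] using ((algebraMap ℝ 𝕂).injective h).symm
  calc ∑ j, f (x j) = ∑ j, ∑ i, ‖Q i j‖ ^ 2 * f (x j) := by
        simp only [← Finset.sum_mul, hcol, one_mul]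
    _ = ∑ i, ∑ j, ‖Q i j‖ ^ 2 * f (y i) := by rw [Finset.sum_comm]; simp only [hij]
    _ = ∑ i, f (y i) := by simp only [← Finset.sum_mul, hrow, one_mul]

/-- Indicators of points in `sum_comp_eq` give equal multiplicities, so x is a rearrangement of y,
and a decreasing rearrangement is unique. -/
theorem IsOrderedEigenvalues.unique {N : ℕ} {A : Matrix (Fin N) (Fin N) 𝕂} {x y : Fin N → ℝ}
    (hx : IsOrderedEigenvalues A x) (hy : IsOrderedEigenvalues A y) : x = y := by
  have hcount : ∀ c : ℝ, Fintype.card {i // x i = c} = Fintype.card {i // y i = c} := by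
    intro c
    have h := hx.sum_comp_eq hy (fun t => if t = c then 1 else 0)
    simp only [Finset.sum_boole] at h
    rw [Fintype.card_subtype, Fintype.card_subtype]
    exact_mod_cast h
  let σ : Equiv.Perm (Fin N) := (Equiv.sigmaFiberEquiv x).symm.trans
    ((Equiv.sigmaCongrRight fun c => (Fintype.equivOfCardEq (hcount c))).trans
      (Equiv.sigmaFiberEquiv y))
  have hσ : y ∘ σ = x := by
    ext i
    exact (Fintype.equivOfCardEq (hcount (x i)) ⟨i, rfl⟩).2
  have h := Tuple.unique_antitone (f := y) (σ := σ) (τ := 1) (by rw [hσ]; exact hx.1)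
    (by simpa using hy.1)
  rw [hσ] at h
  simpa using h

theorem sqSingularValues_spec {m N : ℕ} (X : Matrix (Fin m) (Fin N) 𝕂) :
    IsOrderedEigenvalues (Xᴴ * X) (sqSingularValues X) := by
  rw [sqSingularValues, dif_pos (exists_isOrderedEigenvalues X)]
  exact (exists_isOrderedEigenvalues X).choose_spec

theorem sqSingularValues_eq {m N : ℕ} {X : Matrix (Fin m) (Fin N) 𝕂} {x : Fin N → ℝ}
    (h : IsOrderedEigenvalues (Xᴴ * X) x) : sqSingularValues X = x :=
  (sqSingularValues_spec X).unique h

theorem sqSingularValues_antitone {m N : ℕ} (X : Matrix (Fin m) (Fin N) 𝕂) :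
    Antitone (sqSingularValues X) := (sqSingularValues_spec X).1

theorem sqSingularValues_congr {m m' N : ℕ} {X : Matrix (Fin m) (Fin N) 𝕂}
    {Y : Matrix (Fin m') (Fin N) 𝕂} (h : Xᴴ * X = Yᴴ * Y) :
    sqSingularValues X = sqSingularValues Y :=
  sqSingularValues_eq (h ▸ sqSingularValues_spec Y)

theorem conjTranspose_unitary_mul_mul {m N : ℕ} {W : Matrix (Fin m) (Fin m) 𝕂}
    (hW : W ∈ UGroup 𝕂 m) (X : Matrix (Fin m) (Fin N) 𝕂) : (W * X)ᴴ * (W * X) = Xᴴ * X := by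
  rw [Matrix.conjTranspose_mul, Matrix.mul_assoc, ← Matrix.mul_assoc Wᴴ,
    ← Matrix.star_eq_conjTranspose W, (Unitary.mem_iff.1 hW).1, Matrix.one_mul]

theorem sqSingularValues_unitary_mul {m N : ℕ} {W : Matrix (Fin m) (Fin m) 𝕂}
    (hW : W ∈ UGroup 𝕂 m) (X : Matrix (Fin m) (Fin N) 𝕂) :
    sqSingularValues (W * X) = sqSingularValues X :=
  sqSingularValues_congr (conjTranspose_unitary_mul_mul hW X)

theorem sqSingularValues_mul_unitary {m N : ℕ} (X : Matrix (Fin m) (Fin N) 𝕂)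
    {V : Matrix (Fin N) (Fin N) 𝕂} (hV : V ∈ UGroup 𝕂 N) :
    sqSingularValues (X * V) = sqSingularValues X := by
  obtain ⟨h1, W, hW, h2⟩ := sqSingularValues_spec X
  refine sqSingularValues_eq ⟨h1, star V * W, mul_mem (Unitary.star_mem hV) hW, ?_⟩
  rw [Matrix.conjTranspose_mul, Matrix.mul_assoc, ← Matrix.mul_assoc Xᴴ, h2, star_mul, star_star,
    Matrix.star_eq_conjTranspose V]
  simp only [Matrix.mul_assoc]

theorem sqSingularValues_nonneg {m N : ℕ} (X : Matrix (Fin m) (Fin N) 𝕂) (i : Fin N) :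
    0 ≤ sqSingularValues X i := by
  obtain ⟨-, W, hW, h2⟩ := sqSingularValues_spec X
  have h3 : (X * W)ᴴ * (X * W) = realDiag 𝕂 (sqSingularValues X) := by
    rw [Matrix.conjTranspose_mul, Matrix.mul_assoc, ← Matrix.mul_assoc Xᴴ, h2,
      ← Matrix.star_eq_conjTranspose]
    simp only [Matrix.mul_assoc, (Unitary.mem_iff.1 hW).1, Matrix.mul_one]
    rw [← Matrix.mul_assoc, (Unitary.mem_iff.1 hW).1, Matrix.one_mul, realDiag]
  have h4 := conjTranspose_mul_self_apply_self (X * W) i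
  rw [h3, realDiag, Matrix.diagonal_apply_eq] at h4
  rw [(algebraMap ℝ 𝕂).injective h4]
  positivity

/-- The `m × N` matrix with the numbers `d j` on the diagonal. -/
noncomputable def rectDiag (𝕂 : Type) [NormedDivisionRing 𝕂] [NormedAlgebra ℝ 𝕂] (m : ℕ) {N : ℕ}
    (d : Fin N → ℝ) : Matrix (Fin m) (Fin N) 𝕂 :=
  Matrix.of fun i j => if (i : ℕ) = j then algebraMap ℝ 𝕂 (d j) else 0

theorem rectDiag_eq_submatrix_mul {m N : ℕ} (h : N ≤ m) (d : Fin N → ℝ) :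
    rectDiag 𝕂 m d = (1 : Matrix (Fin m) (Fin m) 𝕂).submatrix id (Fin.castLE h) * realDiag 𝕂 d := by
  ext i j
  simp [rectDiag, realDiag, Matrix.mul_diagonal, Matrix.one_apply, Fin.ext_iff]

theorem rectDiag_conjTranspose_mul_self {m N : ℕ} (h : N ≤ m) (d : Fin N → ℝ) :
    (rectDiag 𝕂 m d)ᴴ * rectDiag 𝕂 m d = realDiag 𝕂 fun i => d i * d i := by
  have h1 : ((1 : Matrix (Fin m) (Fin m) 𝕂).submatrix id (Fin.castLE h))ᴴ *
      (1 : Matrix (Fin m) (Fin m) 𝕂).submatrix id (Fin.castLE h) = 1 := by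
    rw [Matrix.conjTranspose_submatrix, Matrix.conjTranspose_one,
      ← Matrix.submatrix_mul _ _ _ id _ Function.bijective_id, Matrix.one_mul]
    exact Matrix.submatrix_one _ (Fin.castLE_injective h)
  rw [rectDiag_eq_submatrix_mul h, Matrix.conjTranspose_mul, realDiag_conjTranspose,
    Matrix.mul_assoc, ← Matrix.mul_assoc _ _ (realDiag 𝕂 d), h1, Matrix.one_mul, realDiag_mul]

theorem rectDiag_square {N : ℕ} (d : Fin N → ℝ) : rectDiag 𝕂 N d = realDiag 𝕂 d := by
  ext i j
  by_cases h : i = j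
  · simp [rectDiag, realDiag, h]
  · simp [rectDiag, realDiag, h, Fin.val_inj]

/-- Singular value decomposition. -/
theorem exists_singular_value_decomposition {m N : ℕ} (h : N ≤ m) (X : Matrix (Fin m) (Fin N) 𝕂) :
    ∃ W ∈ UGroup 𝕂 m, ∃ V ∈ UGroup 𝕂 N,
      X = W * rectDiag 𝕂 m (fun i => √(sqSingularValues X i)) * V := by
  obtain ⟨-, V, hV, hX⟩ := sqSingularValues_spec X
  set D := rectDiag 𝕂 m (fun i => √(sqSingularValues X i)) with hD
  obtain ⟨W, hW, hXW⟩ := exists_unitary_mul_eq (X := X) (Y := D * star V) (by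
    rw [Matrix.conjTranspose_mul, Matrix.mul_assoc, ← Matrix.mul_assoc Dᴴ, hD,
      rectDiag_conjTranspose_mul_self h, hX, ← Matrix.star_eq_conjTranspose, star_star]
    simp only [Real.mul_self_sqrt (sqSingularValues_nonneg X _), Matrix.mul_assoc, realDiag])
  exact ⟨W, hW, star V, Unitary.star_mem hV, by rw [Matrix.mul_assoc]; exact hXW⟩

/-- For a square matrix X = W D V the factor D is self-adjoint, so X* = V* D W*. -/
theorem sqSingularValues_conjTranspose {N : ℕ} (X : Matrix (Fin N) (Fin N) 𝕂) :
    sqSingularValues Xᴴ = sqSingularValues X := by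
  obtain ⟨W, hW, V, hV, hX⟩ := exists_singular_value_decomposition le_rfl X
  rw [rectDiag_square] at hX
  set D := realDiag 𝕂 fun i => √(sqSingularValues X i) with hD
  have h1 : Xᴴ = star V * D * star W := by
    conv_lhs => rw [hX]
    rw [Matrix.conjTranspose_mul, Matrix.conjTranspose_mul, hD, realDiag_conjTranspose,
      Matrix.star_eq_conjTranspose, Matrix.star_eq_conjTranspose, Matrix.mul_assoc]
  rw [h1, sqSingularValues_mul_unitary _ (Unitary.star_mem hW),
    sqSingularValues_unitary_mul (Unitary.star_mem hV)]
  conv_rhs => rw [hX, sqSingularValues_mul_unitary _ hV, sqSingularValues_unitary_mul hW]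

end eigenvalues

/-! ### Continuity of the singular values -/

section measurability

variable {𝕂 : Type} [NormedDivisionRing 𝕂] [NormedAlgebra ℝ 𝕂] [StarRing 𝕂]
  [hK : IsCompositionField 𝕂]

theorem isOrderedEigenvalues_iff {m N : ℕ} (X : Matrix (Fin m) (Fin N) 𝕂) (x : Fin N → ℝ) :
    IsOrderedEigenvalues (Xᴴ * X) x ↔ Antitone x ∧
      ∃ V : UGroup 𝕂 N, (X * (V : Matrix (Fin N) (Fin N) 𝕂))ᴴ * (X * (V : Matrix (Fin N) (Fin N) 𝕂)) =
        realDiag 𝕂 x := by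
  refine and_congr_right fun _ => ⟨fun ⟨V, hV, h⟩ => ⟨⟨V, hV⟩, ?_⟩, ?_⟩
  · have hV1 := (Unitary.mem_iff.1 hV).1
    calc (X * V)ᴴ * (X * V) = star V * (Xᴴ * X) * V := by
          rw [Matrix.conjTranspose_mul, Matrix.star_eq_conjTranspose]; simp only [Matrix.mul_assoc]
      _ = (star V * V) * realDiag 𝕂 x * (star V * V) := by
          rw [h]; simp only [Matrix.mul_assoc, realDiag]
      _ = _ := by rw [hV1, Matrix.one_mul, Matrix.mul_one]
  · rintro ⟨⟨V, hV⟩, h⟩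
    refine ⟨V, hV, ?_⟩
    have hV2 := (Unitary.mem_iff.1 hV).2
    change (X * V)ᴴ * (X * V) = _ at h
    symm
    calc V * realDiag 𝕂 x * star V = (V * star V) * (Xᴴ * X) * (V * star V) := by
          rw [← h, Matrix.conjTranspose_mul, Matrix.star_eq_conjTranspose]
          simp only [Matrix.mul_assoc]
      _ = _ := by rw [hV2, Matrix.one_mul, Matrix.mul_one]

/-- The preimage of a closed set is the projection of a closed set along the compact unitary group,
hence closed. -/
theorem continuous_sqSingularValues {m N : ℕ} :
    Continuous (sqSingularValues : Matrix (Fin m) (Fin N) 𝕂 → Fin N → ℝ) := by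
  refine continuous_iff_isClosed.2 fun C hC => ?_
  let Z : UGroup 𝕂 N × Matrix (Fin m) (Fin N) 𝕂 → Matrix (Fin m) (Fin N) 𝕂 :=
    fun p => p.2 * (p.1 : Matrix (Fin N) (Fin N) 𝕂)
  have hZ : Continuous Z := continuous_snd.matrix_mul (continuous_subtype_val.comp continuous_fst)
  -- If V diagonalises the Gram matrix of X, the eigenvalues are the squared column lengths of X V,
  -- and these are continuous in (V, X).
  let d : UGroup 𝕂 N × Matrix (Fin m) (Fin N) 𝕂 → Fin N → ℝ := fun p i => ∑ k, ‖Z p k i‖ ^ 2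
  have hd : Continuous d := continuous_pi fun i =>
    continuous_finsetSum _ fun k _ => (hZ.matrix_elem k i).norm.pow 2
  have hdD : Continuous fun p => realDiag 𝕂 (d p) := by
    refine Continuous.matrix_diagonal (continuous_pi fun i => ?_)
    exact (continuous_algebraMap ℝ 𝕂).comp ((continuous_apply i).comp hd)
  have hclosed : IsClosed {p | Antitone (d p) ∧ d p ∈ C ∧ (Z p)ᴴ * Z p = realDiag 𝕂 (d p)} := by
    refine IsClosed.and ?_ (IsClosed.and (hC.preimage hd) (isClosed_eq ?_ hdD))
    · simp only [Antitone, Set.ofPred_forall]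
      exact isClosed_iInter fun i => isClosed_iInter fun j => isClosed_iInter fun _ =>
        isClosed_le ((continuous_apply j).comp hd) ((continuous_apply i).comp hd)
    · exact hZ.matrix_conjTranspose.matrix_mul hZ
  convert isClosedMap_snd_of_compactSpace _ hclosed using 1
  ext X
  simp only [Set.mem_preimage, Set.mem_image, Set.mem_ofPred_eq, Prod.exists, exists_eq_right]
  have hdi : ∀ V x, (Z (V, X))ᴴ * Z (V, X) = realDiag 𝕂 x → x = d (V, X) := by
    intro V x h
    ext i
    have h1 := conjTranspose_mul_self_apply_self (Z (V, X)) i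
    rw [h, realDiag, Matrix.diagonal_apply_eq] at h1
    exact (algebraMap ℝ 𝕂).injective h1
  constructor
  · intro hX
    obtain ⟨h1, V, h2⟩ := (isOrderedEigenvalues_iff X _).1 (sqSingularValues_spec X)
    have h3 := hdi V _ h2
    exact ⟨V, h3 ▸ h1, h3 ▸ hX, h3 ▸ h2⟩
  · rintro ⟨V, h1, h2, h3⟩
    rw [sqSingularValues_eq ((isOrderedEigenvalues_iff X _).2 ⟨h1, V, h3⟩)]
    exact h2

variable [MeasurableSpace 𝕂] [BorelSpace 𝕂]

@[fun_prop]
theorem measurable_sqSingularValues {m N : ℕ} :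
    Measurable (sqSingularValues : Matrix (Fin m) (Fin N) 𝕂 → Fin N → ℝ) :=
  continuous_sqSingularValues.measurable

end measurability

/-! ### Interlacing points and partial fractions -/

section interlacing

open Polynomial in
theorem eq_of_monic_of_eval_eq {k : ℕ} {P Q : ℝ[X]} (hP : P.Monic) (hQ : Q.Monic)
    (hPk : P.natDegree = k) (hQk : Q.natDegree = k) {s : Fin k → ℝ} (hs : Function.Injective s)
    (h : ∀ i, P.eval (s i) = Q.eval (s i)) : P = Q := by
  have hP' : P.degree = k := by rw [Polynomial.degree_eq_natDegree hP.ne_zero, hPk]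
  have hQ' : Q.degree = k := by rw [Polynomial.degree_eq_natDegree hQ.ne_zero, hQk]
  exact Polynomial.eq_of_degree_le_of_eval_index_eq (v := s) Finset.univ hs.injOn
    (by simp [hP']) (by rw [hP', hQ']) (by rw [hP.leadingCoeff, hQ.leadingCoeff])
    fun i _ => h i

variable {k : ℕ}

/-- The points which strictly interlace with `a 0 > a 1 > ⋯ > a k`. -/
def interlacing (a : Fin (k + 1) → ℝ) : Set (Fin k → ℝ) :=
  {s | ∀ i : Fin k, a i.succ < s i ∧ s i < a i.castSucc}

/-- The residues of `∏ (z - s i) / ∏ (z - a j)` at its poles `a j`. -/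
noncomputable def residue (a : Fin (k + 1) → ℝ) (s : Fin k → ℝ) (j : Fin (k + 1)) : ℝ :=
  ∏ i, (a j - s i) / (a j - a (j.succAbove i))

variable {a : Fin (k + 1) → ℝ} {s : Fin k → ℝ}

theorem interlacing.strictAnti (hs : s ∈ interlacing a) : StrictAnti s := by
  cases k with
  | zero => exact fun i => i.elim0
  | succ k =>
    refine Fin.strictAnti_iff_succ_lt.2 fun i => ?_
    have h1 := (hs i.succ).2
    have h2 := (hs i.castSucc).1
    rw [← Fin.succ_castSucc] at h1
    exact h1.trans h2

theorem sub_succAbove_ne_zero (ha : StrictAnti a) (j : Fin (k + 1)) (i : Fin k) :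
    a j - a (j.succAbove i) ≠ 0 :=
  sub_ne_zero.2 fun h => Fin.succAbove_ne j i (ha.injective h).symm

/-- Factor i pairs s i with an endpoint of the gap containing it, and both lie on the same side of a
j. -/
theorem residue_pos (ha : StrictAnti a) (hs : s ∈ interlacing a) (j : Fin (k + 1)) :
    0 < residue a s j := by
  refine Finset.prod_pos fun i _ => ?_
  obtain ⟨h1, h2⟩ := hs i
  rcases lt_or_ge i.castSucc j with h | h
  · rw [Fin.succAbove_of_castSucc_lt _ _ h]
    have h3 : a j ≤ a i.succ := ha.antitone (Fin.castSucc_lt_iff_succ_le.1 h)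
    exact div_pos_of_neg_of_neg (by linarith) (by linarith)
  · rw [Fin.succAbove_of_le_castSucc _ _ h]
    have h3 : a i.castSucc ≤ a j := ha.antitone h
    exact div_pos (by linarith) (by linarith)

theorem residue_mul_prod (ha : StrictAnti a) (j : Fin (k + 1)) :
    residue a s j * ∏ i, (a j - a (j.succAbove i)) = ∏ i, (a j - s i) := by
  rw [residue, ← Finset.prod_mul_distrib]
  exact Finset.prod_congr rfl fun i _ => div_mul_cancel₀ _ (sub_succAbove_ne_zero ha j i)

open Polynomial in
/-- The polynomial taking the value `p j * ∏ (a j - a l)` at the point `a j`. -/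
noncomputable def nodePoly (a : Fin (k + 1) → ℝ) (p : Fin (k + 1) → ℝ) : ℝ[X] :=
  ∑ j, C (p j) * ∏ i, (X - C (a (j.succAbove i)))

theorem nodePoly_eval (p : Fin (k + 1) → ℝ) (z : ℝ) :
    (nodePoly a p).eval z = ∑ j, p j * ∏ i, (z - a (j.succAbove i)) := by
  simp [nodePoly, Polynomial.eval_finsetSum, Polynomial.eval_prod]

theorem nodePoly_eval_node (p : Fin (k + 1) → ℝ) (j : Fin (k + 1)) :
    (nodePoly a p).eval (a j) = p j * ∏ i, (a j - a (j.succAbove i)) := by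
  rw [nodePoly_eval]
  refine Finset.sum_eq_single j (fun l _ hl => ?_) (by simp)
  obtain ⟨i, hi⟩ := Fin.exists_succAbove_eq hl.symm
  rw [Finset.prod_eq_zero (Finset.mem_univ i) (by rw [hi, sub_self]), mul_zero]

open Polynomial in
theorem natDegree_prod_X_sub_C_fin (b : Fin k → ℝ) : (∏ i, (X - C (b i))).natDegree = k := by
  rw [natDegree_prod_of_monic _ _ fun i _ => monic_X_sub_C _]
  simp

open Polynomial in
theorem nodePoly_coeff (p : Fin (k + 1) → ℝ) : (nodePoly a p).coeff k = ∑ j, p j := by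
  simp only [nodePoly, finsetSum_coeff, coeff_C_mul]
  refine Finset.sum_congr rfl fun j _ => ?_
  have h := (monic_prod_X_sub_C (fun i => a (j.succAbove i)) Finset.univ).coeff_natDegree
  rw [natDegree_prod_X_sub_C_fin] at h
  rw [h, mul_one]

open Polynomial in
theorem nodePoly_natDegree_le (p : Fin (k + 1) → ℝ) : (nodePoly a p).natDegree ≤ k :=
  natDegree_sum_le_of_forall_le _ _ fun j _ =>
    (natDegree_C_mul_le _ _).trans (natDegree_prod_X_sub_C_fin _).le

open Polynomial in
-- Lagrange interpolation: both sides have degree at most k and agree at the k + 1 nodes.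
theorem nodePoly_residue (ha : StrictAnti a) (s : Fin k → ℝ) :
    nodePoly a (residue a s) = ∏ i, (X - C (s i)) := by
  refine eq_of_degrees_lt_of_eval_index_eq (v := a) Finset.univ ha.injective.injOn ?_ ?_ ?_
  · refine (natDegree_le_iff_degree_le.1 (nodePoly_natDegree_le _)).trans_lt ?_
    simp only [Finset.card_univ, Fintype.card_fin]
    exact_mod_cast Nat.lt_succ_self k
  · refine (natDegree_le_iff_degree_le.1 (natDegree_prod_X_sub_C_fin s).le).trans_lt ?_
    simp only [Finset.card_univ, Fintype.card_fin]
    exact_mod_cast Nat.lt_succ_self k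
  · intro j _
    rw [nodePoly_eval_node, residue_mul_prod ha, eval_prod]
    simp

/-- Compare the coefficients of degree k in `nodePoly_residue`. -/
theorem sum_residue (ha : StrictAnti a) (s : Fin k → ℝ) : ∑ j, residue a s j = 1 := by
  rw [← nodePoly_coeff (a := a), nodePoly_residue ha]
  have h := (Polynomial.monic_prod_X_sub_C s Finset.univ).coeff_natDegree
  rwa [natDegree_prod_X_sub_C_fin] at h

/-- The secular equation. -/
theorem sum_residue_div (ha : StrictAnti a) (hs : s ∈ interlacing a) (i : Fin k) :
    ∑ j, residue a s j / (s i - a j) = 0 := by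
  have hne : ∀ j, s i - a j ≠ 0 := by
    intro j h
    have h1 := Finset.prod_ne_zero_iff.1 (residue_pos ha hs j).ne' i (Finset.mem_univ i)
    exact h1 (by rw [← neg_sub, h, neg_zero, zero_div])
  have h := nodePoly_eval (a := a) (residue a s) (s i)
  rw [nodePoly_residue ha, Polynomial.eval_prod, Finset.prod_eq_zero (Finset.mem_univ i)
    (by simp)] at h
  have h2 : (∏ j, (s i - a j)) * ∑ j, residue a s j / (s i - a j) = 0 := by
    rw [h, Finset.mul_sum]
    refine Finset.sum_congr rfl fun j _ => ?_
    rw [Fin.prod_univ_succAbove _ j]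
    field_simp [hne j]
  exact (mul_eq_zero.1 h2).resolve_left (Finset.prod_ne_zero_iff.2 fun j _ => hne j)

/-- The open simplex, in the coordinates other than the first one. -/
def openSimplex (k : ℕ) : Set (Fin k → ℝ) := {w | (∀ i, 0 < w i) ∧ ∑ i, w i < 1}

theorem residue_succ_mem_openSimplex (ha : StrictAnti a) (hs : s ∈ interlacing a) :
    (fun i : Fin k => residue a s i.succ) ∈ openSimplex k := by
  refine ⟨fun i => residue_pos ha hs _, ?_⟩
  have h := sum_residue ha s
  rw [Fin.sum_univ_succ] at h
  linarith [residue_pos ha hs 0]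

theorem residue_zero (ha : StrictAnti a) (s : Fin k → ℝ) :
    residue a s 0 = 1 - ∑ i : Fin k, residue a s i.succ := by
  have h := sum_residue ha s
  rw [Fin.sum_univ_succ] at h
  linarith

/-- The residues determine the polynomial with roots s, hence the set of roots; as each gap contains
exactly one of them, their order is determined too. -/
theorem residue_injOn (ha : StrictAnti a) :
    Set.InjOn (fun s (i : Fin k) => residue a s i.succ) (interlacing a) := by
  intro s hs t ht hst
  have h1 : residue a s = residue a t := by
    funext j
    refine Fin.cases ?_ (fun i => congrFun hst i) j
    rw [residue_zero ha, residue_zero ha]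
    exact congrArg (fun f : Fin k → ℝ => 1 - ∑ i, f i) hst
  have h2 : ∏ i, (Polynomial.X - Polynomial.C (s i)) = ∏ i, (Polynomial.X - Polynomial.C (t i)) := by
    rw [← nodePoly_residue ha, h1, nodePoly_residue ha]
  funext i
  have h3 := congrArg (Polynomial.eval (s i)) h2
  rw [Polynomial.eval_prod, Polynomial.eval_prod, Finset.prod_eq_zero (Finset.mem_univ i)
    (by simp)] at h3
  obtain ⟨j, -, hj⟩ := Finset.prod_eq_zero_iff.1 h3.symm
  have hj' : s i = t j := by simpa [sub_eq_zero] using hj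
  have hij : i = j := by
    rcases lt_trichotomy i j with h | h | h
    · have h4 := (hs i).1
      have h5 := (ht j).2
      have h6 : a j.castSucc ≤ a i.succ := ha.antitone (Fin.succ_le_castSucc_iff.2 h)
      linarith
    · exact h
    · have h4 := (hs i).2
      have h5 := (ht j).1
      have h6 : a i.castSucc ≤ a j.succ := ha.antitone (Fin.succ_le_castSucc_iff.2 h)
      linarith
  rw [hj', hij]

/-- No node lies strictly between two adjacent ones, so every factor of the combined product is
positive except the one formed by the two nodes themselves. -/
theorem prod_succAbove_castSucc_mul_succ_neg (ha : StrictAnti a) (i : Fin k) :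
    (∏ m, (a i.castSucc - a (i.castSucc.succAbove m))) *
      (∏ m, (a i.succ - a (i.succ.succAbove m))) < 0 := by
  rw [← Finset.prod_mul_distrib, ← Finset.mul_prod_erase _ _ (Finset.mem_univ i)]
  have hi : a i.succ < a i.castSucc := ha i.castSucc_lt_succ
  refine mul_neg_of_neg_of_pos ?_ (Finset.prod_pos fun m hm => ?_)
  · rw [Fin.succAbove_castSucc_self, Fin.succAbove_succ_self]
    exact mul_neg_of_pos_of_neg (by linarith) (by linarith)
  · rcases lt_or_gt_of_ne (Finset.ne_of_mem_erase hm) with h | h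
    · rw [Fin.succAbove_of_castSucc_lt _ _ (Fin.castSucc_lt_castSucc_iff.2 h),
        Fin.succAbove_of_castSucc_lt _ _ ((Fin.castSucc_lt_castSucc_iff.2 h).trans
          i.castSucc_lt_succ)]
      have h1 : a i.castSucc < a m.castSucc := ha (Fin.castSucc_lt_castSucc_iff.2 h)
      exact mul_pos_of_neg_of_neg (by linarith) (by linarith)
    · rw [Fin.succAbove_of_le_castSucc _ _ (Fin.castSucc_le_castSucc_iff.2 h.le),
        Fin.succAbove_of_le_castSucc _ _ (Fin.succ_le_castSucc_iff.2 h)]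
      have h1 : a m.succ < a i.succ := ha (Fin.succ_lt_succ_iff.2 h)
      exact mul_pos (by linarith) (by linarith)

theorem exists_zero_of_mul_neg {f : ℝ → ℝ} (hf : Continuous f) {x y : ℝ} (hxy : x < y)
    (h : f y * f x < 0) : ∃ z, x < z ∧ z < y ∧ f z = 0 := by
  rcases mul_neg_iff.1 h with ⟨h1, h2⟩ | ⟨h1, h2⟩
  · obtain ⟨z, hz, hz0⟩ := intermediate_value_Ioo hxy.le hf.continuousOn ⟨h2, h1⟩
    exact ⟨z, hz.1, hz.2, hz0⟩
  · obtain ⟨z, hz, hz0⟩ := intermediate_value_Ioo' hxy.le hf.continuousOn ⟨h1, h2⟩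
    exact ⟨z, hz.1, hz.2, hz0⟩

/-- The interpolating polynomial with positive weights p changes sign across every gap, so it has a
root in each. Being monic of degree k because the weights sum to one, it is the product over these
roots, and its weights are their residues. -/
theorem exists_interlacing_residue_eq (ha : StrictAnti a) {w : Fin k → ℝ} (hw : w ∈ openSimplex k) :
    ∃ s ∈ interlacing a, (fun i : Fin k => residue a s i.succ) = w := by
  set p : Fin (k + 1) → ℝ := Fin.cons (1 - ∑ i, w i) w with hp
  have hp0 : ∀ j, 0 < p j := by
    intro j
    refine Fin.cases ?_ (fun i => ?_) j
    · simpa [hp] using hw.2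
    · simpa [hp] using hw.1 i
  have hp1 : ∑ j, p j = 1 := by simp [hp, Fin.sum_univ_succ]
  have hroot : ∀ i : Fin k, ∃ z, a i.succ < z ∧ z < a i.castSucc ∧ (nodePoly a p).eval z = 0 := by
    intro i
    refine exists_zero_of_mul_neg (nodePoly a p).continuous (ha i.castSucc_lt_succ) ?_
    rw [nodePoly_eval_node, nodePoly_eval_node, mul_mul_mul_comm]
    exact mul_neg_of_pos_of_neg (mul_pos (hp0 _) (hp0 _))
      (prod_succAbove_castSucc_mul_succ_neg ha i)
  choose s hs1 hs2 hs3 using hroot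
  have hs : s ∈ interlacing a := fun i => ⟨hs1 i, hs2 i⟩
  refine ⟨s, hs, ?_⟩
  have hdeg : (nodePoly a p).natDegree = k := by
    refine le_antisymm (nodePoly_natDegree_le p) (Polynomial.le_natDegree_of_ne_zero ?_)
    rw [nodePoly_coeff, hp1]
    exact one_ne_zero
  have hmon : (nodePoly a p).Monic := by
    rw [Polynomial.Monic, Polynomial.leadingCoeff, hdeg, nodePoly_coeff, hp1]
  have hpoly := eq_of_monic_of_eval_eq hmon (Polynomial.monic_prod_X_sub_C s Finset.univ) hdeg
    (natDegree_prod_X_sub_C_fin s) (interlacing.strictAnti hs).injective (fun i => by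
      rw [hs3, Polynomial.eval_prod, Finset.prod_eq_zero (Finset.mem_univ i) (by simp)])
  funext i
  have h1 := congrArg (Polynomial.eval (a i.succ)) hpoly
  rw [← nodePoly_residue ha, nodePoly_eval_node, nodePoly_eval_node] at h1
  have h2 := mul_right_cancel₀ (Finset.prod_ne_zero_iff.2
    fun m _ => sub_succAbove_ne_zero ha i.succ m) h1
  rw [← h2]
  simp [hp]

theorem image_residue (ha : StrictAnti a) :
    (fun s (i : Fin k) => residue a s i.succ) '' interlacing a = openSimplex k := by
  ext w
  refine ⟨?_, fun hw => exists_interlacing_residue_eq ha hw⟩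
  rintro ⟨s, hs, rfl⟩
  exact residue_succ_mem_openSimplex ha hs

end interlacing

/-! ### The Jacobian of the map from interlacing points to residues -/

section jacobian

variable {k : ℕ}

/-- The absolute value of the Vandermonde determinant. -/
noncomputable def absVandermonde (s : Fin k → ℝ) : ℝ := ∏ i, ∏ j ∈ Finset.Ioi i, |s i - s j|

theorem abs_det_vandermonde (s : Fin k → ℝ) :
    |(Matrix.vandermonde s).det| = absVandermonde s := by
  simp only [Matrix.det_vandermonde, Finset.abs_prod, absVandermonde]
  exact Finset.prod_congr rfl fun _ _ => Finset.prod_congr rfl fun _ _ => abs_sub_comm _ _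

theorem absVandermonde_pos {s : Fin k → ℝ} (hs : Function.Injective s) : 0 < absVandermonde s :=
  Finset.prod_pos fun i _ => Finset.prod_pos fun j hj =>
    abs_pos.2 (sub_ne_zero.2 fun h => (Finset.mem_Ioi.1 hj).ne (hs h))

theorem absVandermonde_sq (s : Fin k → ℝ) :
    absVandermonde s ^ 2 = ∏ i, ∏ j ∈ Finset.univ.erase i, |s i - s j| := by
  have h := Finset.prod_prod_Ioi_mul_eq_prod_prod_off_diag (fun i j : Fin k => |s j - s i|)
  simp only [← Finset.compl_singleton]
  rw [← h, absVandermonde, pow_two, ← Finset.prod_mul_distrib]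
  refine Finset.prod_congr rfl fun i _ => ?_
  rw [← Finset.prod_mul_distrib]
  exact Finset.prod_congr rfl fun j _ => by rw [abs_sub_comm (s j) (s i)]

theorem prod_succAbove_eq_prod_erase {M : Type*} [CommMonoid M] (f : Fin (k + 1) → M)
    (j : Fin (k + 1)) : ∏ i, f (j.succAbove i) = ∏ l ∈ Finset.univ.erase j, f l := by
  rw [← Finset.compl_singleton, ← Fin.image_succAbove_univ,
    Finset.prod_image (Fin.succAbove_right_injective.injOn)]

theorem absVandermonde_succ (a : Fin (k + 1) → ℝ) :
    absVandermonde a = (∏ i : Fin k, |a 0 - a i.succ|) * absVandermonde fun i : Fin k => a i.succ := by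
  simp only [absVandermonde]
  rw [Fin.prod_univ_succ]
  simp [Fin.prod_Ioi_succ]

theorem prod_prod_succ_succAbove (a : Fin (k + 1) → ℝ) :
    ∏ j : Fin k, ∏ m, |a j.succ - a (j.succ.succAbove m)| =
      (∏ i : Fin k, |a 0 - a i.succ|) * absVandermonde (fun i : Fin k => a i.succ) ^ 2 := by
  rw [absVandermonde_sq, ← Finset.prod_mul_distrib]
  refine Finset.prod_congr rfl fun j _ => ?_
  rw [prod_succAbove_eq_prod_erase (fun l => |a j.succ - a l|), abs_sub_comm (a 0)]
  have h : (Finset.univ.erase j.succ : Finset (Fin (k + 1))) =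
      insert 0 ((Finset.univ.erase j).map (Fin.succEmb k)) := by
    ext l
    refine Fin.cases ?_ (fun i => ?_) l
    · simp [(Fin.succ_ne_zero j).symm]
    · simp
  rw [h, Finset.prod_insert (by simp), Finset.prod_map]
  rfl

open Polynomial in
-- Column i lists the values at the b j of the polynomial ∏_{m ≠ i} (X - s m), so the matrix is the
-- Vandermonde matrix of b times a coefficient matrix Q that does not involve b. For b = s the
-- matrix is diagonal, and this gives |det Q| without expanding it.
theorem abs_det_prod_erase (b : Fin k → ℝ) {s : Fin k → ℝ} (hs : Function.Injective s) :
    |(Matrix.of fun j i => ∏ m ∈ Finset.univ.erase i, (b j - s m)).det| =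
      absVandermonde b * absVandermonde s := by
  let ℓ : Fin k → ℝ[X] := fun i => ∏ m ∈ Finset.univ.erase i, (X - C (s m))
  have hℓ : ∀ i, (ℓ i).natDegree < k := by
    intro i
    rw [natDegree_prod_of_monic _ _ fun _ _ => monic_X_sub_C _]
    have hk : 0 < k := i.pos
    simp [Finset.card_erase_of_mem, hk]
  let Q : Matrix (Fin k) (Fin k) ℝ := Matrix.of fun l i => (ℓ i).coeff l
  have hmul : ∀ c : Fin k → ℝ, (Matrix.of fun j i => ∏ m ∈ Finset.univ.erase i, (c j - s m)) =
      Matrix.vandermonde c * Q := by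
    intro c
    ext j i
    rw [Matrix.of_apply, Matrix.mul_apply]
    have h := eval_eq_sum_range' (hℓ i) (c j)
    rw [← Fin.sum_univ_eq_sum_range (fun l => (ℓ i).coeff l * c j ^ l)] at h
    simp only [ℓ, eval_prod, eval_sub, eval_X, eval_C] at h
    rw [h]
    exact Finset.sum_congr rfl fun l _ => by simp [Matrix.vandermonde_apply, Q, ℓ, mul_comm]
  have hdiag : |(Matrix.of fun j i => ∏ m ∈ Finset.univ.erase i, (s j - s m)).det| =
      absVandermonde s ^ 2 := by
    have h1 : (Matrix.of fun j i => ∏ m ∈ Finset.univ.erase i, (s j - s m)) =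
        Matrix.diagonal fun i => ∏ m ∈ Finset.univ.erase i, (s i - s m) := by
      ext j i
      rcases eq_or_ne j i with rfl | hji
      · simp
      · rw [Matrix.of_apply, Matrix.diagonal_apply_ne _ hji]
        exact Finset.prod_eq_zero (Finset.mem_erase.2 ⟨hji, Finset.mem_univ j⟩) (sub_self _)
    rw [h1, Matrix.det_diagonal, absVandermonde_sq]
    simp only [Finset.abs_prod]
  rw [hmul, Matrix.det_mul, abs_mul, abs_det_vandermonde, pow_two] at hdiag
  rw [hmul, Matrix.det_mul, abs_mul, abs_det_vandermonde,
    mul_left_cancel₀ (absVandermonde_pos hs).ne' hdiag]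

/-- The matrix of the derivative of the residues with respect to the interlacing points. -/
noncomputable def residueDeriv (a : Fin (k + 1) → ℝ) (s : Fin k → ℝ) : Matrix (Fin k) (Fin k) ℝ :=
  Matrix.of fun j i => (-(∏ m, (a j.succ - a (j.succ.succAbove m)))⁻¹) *
    (∏ m ∈ Finset.univ.erase i, (a j.succ - s m))

/-- Each row has a common factor, the inverse of a product of node differences. What remains is
`abs_det_prod_erase` at the nodes other than a 0, and the products over the nodes collapse to 1 /
`absVandermonde a`. -/
theorem abs_det_residueDeriv {a : Fin (k + 1) → ℝ} (ha : StrictAnti a) {s : Fin k → ℝ}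
    (hs : Function.Injective s) :
    |(residueDeriv a s).det| = absVandermonde s / absVandermonde a := by
  have hb : Function.Injective fun i : Fin k => a i.succ :=
    ha.injective.comp (Fin.succ_injective k)
  have h := Matrix.det_mul_column
    (fun j : Fin k => -(∏ m, (a j.succ - a (j.succ.succAbove m)))⁻¹)
    (Matrix.of fun j i => ∏ m ∈ Finset.univ.erase i, (a j.succ - s m))
  have hD : residueDeriv a s = Matrix.of fun j i => (-(∏ m, (a j.succ - a (j.succ.succAbove m)))⁻¹) *
      (Matrix.of fun j i => ∏ m ∈ Finset.univ.erase i, (a j.succ - s m)) j i := rfl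
  rw [hD, h, abs_mul, abs_det_prod_erase _ hs, Finset.abs_prod]
  simp only [abs_neg, abs_inv, Finset.abs_prod]
  rw [Finset.prod_inv_distrib, prod_prod_succ_succAbove, absVandermonde_succ]
  have h1 := (absVandermonde_pos hb).ne'
  have h2 : ∏ i : Fin k, |a 0 - a i.succ| ≠ 0 := Finset.prod_ne_zero_iff.2 fun i _ =>
    abs_ne_zero.2 (sub_ne_zero.2 fun h => (Fin.succ_ne_zero i).symm (ha.injective h))
  field_simp

theorem hasFDerivAt_residue (a : Fin (k + 1) → ℝ) (s : Fin k → ℝ) :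
    HasFDerivAt (fun s (i : Fin k) => residue a s i.succ)
      (LinearMap.toContinuousLinearMap (Matrix.toLin' (residueDeriv a s))) s := by
  refine hasFDerivAt_pi'' fun j => ?_
  have h1 : ∀ i ∈ (Finset.univ : Finset (Fin k)), HasFDerivAt (fun s : Fin k → ℝ => a j.succ - s i)
      (-(ContinuousLinearMap.proj i : (Fin k → ℝ) →L[ℝ] ℝ)) s := fun i _ =>
    (hasFDerivAt_apply i s).const_sub _
  have h2 := (HasFDerivAt.finsetProd h1).const_mul (∏ m, (a j.succ - a (j.succ.succAbove m)))⁻¹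
  have h3 : (fun s => residue a s j.succ) = fun s : Fin k → ℝ =>
      (∏ m, (a j.succ - a (j.succ.succAbove m)))⁻¹ * ∏ i, (a j.succ - s i) := by
    funext t
    rw [residue, Finset.prod_div_distrib, div_eq_inv_mul]
  rw [h3]
  refine h2.congr_fderiv (ContinuousLinearMap.ext fun v => ?_)
  simp [residueDeriv, Matrix.mulVec, dotProduct, Finset.mul_sum, mul_assoc]

theorem measurableSet_interlacing (a : Fin (k + 1) → ℝ) : MeasurableSet (interlacing a) := by
  have : interlacing a = Set.univ.pi fun i : Fin k => Set.Ioo (a i.succ) (a i.castSucc) := by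
    ext s; simp [interlacing]
  rw [this]
  exact MeasurableSet.univ_pi fun i => measurableSet_Ioo

/-- The change of variables of Dixon and Anderson. -/
theorem lintegral_openSimplex_eq {a : Fin (k + 1) → ℝ} (ha : StrictAnti a)
    (f : (Fin k → ℝ) → ENNReal) :
    ∫⁻ w in openSimplex k, f w = ∫⁻ s in interlacing a,
      ENNReal.ofReal (absVandermonde s / absVandermonde a) * f fun i : Fin k => residue a s i.succ := by
  rw [← image_residue ha, lintegral_image_eq_lintegral_abs_det_fderiv_mul volume
    (measurableSet_interlacing a) (fun s _ => (hasFDerivAt_residue a s).hasFDerivWithinAt)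
    (residue_injOn ha)]
  refine setLIntegral_congr_fun (measurableSet_interlacing a) fun s hs => ?_
  rw [LinearMap.det_toContinuousLinearMap, LinearMap.det_toLin',
    abs_det_residueDeriv ha (interlacing.strictAnti hs).injective]

end jacobian

/-! ### Products of one-dimensional densities -/

section productDensity

theorem lintegral_pi_prod {n : ℕ} {α : Type} [MeasurableSpace α]
    (μ : Fin n → Measure α) [∀ i, SigmaFinite (μ i)] (f : Fin n → α → ENNReal)
    (hf : ∀ i, Measurable (f i)) :
    ∫⁻ x, ∏ i, f i (x i) ∂Measure.pi μ = ∏ i, ∫⁻ x, f i x ∂μ i := by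
  induction n with
  | zero => simp
  | succ n ih =>
    have h := (measurePreserving_piFinSuccAbove μ 0).lintegral_comp_emb
      (MeasurableEquiv.measurableEmbedding _)
      (fun p => f 0 p.1 * ∏ i : Fin n, f i.succ (p.2 i))
    simp only [MeasurableEquiv.piFinSuccAbove_apply] at h
    rw [Fin.prod_univ_succ, ← ih (fun i => μ i.succ) (fun i => f i.succ) (fun i => hf _)]
    simp only [Fin.prod_univ_succ]
    have h2 : Measurable fun y : Fin n → α => ∏ i, f i.succ (y i) :=
      Finset.measurable_fun_prod _ fun i _ => (hf _).comp (measurable_pi_apply i)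
    have h3 := lintegral_prod_mul (μ := μ 0) (ν := Measure.pi fun i : Fin n => μ i.succ)
      (hf 0).aemeasurable h2.aemeasurable
    exact Eq.trans rfl (h.trans h3)

theorem pi_withDensity {n : ℕ} (f : Fin n → ℝ → ENNReal) (hf : ∀ i, Measurable (f i))
    [∀ i, SigmaFinite (volume.withDensity (f i))] :
    Measure.pi (fun i => volume.withDensity (f i)) =
      (volume : Measure (Fin n → ℝ)).withDensity fun x => ∏ i, f i (x i) := by
  refine Measure.pi_eq fun s hs => ?_
  rw [withDensity_apply _ (MeasurableSet.univ_pi hs),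
    ← lintegral_indicator (MeasurableSet.univ_pi hs)]
  have h := lintegral_pi_prod (fun _ : Fin n => (volume : Measure ℝ))
    (fun i => (s i).indicator (f i)) (fun i => (hf i).indicator (hs i))
  rw [← volume_pi] at h
  have h2 : ∀ x : Fin n → ℝ, (Set.univ.pi s).indicator (fun x => ∏ i, f i (x i)) x =
      ∏ i, (s i).indicator (f i) (x i) := by
    intro x
    by_cases hx : x ∈ Set.univ.pi s
    · rw [Set.indicator_of_mem hx]
      exact Finset.prod_congr rfl fun i _ => (Set.indicator_of_mem (hx i (Set.mem_univ i)) _).symm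
    · rw [Set.indicator_of_notMem hx]
      simp only [Set.mem_univ_pi, not_forall] at hx
      obtain ⟨i, hi⟩ := hx
      exact (Finset.prod_eq_zero (Finset.mem_univ i) (Set.indicator_of_notMem hi _)).symm
  simp only [h2, h]
  exact Finset.prod_congr rfl fun i _ => by
    rw [lintegral_indicator (hs i), withDensity_apply _ (hs i)]

end productDensity

/-! ### From independent power densities to the Dirichlet density -/

section dirichlet

variable {k : ℕ}

/-- The unnormalised density of the Dirichlet distribution on the open simplex. -/
noncomputable def dirichletWeight (e : Fin (k + 1) → ℝ) (w : Fin k → ℝ) : ENNReal :=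
  ENNReal.ofReal ((1 - ∑ i, w i) ^ (e 0 - 1) * ∏ i : Fin k, w i ^ (e i.succ - 1))

@[fun_prop]
theorem measurable_dirichletWeight (e : Fin (k + 1) → ℝ) : Measurable (dirichletWeight e) := by
  unfold dirichletWeight
  fun_prop

theorem measurableSet_openSimplex : MeasurableSet (openSimplex k) := by
  have : openSimplex k = (⋂ i, {w | 0 < w i}) ∩ {w | ∑ i, w i < 1} := by
    ext w; simp [openSimplex]
  rw [this]
  exact (MeasurableSet.iInter fun i => measurableSet_lt measurable_const (measurable_pi_apply i)).inter
    (measurableSet_lt (by fun_prop) measurable_const)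

/-- The simplex of all positive vectors with sum less than one. -/
def openCorner (k : ℕ) : Set (Fin (k + 1) → ℝ) := {γ | (∀ i, 0 < γ i) ∧ ∑ i, γ i < 1}

theorem measurableSet_openCorner : MeasurableSet (openCorner k) :=
  measurableSet_openSimplex (k := k + 1)

theorem lintegral_comp_smul_pos (f : (Fin k → ℝ) → ENNReal) {τ : ℝ} (hτ : 0 < τ) :
    ∫⁻ γ, f γ = ENNReal.ofReal (τ ^ k) * ∫⁻ w, f (τ • w) := by
  have h := Measure.map_addHaar_smul (volume : Measure (Fin k → ℝ)) hτ.ne'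
  have h1 : ∫⁻ w, f (τ • w) = ENNReal.ofReal |(τ ^ k)⁻¹| * ∫⁻ γ, f γ := by
    have h2 := (Homeomorph.smulOfNeZero τ hτ.ne').measurableEmbedding.lintegral_map
      (μ := (volume : Measure (Fin k → ℝ))) f
    simp only [Homeomorph.smulOfNeZero_apply] at h2
    rw [← h2]
    change ∫⁻ a, f a ∂(Measure.map (fun x => τ • x) volume) = _
    rw [h, lintegral_smul_measure]
    simp
  rw [h1, ← mul_assoc, ← ENNReal.ofReal_mul (by positivity), abs_of_pos (by positivity),
    mul_inv_cancel₀ (by positivity), ENNReal.ofReal_one, one_mul]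

/-- Polar coordinates γ = τ (1 - ∑ w, w) for the sum of the coordinates: the weight is homogeneous,
so the integral factors into a radial part K, whose value is irrelevant, and a Dirichlet integral
over directions. -/
theorem exists_lintegral_openCorner (e : Fin (k + 1) → ℝ) :
    ∃ K : ENNReal, ∀ f : (Fin k → ℝ) → ENNReal, Measurable f →
      ∫⁻ γ in openCorner k, f (fun i => γ i.succ / ∑ j, γ j) *
          ENNReal.ofReal (∏ j, γ j ^ (e j - 1)) =
        K * ∫⁻ w in openSimplex k, f w * dirichletWeight e w := by
  refine ⟨∫⁻ τ in Set.Ioo 0 1, ENNReal.ofReal (τ ^ (∑ j, e j - 1)), fun f hf => ?_⟩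
  set G : (Fin (k + 1) → ℝ) → ENNReal := (openCorner k).indicator fun γ =>
    f (fun i => γ i.succ / ∑ j, γ j) * ENNReal.ofReal (∏ j, γ j ^ (e j - 1)) with hG
  have hGm : Measurable G := by
    refine Measurable.indicator (Measurable.mul (hf.comp ?_) ?_) measurableSet_openCorner
    · fun_prop
    · fun_prop
  set H : ℝ × (Fin k → ℝ) → ENNReal := fun p => G (Fin.cons p.1 p.2) with hH
  have hHm : Measurable H := by
    refine hGm.comp (measurable_pi_iff.2 fun j => ?_)
    refine Fin.cases ?_ (fun i => ?_) j
    · simpa using measurable_fst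
    · simpa only [Fin.cons_succ] using! (measurable_pi_apply i).comp measurable_snd
  have h1 : ∫⁻ γ, G γ = ∫⁻ p, H p := by
    have h := (volume_preserving_piFinSuccAbove (fun _ : Fin (k + 1) => ℝ) 0).lintegral_comp_emb
      (MeasurableEquiv.measurableEmbedding _) H
    rw [← h]
    refine lintegral_congr fun γ => ?_
    simp only [hH, MeasurableEquiv.piFinSuccAbove_apply]
    congr 1
    exact (Fin.cons_self_tail γ).symm
  -- A translation in the first coordinate makes the total mass τ the new variable.
  have hshear : ∫⁻ p, H p = ∫⁻ τ, ∫⁻ γ' : Fin k → ℝ, H (τ - ∑ i, γ' i, γ') := by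
    change ∫⁻ p, H p ∂(volume.prod volume) = _
    rw [lintegral_prod_symm _ hHm.aemeasurable]
    have h2 : ∀ γ' : Fin k → ℝ, ∫⁻ x, H (x, γ') = ∫⁻ τ, H (τ - ∑ i, γ' i, γ') := fun γ' =>
      (lintegral_sub_right_eq_self (fun x => H (x, γ')) _).symm
    simp only [h2]
    rw [lintegral_lintegral_swap]
    exact (hHm.comp (by fun_prop)).aemeasurable
  rw [← lintegral_indicator measurableSet_openCorner, ← hG, h1, hshear,
    ← lintegral_indicator measurableSet_Ioo, ← lintegral_indicator measurableSet_openSimplex,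
    ← lintegral_mul_const _ (by
      refine Measurable.indicator ?_ measurableSet_Ioo
      fun_prop)]
  refine lintegral_congr fun τ => ?_
  by_cases hτ : τ ∈ Set.Ioo (0 : ℝ) 1
  · rw [lintegral_comp_smul_pos _ hτ.1, Set.indicator_of_mem hτ]
    have hτ0 := hτ.1
    have hsum : ∀ w : Fin k → ℝ, ∑ i, (τ • w) i = τ * ∑ i, w i := fun w => by
      simp [Finset.mul_sum]
    have hpt : ∀ w : Fin k → ℝ, H (τ - ∑ i, (τ • w) i, τ • w) =
        ENNReal.ofReal (τ ^ (∑ j, e j - (k + 1))) *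
          (openSimplex k).indicator (fun w => f w * dirichletWeight e w) w := by
      intro w
      set γ : Fin (k + 1) → ℝ := Fin.cons (τ - ∑ i, (τ • w) i) (τ • w) with hγ
      have hγ0 : γ 0 = τ * (1 - ∑ i, w i) := by rw [hγ, Fin.cons_zero, hsum]; ring
      have hγs : ∀ i : Fin k, γ i.succ = τ * w i := fun i => by simp [hγ]
      have hγsum : ∑ j, γ j = τ := by
        rw [Fin.sum_univ_succ, hγ0]
        simp only [hγs, ← Finset.mul_sum]
        ring
      have hmem : γ ∈ openCorner k ↔ w ∈ openSimplex k := by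
        simp only [openCorner, openSimplex, Set.mem_ofPred_eq, hγsum, hτ.2, and_true,
          Fin.forall_fin_succ, hγ0, hγs, mul_pos_iff_of_pos_left hτ0, sub_pos]
        tauto
      change G γ = _
      by_cases hw : w ∈ openSimplex k
      · rw [hG, Set.indicator_of_mem (hmem.2 hw), Set.indicator_of_mem hw, hγsum]
        have hfw : (fun i : Fin k => γ i.succ / τ) = w := by
          funext i; rw [hγs, mul_div_cancel_left₀ _ hτ0.ne']
        have hprod : ∏ j, γ j ^ (e j - 1) = τ ^ (∑ j, e j - (k + 1)) *
            ((1 - ∑ i, w i) ^ (e 0 - 1) * ∏ i : Fin k, w i ^ (e i.succ - 1)) := by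
          rw [Fin.prod_univ_succ, hγ0, Real.mul_rpow hτ0.le (by linarith [hw.2])]
          have : ∀ i : Fin k, γ i.succ ^ (e i.succ - 1) =
              τ ^ (e i.succ - 1) * w i ^ (e i.succ - 1) := fun i => by
            rw [hγs, Real.mul_rpow hτ0.le (hw.1 i).le]
          simp only [this, Finset.prod_mul_distrib]
          rw [← Real.rpow_sum_of_pos hτ0]
          have hexp : ∑ j, e j - (k + 1) = (e 0 - 1) + ∑ i : Fin k, (e i.succ - 1) := by
            rw [Fin.sum_univ_succ, Finset.sum_sub_distrib]; simp; ring
          rw [hexp, Real.rpow_add hτ0]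
          ring
        rw [hfw, hprod, ENNReal.ofReal_mul (by positivity), dirichletWeight]
        ring
      · rw [hG, Set.indicator_of_notMem (fun h => hw (hmem.1 h)), Set.indicator_of_notMem hw,
          mul_zero]
    simp only [hpt]
    rw [lintegral_const_mul _ (Measurable.indicator (by fun_prop) measurableSet_openSimplex),
      ← mul_assoc, ← ENNReal.ofReal_mul (by positivity)]
    congr 2
    rw [← Real.rpow_natCast, ← Real.rpow_add hτ0]
    congr 1
    ring
  · rw [Set.indicator_of_notMem hτ, zero_mul]
    refine (lintegral_congr fun γ' => ?_).trans lintegral_zero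
    refine Set.indicator_of_notMem (fun hmem => hτ ?_) _
    have hs : ∑ j, (Fin.cons (τ - ∑ i, γ' i) γ' : Fin (k + 1) → ℝ) j = τ := by
      simp [Fin.sum_univ_succ]
    refine ⟨?_, ?_⟩
    · rw [← hs]
      exact Finset.sum_pos (fun j _ => hmem.1 j) Finset.univ_nonempty
    · rw [← hs]; exact hmem.2

end dirichlet

/-! ### Squared norms of blocks of a vector under Haar measure -/

section normLaw

variable {𝕂 : Type} [NormedDivisionRing 𝕂] [NormedAlgebra ℝ 𝕂] [StarRing 𝕂]
  [hK : IsCompositionField 𝕂] [MeasurableSpace 𝕂] [BorelSpace 𝕂]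

variable (𝕂) in
/-- A Haar measure on the additive group of vectors over `𝕂`. -/
noncomputable def vectorHaar (κ : Type*) [Fintype κ] : Measure (κ → 𝕂) :=
  Measure.pi fun _ => (Measure.addHaar : Measure 𝕂)

instance (κ : Type*) [Fintype κ] : (vectorHaar 𝕂 κ).IsAddHaarMeasure :=
  inferInstanceAs (Measure.pi fun _ => (Measure.addHaar : Measure 𝕂)).IsAddHaarMeasure

instance (κ : Type*) [Fintype κ] : SigmaFinite (vectorHaar 𝕂 κ) :=
  inferInstanceAs (SigmaFinite (Measure.pi fun _ => (Measure.addHaar : Measure 𝕂)))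

/-- The density `c r ^ (p - 1)` on the positive half-line. -/
noncomputable def powDensity (c : ENNReal) (p : ℝ) : ℝ → ENNReal :=
  (Set.Ioi 0).indicator fun r => c * ENNReal.ofReal (r ^ (p - 1))

@[fun_prop]
theorem measurable_powDensity (c : ENNReal) (p : ℝ) : Measurable (powDensity c p) :=
  Measurable.indicator (by fun_prop) measurableSet_Ioi

theorem withDensity_powDensity_Iio (c : ENNReal) {p : ℝ} (hp : 0 < p) {R : ℝ} (hR : 0 < R) :
    volume.withDensity (powDensity c p) (Set.Iio R) = c * ENNReal.ofReal (R ^ p / p) := by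
  rw [withDensity_apply _ measurableSet_Iio, powDensity, lintegral_indicator measurableSet_Ioi,
    Measure.restrict_restrict measurableSet_Ioi, Set.Ioi_inter_Iio,
    lintegral_const_mul _ (by fun_prop)]
  have hint := intervalIntegral.intervalIntegrable_rpow' (a := 0) (b := R) (r := p - 1)
    (by linarith)
  have h := integral_rpow (a := 0) (b := R) (r := p - 1) (Or.inl (by linarith))
  rw [intervalIntegral.integral_of_le hR.le, integral_Ioc_eq_integral_Ioo, sub_add_cancel,
    Real.zero_rpow hp.ne', sub_zero] at h
  rw [← h, ofReal_integral_eq_lintegral_ofReal]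
  · exact ((intervalIntegrable_iff_integrableOn_Ioc_of_le hR.le).1 hint).mono_set
      Set.Ioo_subset_Ioc_self
  · filter_upwards [ae_restrict_mem measurableSet_Ioo] with r hr
    exact Real.rpow_nonneg hr.1.le _

theorem withDensity_powDensity_Iio_of_nonpos (c : ENNReal) (p : ℝ) {R : ℝ} (hR : R ≤ 0) :
    volume.withDensity (powDensity c p) (Set.Iio R) = 0 := by
  rw [withDensity_apply _ measurableSet_Iio, powDensity, lintegral_indicator measurableSet_Ioi,
    Measure.restrict_restrict measurableSet_Ioi, Set.Ioi_inter_Iio, Set.Ioo_eq_empty (by linarith)]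
  simp

theorem measurable_sum_norm_sq {κ : Type*} [Fintype κ] :
    Measurable fun ξ : κ → 𝕂 => ∑ i, ‖ξ i‖ ^ 2 := by fun_prop

theorem vectorHaar_ball_ne_top (κ : Type*) [Fintype κ] (R : ℝ) :
    vectorHaar 𝕂 κ {ξ | ∑ i, ‖ξ i‖ ^ 2 < R} ≠ ⊤ := by
  refine ne_top_of_le_ne_top (measure_closedBall_lt_top (x := (0 : κ → 𝕂)) (r := √R)).ne
    (measure_mono fun ξ hξ => ?_)
  rw [mem_closedBall_zero_iff, pi_norm_le_iff_of_nonneg (Real.sqrt_nonneg _)]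
  intro i
  refine Real.le_sqrt_of_sq_le (le_trans ?_ (le_of_lt hξ))
  exact Finset.single_le_sum (f := fun i => ‖ξ i‖ ^ 2) (fun _ _ => by positivity)
    (Finset.mem_univ i)

open Pointwise in
-- Scaling: the ball of radius √R is √R times the unit ball, so its measure is R to half the real
-- dimension times a constant. This determines the distribution function and hence the density.
theorem map_sum_norm_sq_vectorHaar (κ : Type*) [Fintype κ] [Nonempty κ] :
    ∃ c : ENNReal, c ≠ ⊤ ∧ (vectorHaar 𝕂 κ).map (fun ξ => ∑ i, ‖ξ i‖ ^ 2) =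
      volume.withDensity (powDensity c ((Module.finrank ℝ 𝕂 : ℝ) / 2 * Fintype.card κ)) := by
  set p : ℝ := (Module.finrank ℝ 𝕂 : ℝ) / 2 * Fintype.card κ with hp
  have hp0 : 0 < p := by
    have h1 : 0 < Module.finrank ℝ 𝕂 := Module.finrank_pos
    have h2 : 0 < Fintype.card κ := Fintype.card_pos
    positivity
  set m := vectorHaar 𝕂 κ {ξ | ∑ i, ‖ξ i‖ ^ 2 < 1} with hm
  have hmtop : m ≠ ⊤ := vectorHaar_ball_ne_top κ 1
  have hctop : m * ENNReal.ofReal p ≠ ⊤ := ENNReal.mul_ne_top hmtop ENNReal.ofReal_ne_top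
  refine ⟨m * ENNReal.ofReal p, hctop, ?_⟩
  have hIio : ∀ R : ℝ, (vectorHaar 𝕂 κ).map (fun ξ => ∑ i, ‖ξ i‖ ^ 2) (Set.Iio R) =
      volume.withDensity (powDensity (m * ENNReal.ofReal p) p) (Set.Iio R) := by
    intro R
    rw [Measure.map_apply measurable_sum_norm_sq measurableSet_Iio]
    rcases le_or_gt R 0 with hR | hR
    · rw [withDensity_powDensity_Iio_of_nonpos _ _ hR]
      refine (congrArg (vectorHaar 𝕂 κ) ?_).trans measure_empty
      ext ξ
      simp only [Set.mem_preimage, Set.mem_Iio, Set.mem_empty_iff_false, iff_false, not_lt]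
      exact hR.trans (by positivity)
    · rw [withDensity_powDensity_Iio _ hp0 hR]
      have hset : (fun ξ : κ → 𝕂 => ∑ i, ‖ξ i‖ ^ 2) ⁻¹' Set.Iio R =
          √R • {ξ : κ → 𝕂 | ∑ i, ‖ξ i‖ ^ 2 < 1} := by
        ext ξ
        rw [Set.mem_smul_set_iff_inv_smul_mem₀ (Real.sqrt_ne_zero'.2 hR)]
        simp only [Set.mem_preimage, Set.mem_Iio, Set.mem_ofPred_eq, Pi.smul_apply, norm_smul,
          mul_pow, ← Finset.mul_sum, norm_inv, Real.norm_eq_abs, inv_pow, sq_abs, Real.sq_sqrt hR.le]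
        rw [inv_mul_lt_iff₀ hR, mul_one]
      rw [hset, Measure.addHaar_smul_of_nonneg _ (Real.sqrt_nonneg R), mul_assoc,
        ← ENNReal.ofReal_mul hp0.le, mul_div_cancel₀ _ hp0.ne', mul_comm, ← hm]
      congr 2
      rw [Module.finrank_pi_fintype, Finset.sum_const, smul_eq_mul, Finset.card_univ,
        Real.sqrt_eq_rpow, ← Real.rpow_natCast, ← Real.rpow_mul hR.le, hp]
      congr 1
      push_cast
      ring
  have hfin : ∀ R : ℝ, volume.withDensity (powDensity (m * ENNReal.ofReal p) p) (Set.Iio R) ≠ ⊤ := by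
    intro R
    rcases le_or_gt R 0 with hR | hR
    · rw [withDensity_powDensity_Iio_of_nonpos _ _ hR]; simp
    · rw [withDensity_powDensity_Iio _ hp0 hR]
      exact ENNReal.mul_ne_top hctop ENNReal.ofReal_ne_top
  refine Measure.ext_of_Ico' _ _ (fun a b _ => ?_) fun a b hab => ?_
  · refine ne_top_of_le_ne_top ?_ (measure_mono Set.Ico_subset_Iio_self)
    rw [hIio]; exact hfin b
  · have hs : Set.Ico a b = Set.Iio b \ Set.Iio a := by ext x; simp
    rw [hs, measure_sdiff (Set.Iio_subset_Iio hab.le) measurableSet_Iio.nullMeasurableSet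
      (by rw [hIio]; exact hfin a), measure_sdiff (Set.Iio_subset_Iio hab.le)
      measurableSet_Iio.nullMeasurableSet (hfin a), hIio, hIio]

theorem sigmaFinite_powDensity {c : ENNReal} (hc : c ≠ ⊤) (p : ℝ) :
    SigmaFinite (volume.withDensity (powDensity c p)) := by
  refine SigmaFinite.withDensity_of_ne_top (Filter.Eventually.of_forall fun r => ?_)
  rw [powDensity]
  by_cases h : r ∈ Set.Ioi 0
  · rw [Set.indicator_of_mem h]
    exact ENNReal.mul_ne_top hc ENNReal.ofReal_ne_top
  · rw [Set.indicator_of_notMem h]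
    exact ENNReal.zero_ne_top

theorem map_pi_fibers_vectorHaar {n k : ℕ} (b : Fin n → Fin k) :
    (Measure.pi fun j => vectorHaar 𝕂 {i // b i = j}).map (fun η i => η (b i) ⟨i, rfl⟩) =
      vectorHaar 𝕂 (Fin n) := by
  symm
  refine Measure.pi_eq fun s hs => ?_
  have hm : Measurable fun (η : ∀ j, {i // b i = j} → 𝕂) (i : Fin n) => η (b i) ⟨i, rfl⟩ := by
    fun_prop
  rw [Measure.map_apply hm (MeasurableSet.univ_pi hs)]
  have hset : (fun (η : ∀ j, {i // b i = j} → 𝕂) (i : Fin n) => η (b i) ⟨i, rfl⟩) ⁻¹'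
      Set.univ.pi s = Set.univ.pi fun j => Set.univ.pi fun i : {i // b i = j} => s i := by
    ext η
    simp only [Set.mem_preimage, Set.mem_univ_pi]
    refine ⟨fun h j i => ?_, fun h i => h _ ⟨i, rfl⟩⟩
    obtain ⟨i, rfl⟩ := i
    exact h i
  rw [hset, Measure.pi_pi]
  simp only [vectorHaar, Measure.pi_pi]
  exact Fintype.prod_fiberwise b fun i => Measure.addHaar (s i)

/-- Additive Haar measure on vectors is a product over the blocks, so the block norms have a product
density, with one exponent per block proportional to its size. -/
theorem map_block_norms_vectorHaar {n k : ℕ} (b : Fin n → Fin k) (hb : Function.Surjective b) :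
    ∃ c : Fin k → ENNReal,
      (vectorHaar 𝕂 (Fin n)).map (fun ξ j => ∑ i : {i // b i = j}, ‖ξ i‖ ^ 2) =
        volume.withDensity fun γ => ∏ j, powDensity (c j) ((Module.finrank ℝ 𝕂 : ℝ) / 2 *
          Fintype.card {i // b i = j}) (γ j) := by
  have hne : ∀ j, Nonempty {i // b i = j} := fun j => let ⟨i, hi⟩ := hb j; ⟨⟨i, hi⟩⟩
  choose c hc hmap using fun j => map_sum_norm_sq_vectorHaar (𝕂 := 𝕂) {i // b i = j}
  refine ⟨c, ?_⟩
  have hsf := fun j => sigmaFinite_powDensity (hc j)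
    ((Module.finrank ℝ 𝕂 : ℝ) / 2 * Fintype.card {i // b i = j})
  rw [← pi_withDensity _ fun j => measurable_powDensity _ _]
  simp only [← hmap] at hsf ⊢
  rw [← Measure.pi_map_pi fun j => measurable_sum_norm_sq.aemeasurable,
    ← map_pi_fibers_vectorHaar b, Measure.map_map (by fun_prop) (by fun_prop)]
  congr 1
  funext η j
  refine Finset.sum_congr rfl fun i _ => ?_
  obtain ⟨i, rfl⟩ := i
  rfl

end normLaw

/-! ### Block norms of a column of a Haar unitary are Dirichlet -/

section haarColumn

variable {𝕂 : Type} [NormedDivisionRing 𝕂] [NormedAlgebra ℝ 𝕂] [StarRing 𝕂]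
  [hK : IsCompositionField 𝕂]

theorem sum_norm_sq_mulVec {n : ℕ} {g : Matrix (Fin n) (Fin n) 𝕂} (hg : g ∈ UGroup 𝕂 n)
    (ξ : Fin n → 𝕂) : ∑ i, ‖(g *ᵥ ξ) i‖ ^ 2 = ∑ i, ‖ξ i‖ ^ 2 := by
  have h1 := conjTranspose_mul_self_apply_self (Matrix.of fun i (_ : Fin 1) => ξ i) 0
  have h2 := conjTranspose_mul_self_apply_self (g * Matrix.of fun i (_ : Fin 1) => ξ i) 0
  rw [conjTranspose_unitary_mul_mul hg, h1] at h2
  exact ((algebraMap ℝ 𝕂).injective h2).symm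

/-- The squared norms of the blocks of a vector. -/
noncomputable def blockNorms {n k : ℕ} (b : Fin n → Fin k) (ξ : Fin n → 𝕂) (j : Fin k) : ℝ :=
  ∑ i : {i // b i = j}, ‖ξ i‖ ^ 2

theorem sum_blockNorms {n k : ℕ} (b : Fin n → Fin k) (ξ : Fin n → 𝕂) :
    ∑ j, blockNorms b ξ j = ∑ i, ‖ξ i‖ ^ 2 :=
  Fintype.sum_fiberwise b fun i => ‖ξ i‖ ^ 2

theorem blockNorms_smul {n k : ℕ} (b : Fin n → Fin k) (r : ℝ) (ξ : Fin n → 𝕂) (j : Fin k) :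
    blockNorms b (r • ξ) j = r ^ 2 * blockNorms b ξ j := by
  simp [blockNorms, norm_smul, mul_pow, Finset.mul_sum]

variable [MeasurableSpace 𝕂] [BorelSpace 𝕂]

@[fun_prop]
theorem measurable_blockNorms {n k : ℕ} (b : Fin n → Fin k) :
    Measurable (blockNorms b : (Fin n → 𝕂) → Fin k → ℝ) := by
  unfold blockNorms
  fun_prop

theorem measurable_column {n : ℕ} (j : Fin n) :
    Measurable fun (g : UGroup 𝕂 n) l => (g : Matrix (Fin n) (Fin n) 𝕂) l j :=
  Continuous.measurable (continuous_pi fun l => continuous_subtype_val.matrix_elem l j)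

theorem measurable_blockNorms_column {n k : ℕ} (b : Fin n → Fin (k + 1)) (j : Fin n) :
    Measurable fun (g : UGroup 𝕂 n) (i : Fin k) =>
      blockNorms b (fun l => (g : Matrix (Fin n) (Fin n) 𝕂) l j) i.succ := by
  have h := (measurable_blockNorms (𝕂 := 𝕂) b).comp (measurable_column j)
  exact measurable_pi_iff.2 fun i => (measurable_pi_apply i.succ).comp h

/-- A real linear bijection multiplies additive Haar measure by a constant. The unit ball is
preserved and has finite positive measure, so the constant is one. -/
theorem measurePreserving_mulVec {n : ℕ} {g : Matrix (Fin n) (Fin n) 𝕂} (hg : g ∈ UGroup 𝕂 n) :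
    MeasurePreserving (fun ξ => g *ᵥ ξ) (vectorHaar 𝕂 (Fin n)) (vectorHaar 𝕂 (Fin n)) := by
  let T : (Fin n → 𝕂) →ₗ[ℝ] (Fin n → 𝕂) :=
    { toFun := fun ξ => g *ᵥ ξ
      map_add' := fun ξ η => Matrix.mulVec_add g ξ η
      map_smul' := fun r ξ => Matrix.mulVec_smul g r ξ }
  have hTc : Continuous T := T.continuous_of_finiteDimensional
  refine ⟨hTc.measurable, ?_⟩
  have hinj : Function.Injective T := by
    intro ξ η h
    have h' : star g *ᵥ (g *ᵥ ξ) = star g *ᵥ (g *ᵥ η) := congrArg _ h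
    rwa [Matrix.mulVec_mulVec, Matrix.mulVec_mulVec, (Unitary.mem_iff.1 hg).1, Matrix.one_mulVec,
      Matrix.one_mulVec] at h'
  have hdet : LinearMap.det T ≠ 0 := by
    rw [← isUnit_iff_ne_zero]
    exact (LinearEquiv.isUnit_det' (LinearEquiv.ofInjectiveEndo T hinj))
  have hmap := Measure.map_linearMap_addHaar_eq_smul_addHaar (vectorHaar 𝕂 (Fin n)) hdet
  set B : Set (Fin n → 𝕂) := {ξ | ∑ i, ‖ξ i‖ ^ 2 < 1} with hB
  have hBm : MeasurableSet B := measurableSet_lt (by fun_prop) measurable_const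
  have hB0 : vectorHaar 𝕂 (Fin n) B ≠ 0 := by
    refine (IsOpen.measure_pos _ ?_ ⟨0, by simp [hB]⟩).ne'
    exact isOpen_lt (by fun_prop) continuous_const
  have h1 := congrArg (fun μ => μ B) hmap
  simp only [Measure.smul_apply, smul_eq_mul] at h1
  rw [Measure.map_apply hTc.measurable hBm] at h1
  have h2 : T ⁻¹' B = B := by
    ext ξ
    simp only [Set.mem_preimage, hB, Set.mem_ofPred_eq]
    change (∑ i, ‖(g *ᵥ ξ) i‖ ^ 2 < 1) ↔ _
    rw [sum_norm_sq_mulVec hg]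
  rw [h2] at h1
  have h3 : ENNReal.ofReal |(LinearMap.det T)⁻¹| = 1 := by
    have := (ENNReal.mul_left_inj hB0 (vectorHaar_ball_ne_top (Fin n) 1)).1 (h1.symm.trans
      (one_mul _).symm)
    exact this
  rw [h3, one_smul] at hmap
  exact hmap

/-- Integrals over the ball of functions of the direction, by averaging over the unitary group. -/
theorem setLIntegral_vectorHaar_eq_haarU {n k : ℕ} (b : Fin n → Fin (k + 1)) (j₀ : Fin n)
    {f : (Fin k → ℝ) → ENNReal} (hf : Measurable f) :
    ∫⁻ ξ in {ξ | ∑ i, ‖ξ i‖ ^ 2 < 1},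
        f (fun i => blockNorms b ξ i.succ / ∑ j, blockNorms b ξ j) ∂vectorHaar 𝕂 (Fin n) =
      vectorHaar 𝕂 (Fin n) {ξ | ∑ i, ‖ξ i‖ ^ 2 < 1} *
        ∫⁻ g : UGroup 𝕂 n, f (fun i => blockNorms b (fun l => (g : Matrix (Fin n) (Fin n) 𝕂) l j₀) i.succ)
          ∂haarU 𝕂 n := by
  set B : Set (Fin n → 𝕂) := {ξ | ∑ i, ‖ξ i‖ ^ 2 < 1} with hB
  have hBm : MeasurableSet B := measurableSet_lt (by fun_prop) measurable_const
  set F : (Fin n → 𝕂) → ENNReal := B.indicator fun ξ =>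
    f (fun i => blockNorms b ξ i.succ / ∑ j, blockNorms b ξ j) with hF
  have hFm : Measurable F := by
    refine Measurable.indicator (hf.comp ?_) hBm
    have := measurable_blockNorms (𝕂 := 𝕂) b
    fun_prop
  have hact : Measurable fun p : UGroup 𝕂 n × (Fin n → 𝕂) => (p.1 : Matrix (Fin n) (Fin n) 𝕂) *ᵥ p.2 := by
    refine Continuous.measurable ?_
    exact (continuous_subtype_val.comp continuous_fst).matrix_mulVec continuous_snd
  set J := ∫⁻ g : UGroup 𝕂 n, f (fun i => blockNorms b (fun l => (g : Matrix (Fin n) (Fin n) 𝕂) l j₀) i.succ)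
          ∂haarU 𝕂 n with hJ
  rw [← lintegral_indicator hBm, ← hF]
  -- Rotating ξ does not change the integral, so it may be averaged over the unitary group; the
  -- order of integration is then exchanged.
  have h1 : ∫⁻ ξ, F ξ ∂vectorHaar 𝕂 (Fin n) = ∫⁻ g : UGroup 𝕂 n, ∫⁻ ξ,
      F ((g : Matrix (Fin n) (Fin n) 𝕂) *ᵥ ξ) ∂vectorHaar 𝕂 (Fin n) ∂haarU 𝕂 n := by
    have : ∀ g : UGroup 𝕂 n, ∫⁻ ξ, F ((g : Matrix (Fin n) (Fin n) 𝕂) *ᵥ ξ) ∂vectorHaar 𝕂 (Fin n) =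
        ∫⁻ ξ, F ξ ∂vectorHaar 𝕂 (Fin n) := fun g =>
      (measurePreserving_mulVec g.2).lintegral_comp hFm
    simp only [this, lintegral_const, measure_univ, mul_one]
  have hswap := lintegral_lintegral_swap (μ := haarU 𝕂 n) (ν := vectorHaar 𝕂 (Fin n))
    (f := fun g ξ => F ((g : Matrix (Fin n) (Fin n) 𝕂) *ᵥ ξ)) (hFm.comp hact).aemeasurable
  rw [h1, hswap]
  have h2 : ∀ᵐ ξ ∂vectorHaar 𝕂 (Fin n), ∫⁻ g : UGroup 𝕂 n, F ((g : Matrix (Fin n) (Fin n) 𝕂) *ᵥ ξ) ∂haarU 𝕂 n =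
      B.indicator (fun _ => J) ξ := by
    have : Nonempty (Fin n) := ⟨j₀⟩
    have hne : ∀ᵐ ξ ∂vectorHaar 𝕂 (Fin n), ξ ≠ 0 := by
      simp [ae_iff]
    filter_upwards [hne] with ξ hξ
    set s := ∑ i, ‖ξ i‖ ^ 2 with hs
    have hs0 : 0 < s := by
      obtain ⟨i, hi⟩ := Function.ne_iff.1 hξ
      refine Finset.sum_pos' (fun _ _ => by positivity) ⟨i, Finset.mem_univ i, ?_⟩
      have : 0 < ‖ξ i‖ := norm_pos_iff.2 hi
      positivity
    -- With ξ / |ξ| as column j₀ of g', the vector g ξ / |ξ| is column j₀ of g * g', and right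
    -- invariance removes g'.
    obtain ⟨g', hg', hcol'⟩ := exists_unitary_apply_eq (fun i => (√s)⁻¹ • ξ i) (by
      simp only [norm_smul, mul_pow, ← Finset.mul_sum, ← hs, norm_inv, Real.norm_eq_abs, inv_pow,
        sq_abs, Real.sq_sqrt hs0.le]
      exact inv_mul_cancel₀ hs0.ne') j₀
    have hgξ : ∀ g : UGroup 𝕂 n, F ((g : Matrix (Fin n) (Fin n) 𝕂) *ᵥ ξ) = B.indicator (fun _ =>
        f (fun i => blockNorms b (fun l => ((g * ⟨g', hg'⟩ : UGroup 𝕂 n) : Matrix _ _ 𝕂) l j₀)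
          i.succ)) ξ := by
      intro g
      have hvec : (fun l => ((g * ⟨g', hg'⟩ : UGroup 𝕂 n) : Matrix (Fin n) (Fin n) 𝕂) l j₀) =
          (√s)⁻¹ • ((g : Matrix (Fin n) (Fin n) 𝕂) *ᵥ ξ) := by
        rw [← Matrix.mulVec_smul]
        funext l
        simp only [Submonoid.coe_mul, Matrix.mul_apply, hcol', Matrix.mulVec, dotProduct,
          Pi.smul_apply]
      by_cases hξB : ξ ∈ B
      · have hgB : (g : Matrix (Fin n) (Fin n) 𝕂) *ᵥ ξ ∈ B := by
          rw [hB, Set.mem_ofPred_eq, sum_norm_sq_mulVec g.2]; exact hξB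
        rw [hF, Set.indicator_of_mem hgB, Set.indicator_of_mem hξB, hvec]
        congr 1
        funext i
        rw [blockNorms_smul, sum_blockNorms, sum_norm_sq_mulVec g.2, ← hs, inv_pow,
          Real.sq_sqrt hs0.le, div_eq_inv_mul]
      · have hgB : (g : Matrix (Fin n) (Fin n) 𝕂) *ᵥ ξ ∉ B := by
          rw [hB, Set.mem_ofPred_eq, sum_norm_sq_mulVec g.2]; exact hξB
        rw [hF, Set.indicator_of_notMem hgB, Set.indicator_of_notMem hξB]
    simp only [hgξ]
    by_cases hξB : ξ ∈ B
    · simp only [Set.indicator_of_mem hξB]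
      exact (measurePreserving_mul_right_haarU (⟨g', hg'⟩ : UGroup 𝕂 n)).lintegral_comp
        (f := fun g => f (fun i => blockNorms b (fun l => (g : Matrix (Fin n) (Fin n) 𝕂) l j₀) i.succ))
        (hf.comp (measurable_blockNorms_column b j₀))
    · simp only [Set.indicator_of_notMem hξB, lintegral_zero]
  rw [lintegral_congr_ae h2, lintegral_indicator hBm, lintegral_const, Measure.restrict_apply_univ,
    mul_comm]

/-- The unnormalised Dirichlet distribution, in the coordinates other than the first one. -/
noncomputable def dirichletMeasure {k : ℕ} (e : Fin (k + 1) → ℝ) : Measure (Fin k → ℝ) :=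
  (volume.restrict (openSimplex k)).withDensity (dirichletWeight e)

/-- A Haar column is distributed as the direction of a vector uniform in the unit ball. The block
norms of such a vector have a product of power densities on the region where their sum is below one,
and their ratios to the total are Dirichlet. -/
theorem exists_map_column_haarU_eq {n k : ℕ} (b : Fin n → Fin (k + 1)) (hb : Function.Surjective b)
    (j₀ : Fin n) : ∃ c : ENNReal,
      (haarU 𝕂 n).map (fun (g : UGroup 𝕂 n) i => blockNorms b (fun l => (g : Matrix (Fin n) (Fin n) 𝕂) l j₀) (Fin.succ i)) =
        c • dirichletMeasure fun j => (Module.finrank ℝ 𝕂 : ℝ) / 2 * Fintype.card {i // b i = j} := by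
  set e : Fin (k + 1) → ℝ := fun j => (Module.finrank ℝ 𝕂 : ℝ) / 2 * Fintype.card {i // b i = j}
    with he
  set m := vectorHaar 𝕂 (Fin n) {ξ | ∑ i, ‖ξ i‖ ^ 2 < 1} with hm
  have hm0 : m ≠ 0 := by
    refine (IsOpen.measure_pos _ ?_ ⟨0, by simp⟩).ne'
    exact isOpen_lt (by fun_prop) continuous_const
  have hmtop : m ≠ ⊤ := vectorHaar_ball_ne_top _ 1
  obtain ⟨c, hc⟩ := map_block_norms_vectorHaar (𝕂 := 𝕂) b hb
  obtain ⟨K, hKf⟩ := exists_lintegral_openCorner e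
  have hcol := measurable_blockNorms_column (𝕂 := 𝕂) b j₀
  refine ⟨m⁻¹ * ((∏ j, c j) * K), Measure.ext fun s hs => ?_⟩
  have hf : Measurable (s.indicator (1 : (Fin k → ℝ) → ENNReal)) := measurable_one.indicator hs
  set f := s.indicator (1 : (Fin k → ℝ) → ENNReal) with hfdef
  have h1 := setLIntegral_vectorHaar_eq_haarU (𝕂 := 𝕂) b j₀ hf
  rw [← hm, ← lintegral_map hf hcol, hfdef, lintegral_indicator_one hs, ← hfdef] at h1
  have h2 : ∫⁻ ξ in {ξ | ∑ i, ‖ξ i‖ ^ 2 < 1},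
        f (fun i => blockNorms b ξ i.succ / ∑ j, blockNorms b ξ j) ∂vectorHaar 𝕂 (Fin n) =
      (∏ j, c j) * ∫⁻ γ in openCorner k, f (fun i => γ i.succ / ∑ j, γ j) *
          ENNReal.ofReal (∏ j, γ j ^ (e j - 1)) := by
    have hGm : Measurable ({γ : Fin (k + 1) → ℝ | ∑ j, γ j < 1}.indicator fun γ =>
        f fun i : Fin k => γ i.succ / ∑ j, γ j) := by
      refine Measurable.indicator (hf.comp (by fun_prop)) ?_
      exact measurableSet_lt (by fun_prop) measurable_const
    have h3 := lintegral_map (μ := vectorHaar 𝕂 (Fin n)) hGm (measurable_blockNorms (𝕂 := 𝕂) b)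
    have hc' : (vectorHaar 𝕂 (Fin n)).map (blockNorms b) =
      volume.withDensity fun γ => ∏ j, powDensity (c j) (e j) (γ j) := hc
    rw [← lintegral_indicator (measurableSet_lt (by fun_prop) measurable_const)]
    have h4 : ∀ ξ : Fin n → 𝕂, {ξ : Fin n → 𝕂 | ∑ i, ‖ξ i‖ ^ 2 < 1}.indicator (fun ξ =>
        f (fun i => blockNorms b ξ i.succ / ∑ j, blockNorms b ξ j)) ξ =
        ({γ : Fin (k + 1) → ℝ | ∑ j, γ j < 1}.indicator fun γ =>
        f fun i : Fin k => γ i.succ / ∑ j, γ j) (blockNorms b ξ) := by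
      intro ξ
      simp only [Set.indicator, Set.mem_ofPred_eq, sum_blockNorms]
    simp only [h4]
    rw [← h3, hc', lintegral_withDensity_eq_lintegral_mul _ (by fun_prop) hGm,
      ← lintegral_indicator measurableSet_openCorner, ← lintegral_const_mul _ (by
        refine Measurable.indicator (Measurable.mul (hf.comp (by fun_prop)) (by fun_prop))
          measurableSet_openCorner)]
    refine lintegral_congr fun γ => ?_
    simp only [Pi.mul_apply]
    by_cases hpos : ∀ j, 0 < γ j
    · have hp : ∏ j, powDensity (c j) (e j) (γ j) =
          (∏ j, c j) * ENNReal.ofReal (∏ j, γ j ^ (e j - 1)) := by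
        rw [ENNReal.ofReal_prod_of_nonneg fun j _ => Real.rpow_nonneg (hpos j).le _,
          ← Finset.prod_mul_distrib]
        exact Finset.prod_congr rfl fun j _ => Set.indicator_of_mem (hpos j) _
      rw [hp]
      by_cases hsum : ∑ j, γ j < 1
      · rw [Set.indicator_of_mem (s := {γ : Fin (k + 1) → ℝ | ∑ j, γ j < 1}) hsum,
          Set.indicator_of_mem (s := openCorner k) ⟨hpos, hsum⟩]
        ring
      · rw [Set.indicator_of_notMem (s := {γ : Fin (k + 1) → ℝ | ∑ j, γ j < 1}) hsum,
          Set.indicator_of_notMem (s := openCorner k) fun h => hsum h.2]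
        simp
    · rw [Set.indicator_of_notMem (s := openCorner k) fun h => hpos h.1]
      push Not at hpos
      obtain ⟨j, hj⟩ := hpos
      have hp : powDensity (c j) (e j) (γ j) = 0 := Set.indicator_of_notMem (by simpa using hj) _
      rw [Finset.prod_eq_zero (Finset.mem_univ j) hp]
      simp
  have h5 : dirichletMeasure e s = ∫⁻ w in openSimplex k, f w * dirichletWeight e w := by
    rw [dirichletMeasure, withDensity_apply _ hs, ← lintegral_indicator hs]
    refine lintegral_congr fun w => ?_
    by_cases hw : w ∈ s
    · simp [hfdef, hw]
    · simp [hfdef, hw]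
  rw [h2, hKf f hf, ← h5, ← mul_assoc] at h1
  rw [Measure.smul_apply, smul_eq_mul, mul_assoc, h1, ← mul_assoc, ENNReal.inv_mul_cancel hm0 hmtop,
    one_mul]

end haarColumn

/-! ### Singular values of a diagonal matrix bordered by one column -/

section bordered

variable {𝕂 : Type} [NormedDivisionRing 𝕂] [NormedAlgebra ℝ 𝕂] [StarRing 𝕂]
  [hK : IsCompositionField 𝕂]

theorem sum_fin_castLE_add {M : Type*} [AddCommMonoid M] {N n : ℕ} (h : N ≤ n) (f : Fin n → M) :
    ∑ i, f i = ∑ j : Fin N, f (Fin.castLE h j) + ∑ i ∈ Finset.univ.filter (fun i : Fin n => N ≤ (i : ℕ)), f i := by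
  rw [← Finset.sum_filter_add_sum_filter_not Finset.univ (fun i : Fin n => (i : ℕ) < N)]
  congr 1
  · have : (Finset.univ.filter fun i : Fin n => (i : ℕ) < N) =
        Finset.univ.map (Fin.castLEEmb h) := by
      ext i
      simp only [Finset.mem_filter, Finset.mem_univ, true_and, Finset.mem_map]
      exact ⟨fun hi => ⟨⟨i, hi⟩, rfl⟩, fun ⟨j, hj⟩ => hj ▸ j.2⟩
    rw [this, Finset.sum_map]
    rfl
  · simp only [not_lt]

/-- The weights of the last column of `borderedMatrix`. -/
noncomputable def borderWeight {N : ℕ} (x : Fin N → ℝ) (i : ℕ) : ℝ :=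
  if h : i < N then √(1 - x ⟨i, h⟩) else 1

/-- The matrix with singular values `√x` extended by one column. -/
noncomputable def borderedMatrix {n N : ℕ} (x : Fin N → ℝ) (q : Fin n → 𝕂) :
    Matrix (Fin n) (Fin (N + 1)) 𝕂 :=
  Matrix.of fun i => Fin.snoc (rectDiag 𝕂 n (fun j => √(x j)) i) (borderWeight x i • q i)

/-- The poles `1 > x₁ > ⋯ > x_N > 0`. -/
def polesOf {N : ℕ} (x : Fin N → ℝ) : Fin (N + 2) → ℝ := Fin.cons 1 (Fin.snoc x 0)

/-- Strictly decreasing vectors with entries in `(0, 1)`. -/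
def strictChamber (N : ℕ) : Set (Fin N → ℝ) := {x | StrictAnti x ∧ ∀ i, x i ∈ Set.Ioo (0 : ℝ) 1}

theorem polesOf_strictAnti {N : ℕ} {x : Fin N → ℝ} (hx : x ∈ strictChamber N) :
    StrictAnti (polesOf x) := by
  have h1 : StrictAnti (Fin.snoc x 0 : Fin (N + 1) → ℝ) := by
    intro i j hij
    induction j using Fin.lastCases with
    | last =>
      obtain ⟨i, rfl⟩ := Fin.exists_castSucc_eq.2 hij.ne
      simpa using (hx.2 i).1
    | cast j =>
      obtain ⟨i, rfl⟩ := Fin.exists_castSucc_eq.2 (hij.trans (Fin.castSucc_lt_last j)).ne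
      simpa using hx.1 (Fin.castSucc_lt_castSucc_iff.1 hij)
  intro i j hij
  induction j using Fin.cases with
  | zero => exact absurd hij (Fin.not_lt_zero i)
  | succ j =>
    induction i using Fin.cases with
    | zero =>
      simp only [polesOf, Fin.cons_zero, Fin.cons_succ]
      induction j using Fin.lastCases with
      | last => simp
      | cast j => simpa using (hx.2 j).2
    | succ i =>
      simp only [polesOf, Fin.cons_succ]
      exact h1 (Fin.succ_lt_succ_iff.1 hij)

/-- The weights at the poles `x₁, …, x_N, 0` of a vector. -/
noncomputable def poleWeights {n : ℕ} (N : ℕ) (h : N ≤ n) (q : Fin n → 𝕂) : Fin (N + 1) → ℝ :=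
  Fin.snoc (fun j : Fin N => ‖q (Fin.castLE h j)‖ ^ 2) (∑ i ∈ Finset.univ.filter (fun i : Fin n => N ≤ (i : ℕ)), ‖q i‖ ^ 2)

/-- The Gram matrix is diag(x) bordered by one row and one column, so its eigenvectors are explicit:
for the eigenvalue t_l the entries are ρ_j q_j / (t_l - x_j) and a last entry 1, up to
normalisation. The last coordinate of the eigenvalue equation is the secular equation for the poles
1, x_1, …, x_N, 0 in disguise. -/
theorem sqSingularValues_borderedMatrix {n N : ℕ} (h : N ≤ n) {x : Fin N → ℝ}
    (hx : x ∈ strictChamber N) {t : Fin (N + 1) → ℝ} (ht : t ∈ interlacing (polesOf x))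
    {q : Fin n → 𝕂} (hq : (fun j : Fin (N + 1) => residue (polesOf x) t j.succ) =
      poleWeights N h q) :
    sqSingularValues (borderedMatrix x q) = t := by
  have ha := polesOf_strictAnti hx
  set w : Fin N → ℝ := fun j => ‖q (Fin.castLE h j)‖ ^ 2 with hw
  set w' : ℝ := ∑ i ∈ Finset.univ.filter (fun i : Fin n => N ≤ (i : ℕ)), ‖q i‖ ^ 2 with hw'
  set H : ℝ := ∑ j, (1 - x j) * w j + w' with hH
  set ρ : Fin N → ℝ := fun j => √(x j) * √(1 - x j) with hρ
  have hρ2 : ∀ j, ρ j * ρ j = x j * (1 - x j) := by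
    intro j
    rw [hρ]
    have h1 := Real.mul_self_sqrt (hx.2 j).1.le
    have h2 := Real.mul_self_sqrt (show 0 ≤ 1 - x j by linarith [(hx.2 j).2])
    calc _ = (√(x j) * √(x j)) * (√(1 - x j) * √(1 - x j)) := by ring
      _ = _ := by rw [h1, h2]
  have htx : ∀ l j, t l - x j ≠ 0 := by
    intro l j hlj
    have h1 := residue_pos ha ht j.castSucc.succ
    rw [residue, Finset.prod_eq_zero (Finset.mem_univ l)] at h1
    · exact lt_irrefl _ h1
    · simp only [polesOf, Fin.cons_succ, Fin.snoc_castSucc]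
      rw [show x j - t l = 0 by linarith, zero_div]
  have ht0 : ∀ l, 0 < t l ∧ t l < 1 := by
    intro l
    have h1 := ht l
    have h2 : polesOf x (Fin.last _) ≤ polesOf x l.succ := ha.antitone (Fin.le_last _)
    have h3 : polesOf x l.castSucc ≤ polesOf x 0 := ha.antitone (Fin.zero_le _)
    have h4 : polesOf x (Fin.last (N + 1)) = 0 := by
      rw [← Fin.succ_last]; simp [polesOf]
    have h5 : polesOf x 0 = 1 := rfl
    exact ⟨by linarith, by linarith⟩
  -- The secular equation multiplied by t (t - 1), with the residue at the pole 1 written as the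
  -- missing mass 1 - ∑ w - w'.
  have hsec : ∀ l, ∑ j, x j * (1 - x j) * w j / (t l - x j) + H = t l := by
    intro l
    have h1 := sum_residue_div ha ht l
    have hr : ∀ j : Fin (N + 1), residue (polesOf x) t j.succ = poleWeights N h q j :=
      fun j => congrFun hq j
    rw [Fin.sum_univ_succ, residue_zero ha] at h1
    simp only [hr] at h1
    rw [Fin.sum_univ_castSucc, Fin.sum_univ_castSucc] at h1
    simp only [poleWeights, Fin.snoc_castSucc, Fin.snoc_last, polesOf, Fin.cons_zero,
      Fin.cons_succ, sub_zero] at h1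
    change (1 - (∑ j, w j + w')) / (t l - 1) + (∑ j, w j / (t l - x j) + w' / t l) = 0 at h1
    have h2 : t l ≠ 0 := (ht0 l).1.ne'
    have h3 : t l - 1 ≠ 0 := by linarith [(ht0 l).2]
    have h4 : (1 - (∑ j, w j + w')) * t l + t l * (t l - 1) * (∑ j, w j / (t l - x j)) +
        w' * (t l - 1) = 0 := by
      field_simp at h1
      linarith
    have h5 : t l * (t l - 1) * (∑ j, w j / (t l - x j)) =
        ∑ j, ((t l + x j - 1) * w j - x j * (1 - x j) * w j / (t l - x j)) := by
      rw [Finset.mul_sum]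
      refine Finset.sum_congr rfl fun j _ => ?_
      field_simp [htx l j]
      ring
    rw [h5, Finset.sum_sub_distrib] at h4
    have h6 : ∑ j, (t l + x j - 1) * w j = t l * ∑ j, w j - ∑ j, (1 - x j) * w j := by
      rw [Finset.mul_sum, ← Finset.sum_sub_distrib]
      exact Finset.sum_congr rfl fun j _ => by ring
    rw [h6] at h4
    rw [hH]
    linarith
  have hw0 : ∀ j, 0 ≤ w j := fun j => by positivity
  -- The squared length of the eigenvector whose last entry is 1.
  set ν : Fin (N + 1) → ℝ := fun l => ∑ j, x j * (1 - x j) * w j / ((t l - x j) * (t l - x j)) + 1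
    with hν
  have hν0 : ∀ l, 0 < ν l := by
    intro l
    have : 0 ≤ ∑ j, x j * (1 - x j) * w j / ((t l - x j) * (t l - x j)) := by
      refine Finset.sum_nonneg fun j _ => div_nonneg (mul_nonneg (mul_nonneg (hx.2 j).1.le ?_)
        (hw0 j)) (mul_self_nonneg _)
      linarith [(hx.2 j).2]
    simp only [hν]
    linarith
  -- Orthogonality of two eigenvectors: the difference of the equations `hsec` for l and m, divided
  -- by t l - t m.
  have horth : ∀ l m, l ≠ m →
      ∑ j, x j * (1 - x j) * w j / ((t l - x j) * (t m - x j)) + 1 = 0 := by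
    intro l m hlm
    have hlm' : t l - t m ≠ 0 :=
      sub_ne_zero.2 fun h => hlm ((interlacing.strictAnti ht).injective h)
    have h1 : (t l - t m) * ∑ j, x j * (1 - x j) * w j / ((t l - x j) * (t m - x j)) =
        ∑ j, x j * (1 - x j) * w j / (t m - x j) - ∑ j, x j * (1 - x j) * w j / (t l - x j) := by
      rw [Finset.mul_sum, ← Finset.sum_sub_distrib]
      refine Finset.sum_congr rfl fun j _ => ?_
      field_simp [htx l j, htx m j]
      ring
    have h2 : (t l - t m) *
        (∑ j, x j * (1 - x j) * w j / ((t l - x j) * (t m - x j)) + 1) = 0 := by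
      rw [mul_add, h1]
      linarith [hsec l, hsec m]
    exact (mul_eq_zero.1 h2).resolve_left hlm'
  set B := borderedMatrix x q with hB
  have hBc : ∀ i (j : Fin N), B i j.castSucc = rectDiag 𝕂 n (fun j => √(x j)) i j := fun i j => by
    simp [hB, borderedMatrix]
  have hBl : ∀ i, B i (Fin.last N) = borderWeight x i • q i := fun i => by
    simp [hB, borderedMatrix]
  have hG1 : ∀ i j : Fin N, (Bᴴ * B) i.castSucc j.castSucc = if i = j then algebraMap ℝ 𝕂 (x i) else 0 := by
    intro i j
    have h1 := congrFun (congrFun (rectDiag_conjTranspose_mul_self (𝕂 := 𝕂) h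
      (fun j => √(x j))) i) j
    rw [Matrix.mul_apply] at h1 ⊢
    simp only [Matrix.conjTranspose_apply, hBc] at h1 ⊢
    rw [h1, realDiag, Matrix.diagonal_apply, Real.mul_self_sqrt (hx.2 i).1.le]
  have hG2 : ∀ i : Fin N, (Bᴴ * B) i.castSucc (Fin.last N) = ρ i • q (Fin.castLE h i) := by
    intro i
    rw [Matrix.mul_apply, Finset.sum_eq_single (Fin.castLE h i)]
    · rw [Matrix.conjTranspose_apply, hBc, hBl]
      simp only [rectDiag, Matrix.of_apply, Fin.val_castLE, if_true, star_algebraMap_real,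
        borderWeight, Fin.is_lt, dif_pos, Fin.eta]
      rw [← Algebra.smul_def, smul_smul]
    · intro k _ hk
      rw [Matrix.conjTranspose_apply, hBc]
      have : (k : ℕ) ≠ i := fun h' => hk (Fin.ext h')
      simp [rectDiag, this]
    · simp
  have hst : ∀ (r : ℝ) (z : 𝕂), star (r • z) = r • star z := by
    intro r z
    rw [Algebra.smul_def, star_mul, star_algebraMap_real, Algebra.smul_def, Algebra.commutes]
  have hG2' : ∀ i : Fin N, (Bᴴ * B) (Fin.last N) i.castSucc = ρ i • star (q (Fin.castLE h i)) := by
    intro i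
    have h1 : (Bᴴ * B)ᴴ = Bᴴ * B := by simp
    rw [← h1, Matrix.conjTranspose_apply, hG2, hst]
  have hG3 : (Bᴴ * B) (Fin.last N) (Fin.last N) = algebraMap ℝ 𝕂 H := by
    rw [conjTranspose_mul_self_apply_self, sum_fin_castLE_add h]
    congr 1
    rw [hH]
    congr 1
    · refine Finset.sum_congr rfl fun j _ => ?_
      rw [hBl, norm_smul, mul_pow, Real.norm_eq_abs, sq_abs]
      simp only [borderWeight, Fin.val_castLE, Fin.is_lt, dif_pos, Fin.eta]
      rw [Real.sq_sqrt (by linarith [(hx.2 j).2])]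
    · refine Finset.sum_congr rfl fun i hi => ?_
      have hi' : ¬ (i : ℕ) < N := not_lt.2 (Finset.mem_filter.1 hi).2
      rw [hBl, borderWeight, dif_neg hi', one_smul]
  -- Since the last entry is real, each q j is multiplied only by reals and by its own conjugate;
  -- the verification therefore needs no commutativity.
  set V : Matrix (Fin (N + 1)) (Fin (N + 1)) 𝕂 := Matrix.of fun i l =>
    Fin.snoc (α := fun _ => 𝕂) (fun j : Fin N => (ρ j / ((t l - x j) * √(ν l))) • q (Fin.castLE h j))
      (algebraMap ℝ 𝕂 (√(ν l))⁻¹) i with hV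
  have hVc : ∀ (j : Fin N) l, V j.castSucc l = (ρ j / ((t l - x j) * √(ν l))) • q (Fin.castLE h j) :=
    fun j l => by simp [hV]
  have hVl : ∀ l, V (Fin.last N) l = algebraMap ℝ 𝕂 (√(ν l))⁻¹ := fun l => by simp [hV]
  have hsν : ∀ l, √(ν l) ≠ 0 := fun l => (Real.sqrt_pos.2 (hν0 l)).ne'
  have hVV : Vᴴ * V = 1 := by
    ext l m
    rw [Matrix.mul_apply, Fin.sum_univ_castSucc]
    simp only [Matrix.conjTranspose_apply, hVc, hVl, star_algebraMap_real, hst, smul_mul_assoc,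
      mul_smul_comm, star_mul_self_eq, smul_smul]
    have h1 : ∀ j : Fin N, (ρ j / ((t m - x j) * √(ν m)) * (ρ j / ((t l - x j) * √(ν l)))) •
        (algebraMap ℝ 𝕂) (‖q (Fin.castLE h j)‖ ^ 2) = algebraMap ℝ 𝕂 ((√(ν l))⁻¹ * (√(ν m))⁻¹ *
          (x j * (1 - x j) * w j / ((t l - x j) * (t m - x j)))) := by
      intro j
      rw [Algebra.smul_def, ← map_mul, ← hρ2]
      congr 1
      field_simp [htx l j, htx m j, hsν l, hsν m]
      rfl
    simp only [h1]
    rw [← map_sum, ← map_mul, ← map_add, ← Finset.mul_sum]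
    rcases eq_or_ne l m with rfl | hlm
    · rw [Matrix.one_apply_eq, ← map_one (algebraMap ℝ 𝕂)]
      congr 1
      have h2 : (√(ν l))⁻¹ * (√(ν l))⁻¹ * ν l = 1 := by
        rw [← mul_inv, Real.mul_self_sqrt (hν0 l).le, inv_mul_cancel₀ (hν0 l).ne']
      have h3 : ν l = ∑ j, x j * (1 - x j) * w j / ((t l - x j) * (t l - x j)) + 1 := rfl
      refine Eq.trans ?_ h2
      calc _ = (√(ν l))⁻¹ * (√(ν l))⁻¹ *
            (∑ j, x j * (1 - x j) * w j / ((t l - x j) * (t l - x j)) + 1) := by ring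
        _ = _ := by rw [← h3]
    · rw [Matrix.one_apply_ne hlm, ← map_zero (algebraMap ℝ 𝕂)]
      congr 1
      have h2 := horth l m hlm
      calc _ = (√(ν l))⁻¹ * (√(ν m))⁻¹ *
            (∑ j, x j * (1 - x j) * w j / ((t l - x j) * (t m - x j)) + 1) := by ring
        _ = 0 := by rw [h2, mul_zero]
  have hGV : Bᴴ * B * V = V * realDiag 𝕂 t := by
    generalize Bᴴ * B = G at hG1 hG2 hG2' hG3 ⊢
    ext i l
    rw [realDiag, Matrix.mul_diagonal, Matrix.mul_apply, Fin.sum_univ_castSucc]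
    induction i using Fin.lastCases with
    | last =>
      simp only [hG2', hG3, hVc, hVl, smul_mul_assoc, mul_smul_comm, star_mul_self_eq, smul_smul]
      have h1 : ∀ j : Fin N, (ρ j / ((t l - x j) * √(ν l)) * ρ j) •
          (algebraMap ℝ 𝕂) (‖q (Fin.castLE h j)‖ ^ 2) =
          algebraMap ℝ 𝕂 ((√(ν l))⁻¹ * (x j * (1 - x j) * w j / (t l - x j))) := by
        intro j
        rw [Algebra.smul_def, ← map_mul, ← hρ2]
        congr 1
        field_simp [htx l j, hsν l]
        rfl
      simp only [h1]
      rw [← map_sum, ← map_mul, ← map_mul, ← map_add, ← Finset.mul_sum]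
      congr 1
      have h2 := hsec l
      calc _ = (√(ν l))⁻¹ * (∑ j, x j * (1 - x j) * w j / (t l - x j) + H) := by ring
        _ = _ := by rw [h2]
    | cast i =>
      simp only [hG1, hG2, hVc, hVl, ite_mul, zero_mul, Finset.sum_ite_eq, Finset.mem_univ, if_true]
      rw [← Algebra.commutes (t l), ← Algebra.commutes (√(ν l))⁻¹, ← Algebra.smul_def,
        ← Algebra.smul_def, ← Algebra.smul_def, smul_smul, smul_smul, smul_smul, ← add_smul]
      congr 1
      field_simp [htx l i, hsν l]
      ring
  have hVU : V ∈ UGroup 𝕂 (N + 1) := mem_unitary_of_conjTranspose_mul_self hVV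
  refine sqSingularValues_eq ⟨(interlacing.strictAnti ht).antitone, V, hVU, ?_⟩
  rw [← realDiag, ← hGV, Matrix.mul_assoc, (Unitary.mem_iff.1 hVU).2, Matrix.mul_one]

end bordered

/-! ### Dixon–Anderson integrals and the induction step for Jacobi densities -/

section selberg

/-- The unnormalised Jacobi density. -/
noncomputable def selbergDensity (θ a b : ℝ) {N : ℕ} (x : Fin N → ℝ) : ℝ :=
  absVandermonde x ^ (2 * θ) * ((∏ i, x i) ^ (a - 1) * (∏ i, (1 - x i)) ^ (b - 1))

/-- The measure with density `selbergDensity` on strictly decreasing vectors. -/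
noncomputable def selbergMeasure (θ a b : ℝ) (N : ℕ) : Measure (Fin N → ℝ) :=
  (volume.restrict (strictChamber N)).withDensity
    fun x => ENNReal.ofReal (selbergDensity θ a b x)

@[fun_prop]
theorem measurable_absVandermonde {N : ℕ} : Measurable (absVandermonde : (Fin N → ℝ) → ℝ) := by
  unfold absVandermonde
  fun_prop

@[fun_prop]
theorem measurable_selbergDensity (θ a b : ℝ) {N : ℕ} :
    Measurable (selbergDensity θ a b : (Fin N → ℝ) → ℝ) := by
  unfold selbergDensity
  fun_prop

theorem measurableSet_strictChamber (N : ℕ) : MeasurableSet (strictChamber N) := by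
  have h : strictChamber N = (⋂ i, ⋂ j, {x | i < j → x j < x i}) ∩ ⋂ i, {x | x i ∈ Set.Ioo 0 1} := by
    ext x
    simp [strictChamber, StrictAnti]
  rw [h]
  refine (MeasurableSet.iInter fun i => MeasurableSet.iInter fun j => ?_).inter
    (MeasurableSet.iInter fun i => measurableSet_Ioo.preimage (measurable_pi_apply i))
  by_cases hij : i < j
  · simpa [hij] using measurableSet_lt (measurable_pi_apply j) (measurable_pi_apply i)
  · simp [hij]

theorem lintegral_selbergMeasure (θ a b : ℝ) {N : ℕ} {f : (Fin N → ℝ) → ENNReal}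
    (hf : Measurable f) : ∫⁻ x, f x ∂selbergMeasure θ a b N =
      ∫⁻ x in strictChamber N, ENNReal.ofReal (selbergDensity θ a b x) * f x := by
  rw [selbergMeasure, lintegral_withDensity_eq_lintegral_mul _ (by fun_prop) hf]
  rfl

theorem residue_eq_abs {k : ℕ} {a : Fin (k + 1) → ℝ} {s : Fin k → ℝ} (ha : StrictAnti a)
    (hs : s ∈ interlacing a) (j : Fin (k + 1)) :
    residue a s j = (∏ i, |a j - s i|) / ∏ m ∈ Finset.univ.erase j, |a j - a m| := by
  rw [← abs_of_pos (residue_pos ha hs j), residue, Finset.prod_div_distrib, abs_div,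
    Finset.abs_prod, Finset.abs_prod, prod_succAbove_eq_prod_erase (fun l => |a j - a l|)]

theorem prod_residue {k : ℕ} {a : Fin (k + 1) → ℝ} {s : Fin k → ℝ} (ha : StrictAnti a)
    (hs : s ∈ interlacing a) :
    ∏ j, residue a s j = (∏ j, ∏ i, |a j - s i|) / absVandermonde a ^ 2 := by
  rw [absVandermonde_sq, ← Finset.prod_div_distrib]
  exact Finset.prod_congr rfl fun j _ => residue_eq_abs ha hs j

theorem dirichletWeight_residue {k : ℕ} {a : Fin (k + 1) → ℝ} {s : Fin k → ℝ} (ha : StrictAnti a)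
    (e : Fin (k + 1) → ℝ) : dirichletWeight e (fun i => residue a s i.succ) =
      ENNReal.ofReal (∏ j, residue a s j ^ (e j - 1)) := by
  rw [dirichletWeight, ← residue_zero ha, ← Fin.prod_univ_succ (fun j => residue a s j ^ (e j - 1))]

/-- The Dixon–Anderson integral. -/
theorem lintegral_interlacing {k : ℕ} (θ : ℝ) {a : Fin (k + 1) → ℝ} (ha : StrictAnti a) :
    ∫⁻ s in interlacing a,
      ENNReal.ofReal (absVandermonde s * (∏ j, ∏ i, |a j - s i|) ^ (θ - 1)) =
    ENNReal.ofReal (absVandermonde a ^ (2 * θ - 1)) *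
      ∫⁻ w in openSimplex k, dirichletWeight (fun _ => θ) w := by
  have hV := absVandermonde_pos ha.injective
  rw [lintegral_openSimplex_eq ha, ← lintegral_const_mul' _ _ ENNReal.ofReal_ne_top]
  refine setLIntegral_congr_fun (measurableSet_interlacing a) fun s hs => ?_
  have hs' := absVandermonde_pos (interlacing.strictAnti hs).injective
  have hP : 0 < ∏ j, ∏ i, |a j - s i| := by
    have := Finset.prod_pos fun j (_ : j ∈ Finset.univ) => residue_pos ha hs j
    rw [prod_residue ha hs] at this
    exact (div_pos_iff_of_pos_right (by positivity)).1 this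
  rw [dirichletWeight_residue ha, Real.finsetProd_rpow _ _ (fun j _ => (residue_pos ha hs j).le),
    prod_residue ha hs, ← ENNReal.ofReal_mul (by positivity), ← ENNReal.ofReal_mul (by positivity)]
  congr 1
  generalize absVandermonde a = A at *
  generalize absVandermonde s = B at *
  generalize ∏ j, ∏ i, |a j - s i| = C at *
  -- Writing every positive quantity as the exponential of its logarithm turns the identity between
  -- real powers into one that `ring` can check.
  rw [← Real.exp_log hV, ← Real.exp_log hs', ← Real.exp_log hP]
  simp only [← Real.exp_mul, ← Real.exp_add, ← Real.exp_sub, ← Real.exp_nat_mul]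
  congr 1
  push_cast
  ring

theorem polesOf_zero {N : ℕ} (x : Fin N → ℝ) : polesOf x 0 = 1 := rfl

theorem polesOf_succ_castSucc {N : ℕ} (x : Fin N → ℝ) (i : Fin N) :
    polesOf x i.castSucc.succ = x i := by simp [polesOf]

theorem polesOf_last {N : ℕ} (x : Fin N → ℝ) : polesOf x (Fin.last _) = 0 := by
  rw [← Fin.succ_last]; simp [polesOf]

theorem prod_polesOf {N : ℕ} {M : Type*} [CommMonoid M] (x : Fin N → ℝ) (f : ℝ → M) :
    ∏ j, f (polesOf x j) = f 1 * ((∏ i, f (x i)) * f 0) := by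
  rw [Fin.prod_univ_succ, Fin.prod_univ_castSucc]
  simp only [polesOf_zero, polesOf_succ_castSucc, Fin.succ_last, polesOf_last]

theorem absVandermonde_snoc {N : ℕ} (x : Fin N → ℝ) (c : ℝ) :
    absVandermonde (Fin.snoc x c : Fin (N + 1) → ℝ) = (∏ i, |x i - c|) * absVandermonde x := by
  have h1 := absVandermonde_sq (Fin.snoc x c : Fin (N + 1) → ℝ)
  have h0 : ∀ {k : ℕ} (s : Fin k → ℝ), 0 ≤ absVandermonde s := fun s =>
    Finset.prod_nonneg fun i _ => Finset.prod_nonneg fun j _ => abs_nonneg _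
  rw [← sq_eq_sq₀ (h0 _) (mul_nonneg (Finset.prod_nonneg fun i _ => abs_nonneg _) (h0 _)), h1,
    mul_pow, absVandermonde_sq x]
  simp only [← prod_succAbove_eq_prod_erase]
  rw [Fin.prod_univ_castSucc]
  simp only [Fin.succAbove_last, Fin.snoc_castSucc, Fin.snoc_last]
  have h2 : ∀ i : Fin N, ∏ l : Fin N, |x i - (Fin.snoc x c : Fin (N + 1) → ℝ) (i.castSucc.succAbove l)| =
      (∏ j ∈ Finset.univ.erase i, |x i - x j|) * |x i - c| := by
    intro i
    rw [prod_succAbove_eq_prod_erase (fun l => |x i - (Fin.snoc x c : Fin (N + 1) → ℝ) l|)]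
    have h : (Finset.univ.erase i.castSucc : Finset (Fin (N + 1))) =
        insert (Fin.last N) ((Finset.univ.erase i).map Fin.castSuccEmb) := by
      ext l
      refine Fin.lastCases ?_ (fun m => ?_) l
      · simp [(Fin.castSucc_ne_last i).symm]
      · simp [Fin.castSucc_ne_last]
    rw [h, Finset.prod_insert (by simp [Fin.castSucc_ne_last]), Finset.prod_map, mul_comm]
    simp
  simp only [h2]
  rw [Finset.prod_mul_distrib, Finset.prod_congr rfl fun i _ => abs_sub_comm c (x i)]
  ring

theorem absVandermonde_polesOf {N : ℕ} {x : Fin N → ℝ} (hx : x ∈ strictChamber N) :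
    absVandermonde (polesOf x) = (∏ i, (1 - x i)) * ((∏ i, x i) * absVandermonde x) := by
  rw [absVandermonde_succ]
  have h : (fun i : Fin (N + 1) => polesOf x i.succ) = Fin.snoc x 0 := by
    ext i; simp [polesOf]
  rw [h, absVandermonde_snoc, polesOf_zero, Fin.prod_univ_castSucc]
  simp only [polesOf_succ_castSucc, Fin.succ_last, polesOf_last, sub_zero, abs_one, mul_one]
  congr 1
  · exact Finset.prod_congr rfl fun i _ => abs_of_pos (by linarith [(hx.2 i).2])
  · congr 1
    exact Finset.prod_congr rfl fun i _ => abs_of_pos (hx.2 i).1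

/-- With 0 and 1 added as poles, "t interlaces with the poles of x" and "x interlaces with t" are
the same condition on the pair. This describes the domain of the joint density in either order of
integration. -/
theorem interlacing_polesOf_iff {N : ℕ} {x : Fin N → ℝ} {t : Fin (N + 1) → ℝ} :
    (x ∈ strictChamber N ∧ t ∈ interlacing (polesOf x)) ↔
      (t ∈ strictChamber (N + 1) ∧ x ∈ interlacing t) := by
  constructor
  · rintro ⟨hx, ht⟩
    have ha := polesOf_strictAnti hx
    refine ⟨⟨interlacing.strictAnti ht, fun l => ?_⟩, fun i => ?_⟩
    · have h1 := ht l
      have h2 : polesOf x (Fin.last _) ≤ polesOf x l.succ := ha.antitone (Fin.le_last _)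
      have h3 : polesOf x l.castSucc ≤ polesOf x 0 := ha.antitone (Fin.zero_le _)
      rw [polesOf_last] at h2
      rw [polesOf_zero] at h3
      exact ⟨by linarith [h1.1], by linarith [h1.2]⟩
    · have h1 := (ht i.castSucc).1
      have h2 := (ht i.succ).2
      rw [polesOf_succ_castSucc] at h1
      rw [← Fin.succ_castSucc, polesOf_succ_castSucc] at h2
      exact ⟨h2, h1⟩
  · rintro ⟨ht, hx⟩
    refine ⟨⟨interlacing.strictAnti hx, fun i => ?_⟩, fun l => ?_⟩
    · exact ⟨(ht.2 _).1.trans (hx i).1, (hx i).2.trans (ht.2 _).2⟩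
    · constructor
      · induction l using Fin.lastCases with
        | last => rw [Fin.succ_last, polesOf_last]; exact (ht.2 _).1
        | cast l => rw [polesOf_succ_castSucc]; exact (hx l).2
      · induction l using Fin.cases with
        | zero => exact (ht.2 _).2
        | succ l => rw [← Fin.succ_castSucc, polesOf_succ_castSucc]; exact (hx l).1

/-- Exponents at the poles `1, x₁, …, x_N, 0`. -/
def poleExponents (N : ℕ) (θ a b : ℝ) : Fin (N + 2) → ℝ := Fin.cons b (Fin.snoc (fun _ => θ) a)

/-- The joint density of (x, t). The residues at 1 and 0 are ∏ (1 - t_i) / ∏ (1 - x_i) and ∏ t_i / ∏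
x_i, and all powers of x_i and 1 - x_i cancel; this is why the exponents drop by θ. What is left in
x is the Dixon–Anderson integrand with nodes t. -/
theorem selbergDensity_mul_residue (θ a b : ℝ) {N : ℕ} {x : Fin N → ℝ} {t : Fin (N + 1) → ℝ}
    (hx : x ∈ strictChamber N) (ht : t ∈ interlacing (polesOf x)) :
    selbergDensity θ (a + θ) (b + θ) x * (absVandermonde t / absVandermonde (polesOf x) *
      ∏ j, residue (polesOf x) t j ^ (poleExponents N θ a b j - 1)) =
    (absVandermonde t * ((∏ i, t i) ^ (a - 1) * (∏ i, (1 - t i)) ^ (b - 1))) *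
      (absVandermonde x * (∏ j, ∏ i, |t j - x i|) ^ (θ - 1)) := by
  have ha := polesOf_strictAnti hx
  have htC := (interlacing_polesOf_iff.1 ⟨hx, ht⟩).1
  have hVx := absVandermonde_pos hx.1.injective
  have hVt := absVandermonde_pos (interlacing.strictAnti ht).injective
  have hA : 0 < ∏ i, (1 - x i) := Finset.prod_pos fun i _ => by linarith [(hx.2 i).2]
  have hB : 0 < ∏ i, x i := Finset.prod_pos fun i _ => (hx.2 i).1
  have hTA : 0 < ∏ i, (1 - t i) := Finset.prod_pos fun i _ => by linarith [(htC.2 i).2]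
  have hTB : 0 < ∏ i, t i := Finset.prod_pos fun i _ => (htC.2 i).1
  have h0 : residue (polesOf x) t 0 = (∏ i, (1 - t i)) / ∏ i, (1 - x i) := by
    rw [residue, Finset.prod_div_distrib]
    simp only [Fin.zero_succAbove, polesOf_zero]
    rw [Fin.prod_univ_castSucc (fun i : Fin (N + 1) => 1 - polesOf x i.succ)]
    simp [polesOf_succ_castSucc, polesOf_last]
  have hl : residue (polesOf x) t (Fin.last _) = (∏ i, t i) / ∏ i, x i := by
    rw [residue_eq_abs ha ht, ← prod_succAbove_eq_prod_erase
      (fun m => |polesOf x (Fin.last _) - polesOf x m|)]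
    simp only [polesOf_last, Fin.succAbove_last, zero_sub, abs_neg]
    rw [Fin.prod_univ_succ (fun i : Fin (N + 1) => |polesOf x i.castSucc|)]
    simp only [Fin.castSucc_zero, polesOf_zero, abs_one, one_mul, ← Fin.succ_castSucc,
      polesOf_succ_castSucc]
    congr 1
    · exact Finset.prod_congr rfl fun i _ => abs_of_pos (htC.2 i).1
    · exact Finset.prod_congr rfl fun i _ => abs_of_pos (hx.2 i).1
  set P := ∏ j, ∏ i, |t j - x i| with hP
  have hall := prod_residue ha ht
  have hPx : ∏ j, ∏ i, |polesOf x j - t i| = (∏ i, (1 - t i)) * (P * ∏ i, t i) := by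
    rw [prod_polesOf x fun y => ∏ i, |y - t i|]
    congr 1
    · exact Finset.prod_congr rfl fun i _ => abs_of_pos (by linarith [(htC.2 i).2])
    · congr 1
      · rw [Finset.prod_comm, hP]
        exact Finset.prod_congr rfl fun i _ => Finset.prod_congr rfl fun j _ => abs_sub_comm _ _
      · refine Finset.prod_congr rfl fun i _ => ?_
        rw [zero_sub, abs_neg, abs_of_pos (htC.2 i).1]
  set R := ∏ i : Fin N, residue (polesOf x) t i.castSucc.succ with hR
  have hRpos : 0 < R := Finset.prod_pos fun i _ => residue_pos ha ht _
  rw [hPx, absVandermonde_polesOf hx, Fin.prod_univ_succ, Fin.prod_univ_castSucc, Fin.succ_last, h0,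
    hl, ← hR] at hall
  -- The residues at the poles x_i alone: the product over all poles divided by the residues at 1
  -- and 0.
  have hRP : R = P / ((∏ i, (1 - x i)) * (∏ i, x i) * absVandermonde x ^ 2) := by
    field_simp at hall ⊢
    linarith
  have hPpos : 0 < P := by
    rw [hRP] at hRpos
    exact (div_pos_iff_of_pos_right (by positivity)).1 hRpos
  rw [Fin.prod_univ_succ, Fin.prod_univ_castSucc, absVandermonde_polesOf hx]
  simp only [Fin.succ_last]
  have he0 : poleExponents N θ a b 0 = b := rfl
  have hel : poleExponents N θ a b (Fin.last _) = a := by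
    rw [← Fin.succ_last]; simp [poleExponents]
  have hem : ∀ i : Fin N, poleExponents N θ a b i.castSucc.succ = θ := fun i => by
    simp [poleExponents]
  simp only [he0, hel, hem]
  rw [Real.finsetProd_rpow _ _ (fun i _ => (residue_pos ha ht _).le), ← hR, h0, hl, hRP,
    selbergDensity]
  generalize absVandermonde x = v at *
  generalize absVandermonde t = v' at *
  generalize ∏ i, (1 - x i) = A at *
  generalize ∏ i, x i = B at *
  generalize ∏ i, (1 - t i) = A' at *
  generalize ∏ i, t i = B' at *
  clear_value P
  rw [← Real.exp_log hVx, ← Real.exp_log hVt, ← Real.exp_log hA, ← Real.exp_log hB,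
    ← Real.exp_log hTA, ← Real.exp_log hTB, ← Real.exp_log hPpos]
  simp only [← Real.exp_mul, ← Real.exp_add, ← Real.exp_sub, ← Real.exp_nat_mul]
  congr 1
  push_cast
  ring

/-- Adding one particle to the Jacobi ensemble. -/
theorem lintegral_selberg_succ (θ a b : ℝ) (N : ℕ) : ∃ c : ENNReal,
    ∀ (F : (Fin (N + 1) → ℝ) → ENNReal) (_ : Measurable F)
      (T : (Fin N → ℝ) → (Fin (N + 1) → ℝ) → Fin (N + 1) → ℝ)
      (_ : ∀ x ∈ strictChamber N, ∀ t ∈ interlacing (polesOf x),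
        T x (fun i => residue (polesOf x) t i.succ) = t),
      ∫⁻ x in strictChamber N, ENNReal.ofReal (selbergDensity θ (a + θ) (b + θ) x) *
        ∫⁻ w in openSimplex (N + 1), dirichletWeight (poleExponents N θ a b) w * F (T x w) =
      c * ∫⁻ t, F t ∂selbergMeasure θ a b (N + 1) := by
  -- The constant comes from the final integral over x, where all N + 1 nodes t carry the exponent
  -- θ. The map T enters only through its values at residue vectors.
  refine ⟨∫⁻ w in openSimplex N, dirichletWeight (fun _ => θ) w, fun F hF T hT => ?_⟩
  set G : (Fin (N + 1) → ℝ) → ENNReal := fun t =>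
    ENNReal.ofReal (absVandermonde t * ((∏ i, t i) ^ (a - 1) * (∏ i, (1 - t i)) ^ (b - 1))) * F t
    with hG
  have hGm : Measurable G := by fun_prop
  set g : (Fin N → ℝ) → (Fin (N + 1) → ℝ) → ENNReal := fun x t =>
    ENNReal.ofReal (absVandermonde x * (∏ j, ∏ i, |t j - x i|) ^ (θ - 1)) with hg
  have hgm : Measurable (Function.uncurry g) := by
    simp only [hg, Function.uncurry_def]
    fun_prop
  have h1 : ∀ x ∈ strictChamber N, ENNReal.ofReal (selbergDensity θ (a + θ) (b + θ) x) *
        ∫⁻ w in openSimplex (N + 1), dirichletWeight (poleExponents N θ a b) w * F (T x w) =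
      ∫⁻ t in interlacing (polesOf x), G t * g x t := by
    intro x hx
    rw [lintegral_openSimplex_eq (polesOf_strictAnti hx),
      ← lintegral_const_mul' _ _ ENNReal.ofReal_ne_top]
    refine setLIntegral_congr_fun (measurableSet_interlacing _) fun t ht => ?_
    have hd : 0 ≤ selbergDensity θ (a + θ) (b + θ) x := by
      have hVx := absVandermonde_pos hx.1.injective
      have hA : 0 < ∏ i, (1 - x i) := Finset.prod_pos fun i _ => by linarith [(hx.2 i).2]
      have hB : 0 < ∏ i, x i := Finset.prod_pos fun i _ => (hx.2 i).1
      unfold selbergDensity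
      positivity
    have hq : 0 ≤ absVandermonde t / absVandermonde (polesOf x) :=
      (div_pos (absVandermonde_pos (interlacing.strictAnti ht).injective)
        (absVandermonde_pos (polesOf_strictAnti hx).injective)).le
    have htC := (interlacing_polesOf_iff.1 ⟨hx, ht⟩).1
    have hk : 0 ≤ absVandermonde t * ((∏ i, t i) ^ (a - 1) * (∏ i, (1 - t i)) ^ (b - 1)) := by
      have hVt := absVandermonde_pos (interlacing.strictAnti ht).injective
      have hTA : 0 < ∏ i, (1 - t i) := Finset.prod_pos fun i _ => by linarith [(htC.2 i).2]
      have hTB : 0 < ∏ i, t i := Finset.prod_pos fun i _ => (htC.2 i).1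
      positivity
    simp only [hT x hx t ht, dirichletWeight_residue (polesOf_strictAnti hx), hG, hg]
    rw [mul_right_comm, ← ENNReal.ofReal_mul hk, ← selbergDensity_mul_residue θ a b hx ht,
      ENNReal.ofReal_mul hd, ENNReal.ofReal_mul hq]
    ring
  rw [setLIntegral_congr_fun (measurableSet_strictChamber N) h1]
  set S : Set ((Fin N → ℝ) × (Fin (N + 1) → ℝ)) :=
    {p | p.2 ∈ strictChamber (N + 1) ∧ p.1 ∈ interlacing p.2} with hS
  have hSm : MeasurableSet S := by
    have h2 : S = (Prod.snd ⁻¹' strictChamber (N + 1)) ∩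
        ⋂ i : Fin N, {p : (Fin N → ℝ) × (Fin (N + 1) → ℝ) | p.2 i.succ < p.1 i} ∩
          {p | p.1 i < p.2 i.castSucc} := by
      ext p
      simp [hS, interlacing]
    rw [h2]
    refine (measurable_snd (measurableSet_strictChamber _)).inter
      (MeasurableSet.iInter fun i => (measurableSet_lt ?_ ?_).inter (measurableSet_lt ?_ ?_)) <;>
    fun_prop
  have h3 : ∫⁻ x in strictChamber N, ∫⁻ t in interlacing (polesOf x), G t * g x t =
      ∫⁻ x, ∫⁻ t, S.indicator (fun p => G p.2 * g p.1 p.2) (x, t) := by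
    rw [← lintegral_indicator (measurableSet_strictChamber N)]
    refine lintegral_congr fun x => ?_
    by_cases hx : x ∈ strictChamber N
    · rw [Set.indicator_of_mem hx, ← lintegral_indicator (measurableSet_interlacing _)]
      refine lintegral_congr fun t => ?_
      have : (x, t) ∈ S ↔ t ∈ interlacing (polesOf x) := by
        rw [hS, Set.mem_ofPred_eq, ← interlacing_polesOf_iff]
        exact and_iff_right hx
      by_cases ht : t ∈ interlacing (polesOf x)
      · rw [Set.indicator_of_mem ht, Set.indicator_of_mem (this.2 ht)]
      · rw [Set.indicator_of_notMem ht, Set.indicator_of_notMem (fun h => ht (this.1 h))]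
    · rw [Set.indicator_of_notMem hx]
      have : ∀ t, S.indicator (fun p => G p.2 * g p.1 p.2) (x, t) = 0 := fun t =>
        Set.indicator_of_notMem (fun h : (x, t) ∈ S => hx (interlacing_polesOf_iff.2 h).1) _
      simp [this]
  -- After the exchange x runs over the points interlacing with t, and `lintegral_interlacing`
  -- evaluates the inner integral.
  rw [h3, lintegral_lintegral_swap (f := fun x t => S.indicator (fun p => G p.2 * g p.1 p.2) (x, t))
    (((hGm.comp measurable_snd).mul hgm).indicator hSm).aemeasurable,
    lintegral_selbergMeasure θ a b hF, ← lintegral_indicator (measurableSet_strictChamber _),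
    ← lintegral_const_mul _ (Measurable.indicator (by fun_prop) (measurableSet_strictChamber _))]
  refine lintegral_congr fun t => ?_
  by_cases ht : t ∈ strictChamber (N + 1)
  · rw [Set.indicator_of_mem ht]
    have h4 : ∀ x, S.indicator (fun p => G p.2 * g p.1 p.2) (x, t) =
        G t * (interlacing t).indicator (fun x => g x t) x := by
      intro x
      by_cases hx : x ∈ interlacing t
      · rw [Set.indicator_of_mem hx, Set.indicator_of_mem (show (x, t) ∈ S from ⟨ht, hx⟩)]
      · rw [Set.indicator_of_notMem hx, Set.indicator_of_notMem (fun h : (x, t) ∈ S => hx h.2),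
          mul_zero]
    simp only [h4]
    have hgt : Measurable fun x => g x t := hgm.of_uncurry_right
    rw [lintegral_const_mul _ (hgt.indicator (measurableSet_interlacing _)),
      lintegral_indicator (measurableSet_interlacing _), lintegral_interlacing θ ht.1]
    have hVt := absVandermonde_pos ht.1.injective
    have hTA : 0 < ∏ i, (1 - t i) := Finset.prod_pos fun i _ => by linarith [(ht.2 i).2]
    have hTB : 0 < ∏ i, t i := Finset.prod_pos fun i _ => (ht.2 i).1
    have h5 : selbergDensity θ a b t = absVandermonde t *
        ((∏ i, t i) ^ (a - 1) * (∏ i, (1 - t i)) ^ (b - 1)) * absVandermonde t ^ (2 * θ - 1) := by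
      rw [selbergDensity, Real.rpow_sub_one hVt.ne']
      field_simp
    rw [h5, ENNReal.ofReal_mul (by positivity), hG]
    ring
  · rw [Set.indicator_of_notMem ht, mul_zero]
    have h4 : ∀ x, S.indicator (fun p => G p.2 * g p.1 p.2) (x, t) = 0 := fun x =>
      Set.indicator_of_notMem (fun h : (x, t) ∈ S => ht h.1) _
    simp [h4]

end selberg

/-! ### Adding a column to a corner of a unitary matrix -/

section addColumn

variable {𝕂 : Type} [NormedDivisionRing 𝕂] [NormedAlgebra ℝ 𝕂] [StarRing 𝕂]
  [hK : IsCompositionField 𝕂]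

/-- Appends a column to a matrix. -/
def snocCol {n N : ℕ} (X : Matrix (Fin n) (Fin N) 𝕂) (v : Fin n → 𝕂) :
    Matrix (Fin n) (Fin (N + 1)) 𝕂 := Matrix.of fun i => Fin.snoc (X i) (v i)

theorem mul_snocCol {n N : ℕ} (W : Matrix (Fin n) (Fin n) 𝕂) (X : Matrix (Fin n) (Fin N) 𝕂)
    (v : Fin n → 𝕂) : W * snocCol X v = snocCol (W * X) (W *ᵥ v) := by
  ext i j
  induction j using Fin.lastCases with
  | last => simp [snocCol, Matrix.mul_apply, Matrix.mulVec, dotProduct]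
  | cast j => simp [snocCol, Matrix.mul_apply]

theorem snocCol_mul_blockDiag {n N : ℕ} (X : Matrix (Fin n) (Fin N) 𝕂) (v : Fin n → 𝕂)
    (V : Matrix (Fin N) (Fin N) 𝕂) :
    snocCol X v * blockDiag finSumFinEquiv V (1 : Matrix (Fin 1) (Fin 1) 𝕂) = snocCol (X * V) v := by
  ext i j
  rw [Matrix.mul_apply, ← finSumFinEquiv.sum_comp, Fintype.sum_sum_type]
  have h1 : ∀ l : Fin N, finSumFinEquiv (Sum.inl l : Fin N ⊕ Fin 1) = l.castSucc := fun _ => rfl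
  have h2 : finSumFinEquiv (Sum.inr 0 : Fin N ⊕ Fin 1) = Fin.last N := rfl
  induction j using Fin.lastCases with
  | last =>
    have h3 : Fin.natAdd N (0 : Fin 1) = Fin.last N := rfl
    rw [← h2]; simp [snocCol, blockDiag, h1, h3]
  | cast j => rw [← h1]; simp [snocCol, blockDiag, h1, Matrix.mul_apply]

/-- Because Z Z* = 1 - X X*, the matrix Z Z* is diagonal in the left singular basis of X, with
entries 1 - x_j and then 1. Two matrices with the same Z Z* differ by a unitary on the right, so in
this basis Z is the diagonal of `borderWeight` times a unitary, which acts on q. -/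
theorem sqSingularValues_snocCol {n N m : ℕ} (hN : N ≤ n) (hn : n ≤ m)
    {X : Matrix (Fin n) (Fin N) 𝕂} {Z : Matrix (Fin n) (Fin m) 𝕂} (hXZ : X * Xᴴ + Z * Zᴴ = 1) :
    ∃ W ∈ UGroup 𝕂 m, ∀ q : Fin m → 𝕂, sqSingularValues (snocCol X (Z *ᵥ q)) =
      sqSingularValues (borderedMatrix (sqSingularValues X)
        fun i : Fin n => (W *ᵥ q) (Fin.castLE hn i)) := by
  obtain ⟨W, hW, V, hV, hX⟩ := exists_singular_value_decomposition hN X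
  set x := sqSingularValues X with hx
  set D := rectDiag 𝕂 n (fun j => √(x j)) with hD
  have hWs := Unitary.mem_iff.1 hW
  have hVs := Unitary.mem_iff.1 hV
  simp only [Matrix.star_eq_conjTranspose] at hWs hVs
  have hZ : (Wᴴ * Z) * (Wᴴ * Z)ᴴ = 1 - D * Dᴴ := by
    have h1 : X * Xᴴ = W * (D * Dᴴ) * Wᴴ := by
      rw [hX]
      simp only [Matrix.conjTranspose_mul, Matrix.mul_assoc]
      rw [← Matrix.mul_assoc V, hVs.2, Matrix.one_mul]
    have h2 : Z * Zᴴ = 1 - W * (D * Dᴴ) * Wᴴ := by rw [← hXZ, h1]; abel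
    rw [Matrix.conjTranspose_mul, Matrix.conjTranspose_conjTranspose, Matrix.mul_assoc,
      ← Matrix.mul_assoc Z, h2, Matrix.sub_mul, Matrix.one_mul, Matrix.mul_assoc, hWs.1,
      Matrix.mul_one, Matrix.mul_sub, hWs.1, ← Matrix.mul_assoc, hWs.1, Matrix.one_mul]
  set S : Matrix (Fin n) (Fin m) 𝕂 := rectDiag 𝕂 n (fun j : Fin m => borderWeight x j) with hS
  have hSv : ∀ (v : Fin m → 𝕂) i, (S *ᵥ v) i = borderWeight x i • v (Fin.castLE hn i) := by
    intro v i
    rw [Matrix.mulVec, dotProduct, Finset.sum_eq_single (Fin.castLE hn i)]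
    · simp [hS, rectDiag, Algebra.smul_def]
    · intro k _ hk
      have : (i : ℕ) ≠ k := fun h => hk (Fin.ext h.symm)
      simp [hS, rectDiag, this]
    · simp
  have hDD : ∀ i j : Fin n, (D * Dᴴ) i j =
      if i = j then algebraMap ℝ 𝕂 (if h : (i : ℕ) < N then x ⟨i, h⟩ else 0) else 0 := by
    intro i j
    rw [Matrix.mul_apply]
    by_cases h : (i : ℕ) < N
    · rw [Finset.sum_eq_single ⟨i, h⟩]
      · by_cases hij : i = j
        · subst hij
          simp [hD, rectDiag, Matrix.conjTranspose_apply, star_algebraMap_real, h, ← map_mul,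
            Real.mul_self_sqrt (sqSingularValues_nonneg X _), hx]
        · have : (j : ℕ) ≠ i := fun h' => hij (Fin.ext h'.symm)
          simp [hD, rectDiag, Matrix.conjTranspose_apply, hij, this]
      · intro k _ hk
        have : (i : ℕ) ≠ k := fun h => hk (Fin.ext h.symm)
        simp [hD, rectDiag, this]
      · simp
    · rw [Finset.sum_eq_zero]
      · simp [h]
      · intro k _
        have : (i : ℕ) ≠ k := fun h' => h (h' ▸ k.2)
        simp [hD, rectDiag, this]
  -- By `hZ` these numbers are diagonal entries of a Gram matrix, so the square roots in
  -- `borderWeight` are genuine.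
  have hx1 : ∀ i : Fin N, 0 ≤ 1 - x i := by
    intro i
    have h1 := congrFun (congrFun hZ (Fin.castLE hN i)) (Fin.castLE hN i)
    have h2 := conjTranspose_mul_self_apply_self (Wᴴ * Z)ᴴ (Fin.castLE hN i)
    rw [Matrix.conjTranspose_conjTranspose, h1, Matrix.sub_apply, Matrix.one_apply_eq, hDD,
      if_pos rfl, dif_pos (show ((Fin.castLE hN i : Fin n) : ℕ) < N from i.2), ← map_one (algebraMap ℝ 𝕂), ← map_sub] at h2
    have h3 := (algebraMap ℝ 𝕂).injective h2
    simp only [Fin.val_castLE, Fin.eta] at h3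
    rw [h3]
    positivity
  have hSS : S * Sᴴ = 1 - D * Dᴴ := by
    ext i j
    rw [Matrix.sub_apply, hDD, Matrix.mul_apply, Finset.sum_eq_single (Fin.castLE hn i)]
    · by_cases hij : i = j
      · subst hij
        simp only [hS, rectDiag, Matrix.conjTranspose_apply, Matrix.of_apply, Fin.val_castLE,
          if_true, star_algebraMap_real, ← map_mul, Matrix.one_apply_eq]
        rw [← map_one (algebraMap ℝ 𝕂), ← map_sub]
        congr 1
        by_cases h : (i : ℕ) < N
        · simp [borderWeight, h, Real.mul_self_sqrt (hx1 _)]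
        · simp [borderWeight, h]
      · have : (j : ℕ) ≠ i := fun h' => hij (Fin.ext h'.symm)
        simp [hS, rectDiag, Matrix.conjTranspose_apply, hij, this]
    · intro k _ hk
      have : (i : ℕ) ≠ k := fun h => hk (Fin.ext h.symm)
      simp [hS, rectDiag, this]
    · simp
  obtain ⟨W', hW', hZW⟩ := exists_unitary_eq_mul (X := Wᴴ * Z) (Y := S) (hZ.trans hSS.symm)
  refine ⟨W', hW', fun q => ?_⟩
  have h1 : snocCol X (Z *ᵥ q) = W * (snocCol D (S *ᵥ (W' *ᵥ q)) *
      blockDiag finSumFinEquiv V (1 : Matrix (Fin 1) (Fin 1) 𝕂)) := by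
    rw [snocCol_mul_blockDiag, mul_snocCol, ← Matrix.mul_assoc, ← hX, Matrix.mulVec_mulVec,
      Matrix.mulVec_mulVec, Matrix.mul_assoc W S, ← hZW, ← Matrix.mul_assoc, hWs.2, Matrix.one_mul]
  rw [h1, sqSingularValues_unitary_mul hW, sqSingularValues_mul_unitary _
    (blockDiag_mem_unitary _ hV (one_mem _))]
  congr 1
  ext i j
  simp only [snocCol, borderedMatrix, Matrix.of_apply, hSv, hD]

/-- The blocks of the rows of a new column. -/
def columnBlocks (m n N : ℕ) (i : Fin m) : Fin (N + 2) :=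
  if n ≤ (i : ℕ) then 0 else if h : (i : ℕ) < N then (⟨i, h⟩ : Fin N).castSucc.succ else Fin.last _

theorem columnBlocks_eq_zero_iff {m n N : ℕ} (i : Fin m) :
    columnBlocks m n N i = 0 ↔ n ≤ (i : ℕ) := by
  unfold columnBlocks
  split_ifs with h1 h2
  · simp [h1]
  · simp [h1, Fin.ext_iff]
  · simp [h1, Fin.ext_iff]

theorem columnBlocks_eq_castSucc_succ_iff {m n N : ℕ} (hN : N ≤ n) (i : Fin m) (j : Fin N) :
    columnBlocks m n N i = j.castSucc.succ ↔ (i : ℕ) = j := by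
  unfold columnBlocks
  split_ifs with h1 h2
  · have := j.2
    simp [Fin.ext_iff]
    omega
  · simp [Fin.ext_iff]
  · have := j.2
    simp [Fin.ext_iff]
    omega

theorem columnBlocks_eq_last_iff {m n N : ℕ} (i : Fin m) :
    columnBlocks m n N i = Fin.last _ ↔ N ≤ (i : ℕ) ∧ (i : ℕ) < n := by
  unfold columnBlocks
  split_ifs with h1 h2
  · simp [Fin.ext_iff, h1]
  · simp [Fin.ext_iff]
    omega
  · simp
    omega

theorem card_subtype_fin_Ico {m n N : ℕ} (h : n ≤ m) (p : Fin m → Prop) [DecidablePred p]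
    (hp : ∀ i, p i ↔ N ≤ (i : ℕ) ∧ (i : ℕ) < n) : Fintype.card {i // p i} = n - N := by
  rw [Fintype.card_subtype, ← Nat.card_Ico, ← Finset.card_map Fin.valEmbedding]
  congr 1
  ext k
  simp only [Finset.mem_map, Finset.mem_filter, Finset.mem_univ, true_and, hp, Finset.mem_Ico,
    Fin.valEmbedding_apply]
  exact ⟨fun ⟨i, hi, hk⟩ => hk ▸ hi, fun hk => ⟨⟨k, by omega⟩, hk, rfl⟩⟩

theorem columnBlocks_surjective {m n N : ℕ} (hN : N < n) (hn : n < m) :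
    Function.Surjective (columnBlocks m n N) := by
  intro j
  induction j using Fin.cases with
  | zero => exact ⟨⟨n, hn⟩, (columnBlocks_eq_zero_iff _).2 le_rfl⟩
  | succ j =>
    induction j using Fin.lastCases with
    | last => exact ⟨⟨N, hN.trans hn⟩, (columnBlocks_eq_last_iff _).2 ⟨le_rfl, hN⟩⟩
    | cast j =>
      exact ⟨⟨j, by omega⟩, (columnBlocks_eq_castSucc_succ_iff hN.le _ _).2 rfl⟩

/-- The block of the pole 1 consists of the coordinates from n on, which the n rows do not see; that
of the pole 0 consists of those between N and n. Each x_j has a single coordinate. -/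
theorem card_columnBlocks {m n N : ℕ} (hN : N < n) (hn : n < m) (θ : ℝ) :
    (fun j => θ * (Fintype.card {i // columnBlocks m n N i = j} : ℝ)) =
      poleExponents N θ (θ * (n - N)) (θ * (m - n)) := by
  ext j
  induction j using Fin.cases with
  | zero =>
    rw [card_subtype_fin_Ico (n := m) (N := n) le_rfl _ fun i =>
      (columnBlocks_eq_zero_iff i).trans ⟨fun h => ⟨h, i.2⟩, fun h => h.1⟩, Nat.cast_sub hn.le]
    rfl
  | succ j =>
    induction j using Fin.lastCases with
    | last =>
      rw [Fin.succ_last, card_subtype_fin_Ico (n := n) (N := N) hn.le _ columnBlocks_eq_last_iff,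
        Nat.cast_sub hN.le, ← Fin.succ_last]
      simp [poleExponents]
    | cast j =>
      have hj := j.2
      rw [card_subtype_fin_Ico (n := j + 1) (N := j) (by omega) _ fun i =>
        (columnBlocks_eq_castSucc_succ_iff hN.le i j).trans (by omega)]
      simp [poleExponents]

theorem blockNorms_columnBlocks {m n N : ℕ} (hN : N ≤ n) (hn : n ≤ m) (ξ : Fin m → 𝕂) :
    (fun j : Fin (N + 1) => blockNorms (columnBlocks m n N) ξ j.succ) =
      poleWeights N hN fun i : Fin n => ξ (Fin.castLE hn i) := by
  ext j
  rw [blockNorms]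
  induction j using Fin.lastCases with
  | last =>
    rw [poleWeights, Fin.snoc_last, Fin.succ_last, ← Finset.sum_subtype
      ((Finset.univ.filter (fun i : Fin n => N ≤ (i : ℕ))).map (Fin.castLEEmb hn)) _
      (fun i => ‖ξ i‖ ^ 2), Finset.sum_map]
    · rfl
    · intro i
      simp only [Finset.mem_map, Finset.mem_filter, Finset.mem_univ, true_and,
        columnBlocks_eq_last_iff]
      exact ⟨fun ⟨k, hk, hi⟩ => hi ▸ ⟨hk, k.2⟩, fun h => ⟨⟨i, h.2⟩, h.1, rfl⟩⟩
  | cast j =>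
    rw [poleWeights, Fin.snoc_castSucc, ← Finset.sum_subtype {Fin.castLE (hN.trans hn) j} _
      (fun i => ‖ξ i‖ ^ 2), Finset.sum_singleton]
    · rfl
    · intro i
      rw [columnBlocks_eq_castSucc_succ_iff hN, Finset.mem_singleton, Fin.ext_iff]
      rfl

variable [MeasurableSpace 𝕂] [BorelSpace 𝕂]

/-- The squared singular values after adding a column with given squared norms. -/
noncomputable def borderMap (𝕂 : Type) [NormedDivisionRing 𝕂] [NormedAlgebra ℝ 𝕂] [StarRing 𝕂]
    {N : ℕ} (x : Fin N → ℝ) (w : Fin (N + 1) → ℝ) : Fin (N + 1) → ℝ :=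
  sqSingularValues (borderedMatrix x fun j : Fin (N + 1) => algebraMap ℝ 𝕂 √(w j))

theorem measurable_snoc {N : ℕ} {α β : Type*} [MeasurableSpace α] [MeasurableSpace β]
    {f : β → Fin N → α} {g : β → α} (hf : Measurable f) (hg : Measurable g) :
    Measurable fun p => (Fin.snoc (f p) (g p) : Fin (N + 1) → α) := by
  refine measurable_pi_iff.2 fun i => ?_
  induction i using Fin.lastCases with
  | last => simpa using hg
  | cast i => simpa [Function.comp_def] using (measurable_pi_apply i).comp hf

theorem measurable_borderedMatrix {n N : ℕ} {β : Type*} [MeasurableSpace β]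
    {f : β → Fin N → ℝ} {g : β → Fin n → 𝕂} (hf : Measurable f) (hg : Measurable g) :
    Measurable fun p => borderedMatrix (f p) (g p) := by
  refine measurable_pi_iff.2 fun i => measurable_snoc (measurable_pi_iff.2 fun j => ?_) ?_
  · simp only [rectDiag, Matrix.of_apply]
    split_ifs
    · exact (continuous_algebraMap ℝ 𝕂).measurable.comp
        (Real.continuous_sqrt.measurable.comp ((measurable_pi_apply j).comp hf))
    · exact measurable_const
  · unfold borderWeight
    refine Measurable.smul ?_ ((measurable_pi_apply i).comp hg)
    split_ifs with h
    · exact Real.continuous_sqrt.measurable.comp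
        (measurable_const.sub ((measurable_pi_apply _).comp hf))
    · exact measurable_const

theorem measurable_borderMap {N : ℕ} (x : Fin N → ℝ) : Measurable (borderMap 𝕂 x) := by
  refine measurable_sqSingularValues.comp (measurable_borderedMatrix measurable_const ?_)
  refine measurable_pi_iff.2 fun j => (continuous_algebraMap ℝ 𝕂).measurable.comp ?_
  fun_prop

/-- `borderMap` is defined everywhere, is measurable, and inverts the residue map on interlacing
points; it serves as the map T of `lintegral_selberg_succ`. -/
theorem borderMap_residue {N : ℕ} {x : Fin N → ℝ} (hx : x ∈ strictChamber N)
    {t : Fin (N + 1) → ℝ} (ht : t ∈ interlacing (polesOf x)) :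
    borderMap 𝕂 x (fun i => residue (polesOf x) t i.succ) = t := by
  have hpos : ∀ j : Fin (N + 1), 0 ≤ residue (polesOf x) t j.succ := fun j =>
    (residue_pos (polesOf_strictAnti hx) ht _).le
  refine sqSingularValues_borderedMatrix (Nat.le_succ N) hx ht ?_
  ext j
  induction j using Fin.lastCases with
  | last =>
    rw [poleWeights, Fin.snoc_last, Finset.sum_eq_single (Fin.last N)]
    · rw [norm_algebraMap', Real.norm_eq_abs, sq_abs, Real.sq_sqrt (hpos _)]
    · intro i hi hi'
      have := (Finset.mem_filter.1 hi).2
      exact absurd (Fin.ext (le_antisymm (Nat.lt_succ_iff.1 i.2) this)) hi'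
    · simp
  | cast j =>
    rw [poleWeights, Fin.snoc_castSucc, norm_algebraMap', Real.norm_eq_abs, sq_abs]
    rw [Real.sq_sqrt (hpos _)]
    rfl

/-- The singular values depend on the Haar column only through its block norms, and these are
Dirichlet with parameters θ times the block sizes. -/
theorem exists_lintegral_borderedMatrix {m n N : ℕ} (hN : N < n) (hn : n < m) (j₀ : Fin m) :
    ∃ c : ENNReal, ∀ (F : (Fin (N + 1) → ℝ) → ENNReal) (_ : Measurable F),
      ∀ x ∈ strictChamber N,
      ∫⁻ g, F (sqSingularValues (borderedMatrix x fun i : Fin n =>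
        (g : Matrix (Fin m) (Fin m) 𝕂) (Fin.castLE hn.le i) j₀)) ∂haarU 𝕂 m =
      c * ∫⁻ w in openSimplex (N + 1), dirichletWeight (poleExponents N
        ((Module.finrank ℝ 𝕂 : ℝ) / 2) ((Module.finrank ℝ 𝕂 : ℝ) / 2 * (n - N))
          ((Module.finrank ℝ 𝕂 : ℝ) / 2 * (m - n))) w * F (borderMap 𝕂 x w) := by
  obtain ⟨c, hc⟩ := exists_map_column_haarU_eq (𝕂 := 𝕂) _ (columnBlocks_surjective hN hn) j₀
  rw [card_columnBlocks hN hn] at hc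
  refine ⟨c, fun F hF x hx => ?_⟩
  have hcol := measurable_blockNorms_column (𝕂 := 𝕂) (columnBlocks m n N) j₀
  -- The law of the block norms has a density on the open simplex, so almost surely they are the
  -- residues of some interlacing t; both bordered matrices then have squared singular values t.
  have hae : ∀ᵐ (g : UGroup 𝕂 m) ∂haarU 𝕂 m, (fun i : Fin (N + 1) =>
      blockNorms (columnBlocks m n N) (fun l => (g : Matrix (Fin m) (Fin m) 𝕂) l j₀) i.succ) ∈
      openSimplex (N + 1) := by
    refine ae_of_ae_map hcol.aemeasurable (p := (· ∈ openSimplex (N + 1))) ?_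
    rw [hc]
    refine Measure.ae_smul_measure ?_ _
    exact (withDensity_absolutelyContinuous _ _).ae_le
      (ae_restrict_mem measurableSet_openSimplex)
  have h1 : ∀ᵐ (g : UGroup 𝕂 m) ∂haarU 𝕂 m, F (sqSingularValues (borderedMatrix x fun i : Fin n =>
        (g : Matrix (Fin m) (Fin m) 𝕂) (Fin.castLE hn.le i) j₀)) =
      F (borderMap 𝕂 x fun i : Fin (N + 1) =>
        blockNorms (columnBlocks m n N) (fun l => (g : Matrix (Fin m) (Fin m) 𝕂) l j₀) i.succ) := by
    filter_upwards [hae] with g hg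
    obtain ⟨t, ht, hw⟩ := exists_interlacing_residue_eq (polesOf_strictAnti hx) hg
    rw [← hw, borderMap_residue hx ht, sqSingularValues_borderedMatrix hN.le hx ht]
    rw [hw, blockNorms_columnBlocks hN.le hn.le]
  have hFm : Measurable fun w => F (borderMap 𝕂 x w) := hF.comp (measurable_borderMap x)
  rw [lintegral_congr_ae h1, ← lintegral_map hFm hcol, hc, lintegral_smul_measure, dirichletMeasure,
    lintegral_withDensity_eq_lintegral_mul _ (measurable_dirichletWeight _) hFm]
  rfl

end addColumn

/-! ### Law of the singular values of a corner, up to a constant -/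

section corner

variable {𝕂 : Type} [NormedDivisionRing 𝕂] [NormedAlgebra ℝ 𝕂] [StarRing 𝕂]
  [hK : IsCompositionField 𝕂]

theorem exists_sum_equiv_of_embedding {N L : ℕ} (f : Fin N ↪ Fin L) :
    ∃ e : Fin N ⊕ Fin (L - N) ≃ Fin L, ∀ j, e (Sum.inl j) = f j := by
  have h1 : Fintype.card ((Set.range f)ᶜ : Set (Fin L)) = L - N := by
    rw [Fintype.card_compl_set, Set.card_range_of_injective f.injective]
    simp
  refine ⟨((Equiv.ofInjective f f.injective).sumCongr (Fintype.equivFinOfCardEq h1).symm).trans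
    (Equiv.Set.sumCompl (Set.range f)), fun j => ?_⟩
  simp

/-- The matrix `1 ⊕ g` as a unitary matrix. -/
def blockU {N m L : ℕ} (e : Fin N ⊕ Fin m ≃ Fin L) (g : UGroup 𝕂 m) : UGroup 𝕂 L :=
  ⟨blockDiag e 1 (g : Matrix (Fin m) (Fin m) 𝕂), blockDiag_mem_unitary e (one_mem _) g.2⟩

theorem continuous_blockU {N m L : ℕ} (e : Fin N ⊕ Fin m ≃ Fin L) :
    Continuous (blockU (𝕂 := 𝕂) e) := by
  refine Continuous.subtype_mk ?_ _
  exact (Continuous.matrix_fromBlocks continuous_const continuous_const continuous_const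
    continuous_subtype_val).matrix_submatrix _ _

theorem submatrix_mul_conjTranspose_add {ι N m L : Type*} [Fintype N] [Fintype m] [Fintype L]
    [DecidableEq ι] [DecidableEq L] (e : N ⊕ m ≃ L) {U : Matrix L L 𝕂} (hU : U * Uᴴ = 1)
    (row : ι ↪ L) :
    (U.submatrix row fun j => e (Sum.inl j)) * (U.submatrix row fun j => e (Sum.inl j))ᴴ +
      (U.submatrix row fun j => e (Sum.inr j)) * (U.submatrix row fun j => e (Sum.inr j))ᴴ = 1 := by
  ext i j
  have h := congrFun (congrFun hU (row i)) (row j)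
  rw [Matrix.mul_apply, ← e.sum_comp, Fintype.sum_sum_type] at h
  rw [Matrix.add_apply, Matrix.mul_apply, Matrix.mul_apply]
  refine Eq.trans h ?_
  simp [Matrix.one_apply]

variable [MeasurableSpace 𝕂] [BorelSpace 𝕂]

theorem measurable_entry {L : ℕ} (i j : Fin L) :
    Measurable fun U : UGroup 𝕂 L => (U : Matrix (Fin L) (Fin L) 𝕂) i j :=
  (continuous_subtype_val.matrix_elem i j).measurable

theorem measurable_uncurry_borderMap (N : ℕ) :
    Measurable fun p : (Fin N → ℝ) × (Fin (N + 1) → ℝ) => borderMap 𝕂 p.1 p.2 := by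
  refine measurable_sqSingularValues.comp (measurable_borderedMatrix measurable_fst ?_)
  refine measurable_pi_iff.2 fun j => (continuous_algebraMap ℝ 𝕂).measurable.comp ?_
  fun_prop

theorem measurable_sqSingularValues_submatrix {n N L : ℕ} (row : Fin n → Fin L)
    (col : Fin N → Fin L) : Measurable fun U : UGroup 𝕂 L =>
      sqSingularValues ((U : Matrix (Fin L) (Fin L) 𝕂).submatrix row col) :=
  (continuous_sqSingularValues.comp (continuous_subtype_val.matrix_submatrix _ _)).measurable

/-- U may be replaced by U (1 ⊕ g) with g Haar on the complement of the first N chosen columns. This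
changes only the last chosen column, into Z times a column of g, and the unitary produced by
`sqSingularValues_snocCol` is absorbed by left invariance of g. -/
theorem lintegral_corner_succ {n N L : ℕ} (hN : N ≤ n) (hn : n ≤ L - N)
    (row : Fin n ↪ Fin L) (col : Fin (N + 1) ↪ Fin L) : ∃ j₀ : Fin (L - N),
    ∀ (F : (Fin (N + 1) → ℝ) → ENNReal) (_ : Measurable F),
    ∫⁻ U, F (sqSingularValues ((U : Matrix (Fin L) (Fin L) 𝕂).submatrix row col)) ∂haarU 𝕂 L =
    ∫⁻ U, ∫⁻ g, F (sqSingularValues (borderedMatrix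
      (sqSingularValues ((U : Matrix (Fin L) (Fin L) 𝕂).submatrix row (col ∘ Fin.castSucc)))
      fun i : Fin n => (g : Matrix (Fin (L - N)) (Fin (L - N)) 𝕂) (Fin.castLE hn i) j₀))
      ∂haarU 𝕂 (L - N) ∂haarU 𝕂 L := by
  obtain ⟨e, he⟩ := exists_sum_equiv_of_embedding (Fin.castSuccEmb.trans col)
  obtain ⟨j₀, hj₀⟩ : ∃ j₀, e (Sum.inr j₀) = col (Fin.last N) := by
    obtain ⟨s, hs⟩ := e.surjective (col (Fin.last N))
    rcases s with j | j
    · rw [he] at hs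
      exact absurd (col.injective hs) (Fin.castSucc_ne_last j)
    · exact ⟨j, hs⟩
  refine ⟨j₀, fun F hF => ?_⟩
  have hm := measurable_sqSingularValues_submatrix (𝕂 := 𝕂) row col
  set Φ : UGroup 𝕂 L → ENNReal := fun U =>
    F (sqSingularValues ((U : Matrix (Fin L) (Fin L) 𝕂).submatrix row col)) with hΦ
  have hΦm : Measurable Φ := hF.comp hm
  have hbm : Measurable fun p : UGroup 𝕂 (L - N) × UGroup 𝕂 L => Φ (p.2 * blockU e p.1) :=
    hΦm.comp (continuous_snd.mul ((continuous_blockU e).comp continuous_fst)).measurable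
  have h1 : ∫⁻ U, Φ U ∂haarU 𝕂 L =
      ∫⁻ g, ∫⁻ U, Φ (U * blockU e g) ∂haarU 𝕂 L ∂haarU 𝕂 (L - N) := by
    have : ∀ g, ∫⁻ U, Φ (U * blockU e g) ∂haarU 𝕂 L = ∫⁻ U, Φ U ∂haarU 𝕂 L := fun g =>
      (measurePreserving_mul_right_haarU (blockU e g)).lintegral_comp hΦm
    simp [this]
  rw [h1, lintegral_lintegral_swap (f := fun g U => Φ (U * blockU e g)) hbm.aemeasurable]
  refine lintegral_congr fun U => ?_
  set X := (U : Matrix (Fin L) (Fin L) 𝕂).submatrix row (col ∘ Fin.castSucc) with hX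
  set Z := (U : Matrix (Fin L) (Fin L) 𝕂).submatrix row fun j => e (Sum.inr j) with hZ
  have hXe : X = (U : Matrix (Fin L) (Fin L) 𝕂).submatrix row fun j => e (Sum.inl j) := by
    simp only [he]
    rfl
  have hXZ : X * Xᴴ + Z * Zᴴ = 1 := by
    rw [hXe, hZ]
    exact submatrix_mul_conjTranspose_add e (Unitary.mem_iff.1 U.2).2 row
  obtain ⟨W, hW, hWq⟩ := sqSingularValues_snocCol hN hn hXZ
  have h2 : ∀ g : UGroup 𝕂 (L - N), Φ (U * blockU e g) =
      F (sqSingularValues (borderedMatrix (sqSingularValues X) fun i : Fin n =>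
        ((⟨W, hW⟩ * g : UGroup 𝕂 (L - N)) : Matrix (Fin (L - N)) (Fin (L - N)) 𝕂)
          (Fin.castLE hn i) j₀)) := by
    intro g
    have h3 : ((U * blockU e g : UGroup 𝕂 L) : Matrix (Fin L) (Fin L) 𝕂).submatrix row col =
        snocCol X (Z *ᵥ fun l => (g : Matrix (Fin (L - N)) (Fin (L - N)) 𝕂) l j₀) := by
      have hl := submatrix_mul_blockDiag_inl e (U : Matrix (Fin L) (Fin L) 𝕂) 1
        (g : Matrix (Fin (L - N)) (Fin (L - N)) 𝕂) row (id : Fin N → Fin N)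
      have hr := submatrix_mul_blockDiag_inr e (U : Matrix (Fin L) (Fin L) 𝕂) 1
        (g : Matrix (Fin (L - N)) (Fin (L - N)) 𝕂) row (fun _ : Fin 1 => j₀)
      rw [← hXe, Matrix.submatrix_id_id, Matrix.mul_one] at hl
      ext i j
      induction j using Fin.lastCases with
      | last =>
        have := congrFun (congrFun hr i) 0
        simp only [hj₀] at this
        refine Eq.trans this ?_
        simp [snocCol, Matrix.mul_apply, Matrix.mulVec, dotProduct, hZ]
      | cast j =>
        have := congrFun (congrFun hl i) j
        simp only [he] at this
        refine Eq.trans this ?_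
        simp [snocCol]
    rw [hΦ]
    simp only [h3, hWq]
    rfl
  simp only [h2]
  refine (measurePreserving_mul_left_haarU (⟨W, hW⟩ : UGroup 𝕂 (L - N))).lintegral_comp
    (f := fun g : UGroup 𝕂 (L - N) =>
      F (sqSingularValues (borderedMatrix (sqSingularValues X) fun i : Fin n =>
        (g : Matrix (Fin (L - N)) (Fin (L - N)) 𝕂) (Fin.castLE hn i) j₀))) ?_
  refine hF.comp (measurable_sqSingularValues.comp (measurable_borderedMatrix measurable_const ?_))
  exact measurable_pi_iff.2 fun i => measurable_entry _ _

/-- The law of the squared singular values of a corner of a Haar distributed unitary matrix. -/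
theorem exists_map_corner_eq (N : ℕ) {n L : ℕ} (hN : N ≤ n) (hn : N + n ≤ L) (row : Fin n ↪ Fin L)
    (col : Fin N ↪ Fin L) : ∃ c : ENNReal,
    (haarU 𝕂 L).map (fun U : UGroup 𝕂 L =>
      sqSingularValues ((U : Matrix (Fin L) (Fin L) 𝕂).submatrix row col)) =
    c • selbergMeasure ((Module.finrank ℝ 𝕂 : ℝ) / 2)
      ((Module.finrank ℝ 𝕂 : ℝ) / 2 * (n - N + 1))
      ((Module.finrank ℝ 𝕂 : ℝ) / 2 * (L - n - N + 1)) N := by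
  induction N with
  | zero =>
    have h1 := measurable_sqSingularValues_submatrix (𝕂 := 𝕂) row col
    have h2 : IsProbabilityMeasure ((haarU 𝕂 L).map (fun U : UGroup 𝕂 L =>
      sqSingularValues ((U : Matrix (Fin L) (Fin L) 𝕂).submatrix row col))) :=
      Measure.isProbabilityMeasure_map h1.aemeasurable
    refine ⟨1, Measure.ext fun s _ => ?_⟩
    have h3 : strictChamber 0 = Set.univ := Set.eq_univ_of_forall fun x =>
      ⟨fun i => i.elim0, fun i => i.elim0⟩
    have h4 : selbergMeasure ((Module.finrank ℝ 𝕂 : ℝ) / 2)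
      ((Module.finrank ℝ 𝕂 : ℝ) / 2 * (n - (0 : ℕ) + 1))
      ((Module.finrank ℝ 𝕂 : ℝ) / 2 * (L - n - (0 : ℕ) + 1)) 0 Set.univ = 1 := by
      rw [selbergMeasure, withDensity_apply _ MeasurableSet.univ, h3]
      simp [selbergDensity, absVandermonde, volume_pi]
    rcases Set.eq_empty_or_nonempty s with rfl | hs
    · simp
    · rw [Subsingleton.eq_univ_of_nonempty hs, measure_univ, one_smul, h4]
  | succ N ih =>
    set θ := (Module.finrank ℝ 𝕂 : ℝ) / 2 with hθ
    obtain ⟨c₁, hc₁⟩ := ih (by omega) (by omega) (Fin.castSuccEmb.trans col)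
    obtain ⟨j₀, hj₀⟩ := lintegral_corner_succ (𝕂 := 𝕂) (by omega) (by omega) row col
    obtain ⟨c₂, hc₂⟩ := exists_lintegral_borderedMatrix (𝕂 := 𝕂) (m := L - N) (n := n) (N := N)
      (by omega) (by omega) j₀
    -- With a = θ (n - N) and b = θ (L - N - n), the induction hypothesis has the exponents a + θ
    -- and b + θ, and the new column has Dirichlet parameters a at the pole 0 and b at the pole 1.
    obtain ⟨c₃, hc₃⟩ := lintegral_selberg_succ θ (θ * (n - N)) (θ * ((L - N : ℕ) - n)) N
    have hcast : ((L - N : ℕ) : ℝ) = L - N := Nat.cast_sub (by omega)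
    refine ⟨c₁ * c₂ * c₃, Measure.ext_of_lintegral _ fun F hF => ?_⟩
    have hHm : Measurable fun x : Fin N → ℝ => ∫⁻ g, F (sqSingularValues (borderedMatrix x
        fun i : Fin n => (g : Matrix (Fin (L - N)) (Fin (L - N)) 𝕂) (Fin.castLE (by omega) i) j₀))
        ∂haarU 𝕂 (L - N) := by
      refine Measurable.lintegral_prod_right' (f := fun p : (Fin N → ℝ) × UGroup 𝕂 (L - N) =>
        F (sqSingularValues (borderedMatrix p.1 fun i : Fin n =>
          (p.2 : Matrix (Fin (L - N)) (Fin (L - N)) 𝕂) (Fin.castLE (by omega) i) j₀))) ?_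
      refine hF.comp (measurable_sqSingularValues.comp (measurable_borderedMatrix measurable_fst ?_))
      exact measurable_pi_iff.2 fun i => (measurable_entry _ _).comp measurable_snd
    rw [lintegral_map hF (measurable_sqSingularValues_submatrix _ _), hj₀ F hF]
    rw [← lintegral_map hHm (measurable_sqSingularValues_submatrix row (col ∘ Fin.castSucc))]
    have hc₁' := hc₁
    change Measure.map (fun U : UGroup 𝕂 L => sqSingularValues
      ((U : Matrix (Fin L) (Fin L) 𝕂).submatrix row (col ∘ Fin.castSucc))) _ = _ at hc₁'
    have hm3 := hc₃ F hF (borderMap 𝕂) fun x hx t ht => borderMap_residue hx ht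
    rw [hc₁', lintegral_smul_measure, lintegral_selbergMeasure _ _ _ hHm,
      lintegral_smul_measure]
    have ha : θ * (n - N + 1) = θ * (n - N) + θ := by ring
    have hb : θ * (L - n - N + 1) = θ * ((L - N : ℕ) - n) + θ := by rw [hcast]; ring
    have ha' : θ * (n - (N + 1 : ℕ) + 1) = θ * (n - N) := by push_cast; ring
    have hb' : θ * (L - n - (N + 1 : ℕ) + 1) = θ * ((L - N : ℕ) - n) := by
      rw [hcast]; push_cast; ring
    rw [ha, hb, ha', hb']
    rw [smul_eq_mul, smul_eq_mul, mul_assoc (c₁ * c₂), ← hm3, mul_assoc c₁]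
    congr 1
    have hIm : Measurable fun x : Fin N → ℝ => ∫⁻ w in openSimplex (N + 1),
        dirichletWeight (poleExponents N θ (θ * (n - N)) (θ * ((L - N : ℕ) - n))) w *
          F (borderMap 𝕂 x w) := by
      refine Measurable.lintegral_prod_right' (f := fun p : (Fin N → ℝ) × (Fin (N + 1) → ℝ) =>
        dirichletWeight (poleExponents N θ (θ * (n - N)) (θ * ((L - N : ℕ) - n))) p.2 *
          F (borderMap 𝕂 p.1 p.2)) ?_
      exact ((measurable_dirichletWeight _).comp measurable_snd).mul
        (hF.comp (measurable_uncurry_borderMap N))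
    refine Eq.trans ?_ (lintegral_const_mul c₂
      (((measurable_selbergDensity θ (θ * (n - N) + θ) (θ * ((L - N : ℕ) - n) + θ)).ennreal_ofReal).mul
        hIm))
    refine setLIntegral_congr_fun (measurableSet_strictChamber N) fun x hx => ?_
    simp only [hc₂ F hF x hx]
    ring

end corner

/-! ### Identification with the Jacobi ensemble, including frozen particles -/

section jacobi

theorem absVandermonde_nonneg {k : ℕ} (s : Fin k → ℝ) : 0 ≤ absVandermonde s :=
  Finset.prod_nonneg fun _ _ => Finset.prod_nonneg fun _ _ => abs_nonneg _

/-- The reflection `x_j ↦ 1 - x_{k-j}`. -/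
def reflect {k : ℕ} (x : Fin k → ℝ) : Fin k → ℝ := fun j => 1 - x j.rev

theorem reflect_reflect {k : ℕ} (x : Fin k → ℝ) : reflect (reflect x) = x := by
  ext j
  simp [reflect]

theorem absVandermonde_reflect {k : ℕ} (x : Fin k → ℝ) :
    absVandermonde (reflect x) = absVandermonde x := by
  rw [← sq_eq_sq₀ (absVandermonde_nonneg _) (absVandermonde_nonneg _), absVandermonde_sq,
    absVandermonde_sq]
  have h : ∀ (y : Fin k → ℝ) i, ∏ j ∈ Finset.univ.erase i, |y i - y j| =
      ∏ j, if j = i then 1 else |y i - y j| := by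
    intro y i
    rw [← Finset.mul_prod_erase _ _ (Finset.mem_univ i), if_pos rfl, one_mul]
    exact Finset.prod_congr rfl fun j hj => by rw [if_neg (Finset.ne_of_mem_erase hj)]
  simp only [h]
  rw [← Equiv.prod_comp Fin.revPerm]
  refine Finset.prod_congr rfl fun i _ => ?_
  rw [← Equiv.prod_comp Fin.revPerm]
  refine Finset.prod_congr rfl fun j _ => ?_
  simp [reflect, abs_sub_comm]

theorem reflect_mem_strictChamber {k : ℕ} {x : Fin k → ℝ} (hx : x ∈ strictChamber k) :
    reflect x ∈ strictChamber k := by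
  refine ⟨fun i j hij => ?_, fun i => ?_⟩
  · have := hx.1 (Fin.rev_lt_rev.2 hij)
    simp only [reflect]
    linarith
  · have := hx.2 i.rev
    exact ⟨by simp only [reflect]; linarith [this.2], by simp only [reflect]; linarith [this.1]⟩

theorem preimage_reflect_strictChamber (k : ℕ) :
    reflect ⁻¹' strictChamber k = strictChamber k := by
  ext x
  exact ⟨fun h => reflect_reflect x ▸ reflect_mem_strictChamber h, reflect_mem_strictChamber⟩

theorem measurePreserving_reflect (k : ℕ) :
    MeasurePreserving (reflect : (Fin k → ℝ) → Fin k → ℝ) volume volume := by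
  have h1 := volume_measurePreserving_piCongrLeft (fun _ : Fin k => ℝ) Fin.revPerm
  have h2 : MeasurePreserving (fun x : Fin k → ℝ => 1 - x) volume volume :=
    Measure.measurePreserving_sub_left volume 1
  have h3 := h2.comp h1
  convert h3 using 1
  ext x j
  have h4 := Equiv.piCongrLeft_apply_apply (fun _ : Fin k => ℝ) Fin.revPerm x j.rev
  simp only [Fin.revPerm_apply, Fin.rev_rev] at h4
  simp only [reflect, Function.comp_apply, Pi.sub_apply, Pi.one_apply]
  congr 1
  exact h4.symm

theorem selbergDensity_reflect (θ a b : ℝ) {k : ℕ} (x : Fin k → ℝ) :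
    selbergDensity θ b a (reflect x) = selbergDensity θ a b x := by
  have h1 : ∏ i, reflect x i = ∏ i, (1 - x i) := by
    rw [← Equiv.prod_comp Fin.revPerm]; simp [reflect]
  have h2 : ∏ i, (1 - reflect x i) = ∏ i, x i := by
    rw [← Equiv.prod_comp Fin.revPerm]; simp [reflect]
  rw [selbergDensity, selbergDensity, absVandermonde_reflect, h1, h2, mul_comm ((∏ i, x i) ^ (a - 1))]

theorem map_reflect_selbergMeasure (θ a b : ℝ) (k : ℕ) :
    (selbergMeasure θ a b k).map reflect = selbergMeasure θ b a k := by
  have hr := measurePreserving_reflect k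
  refine Measure.ext_of_lintegral _ fun F hF => ?_
  rw [lintegral_map hF hr.measurable,
    lintegral_selbergMeasure _ _ _ (f := fun a => F (reflect a)) (hF.comp hr.measurable),
    lintegral_selbergMeasure _ _ _ hF]
  refine Eq.trans ?_ (hr.setLIntegral_comp_preimage (measurableSet_strictChamber k)
    (((measurable_selbergDensity θ b a).ennreal_ofReal).mul hF))
  rw [preimage_reflect_strictChamber]
  simp only [selbergDensity_reflect]

theorem volume_setOf_apply_eq_apply {k : ℕ} {i j : Fin k} (hij : i ≠ j) :
    volume {x : Fin k → ℝ | x i = x j} = 0 := by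
  let S : Submodule ℝ (Fin k → ℝ) := LinearMap.ker
    ((LinearMap.proj i : (Fin k → ℝ) →ₗ[ℝ] ℝ) - LinearMap.proj j)
  have h : {x : Fin k → ℝ | x i = x j} = S := by
    ext x
    simp [S, sub_eq_zero]
  rw [h]
  refine Measure.addHaar_submodule _ _ fun hS => ?_
  have h1 : Pi.single i 1 ∈ S := hS ▸ Submodule.mem_top
  simp [S, hij.symm] at h1

theorem ae_eq_strictChamber (k : ℕ) :
    {x : Fin k → ℝ | Antitone x ∧ ∀ i, x i ∈ Set.Icc (0 : ℝ) 1} =ᵐ[volume] strictChamber k := by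
  have h1 : ∀ᵐ x : Fin k → ℝ, ∀ i j, i ≠ j → x i ≠ x j := by
    rw [ae_all_iff]
    intro i
    rw [ae_all_iff]
    intro j
    by_cases hij : i = j
    · simp [hij]
    · rw [ae_iff]
      simpa [hij] using volume_setOf_apply_eq_apply hij
  have h2 : ∀ c : ℝ, ∀ᵐ x : Fin k → ℝ, ∀ i, x i ≠ c := by
    intro c
    rw [ae_all_iff]
    intro i
    rw [ae_iff]
    simpa [volume_pi] using Measure.pi_hyperplane (fun _ : Fin k => (volume : Measure ℝ)) i c
  filter_upwards [h1, h2 0, h2 1] with x hx hx0 hx1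
  refine propext ⟨fun h => ⟨?_, fun i => ?_⟩, fun h => ⟨h.1.antitone, fun i => ?_⟩⟩
  · exact h.1.strictAnti_of_injective fun i j hij => by_contra fun hne => hx i j hne hij
  · exact ⟨lt_of_le_of_ne (h.2 i).1 (hx0 i).symm, lt_of_le_of_ne (h.2 i).2 (hx1 i)⟩
  · exact ⟨(h.2 i).1.le, (h.2 i).2.le⟩

theorem jacobiUnnormalized_eq (θ α : ℝ) (M N : ℕ) : jacobiUnnormalized θ α M N =
    selbergMeasure θ (θ * α) (θ * |(M : ℝ) - N| + θ) (min M N) := by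
  rw [jacobiUnnormalized, selbergMeasure, Measure.restrict_congr_set (ae_eq_strictChamber _)]
  refine withDensity_congr_ae ?_
  filter_upwards [ae_restrict_mem (measurableSet_strictChamber _)] with x hx
  congr 1
  rw [jacobiWeight, selbergDensity, Finset.prod_mul_distrib,
    Real.finsetProd_rpow _ _ (fun i _ => (hx.2 i).1.le),
    Real.finsetProd_rpow _ _ (fun i _ => by linarith [(hx.2 i).2]), absVandermonde,
    ← Real.finsetProd_rpow _ _ (fun i _ => Finset.prod_nonneg fun _ _ => abs_nonneg _)]
  congr 1
  exact Finset.prod_congr rfl fun i _ => Real.finsetProd_rpow _ _ (fun _ _ => abs_nonneg _) _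

/-- A probability measure proportional to J is J normalised; this disposes of all the unknown
constants. -/
theorem eq_inv_smul_of_eq_smul {α : Type*} [MeasurableSpace α] {μ J : Measure α}
    [IsProbabilityMeasure μ] {c : ENNReal} (h : μ = c • J) : μ = (J Set.univ)⁻¹ • J := by
  have h1 : c * J Set.univ = 1 := by
    rw [← smul_eq_mul, ← Measure.smul_apply, ← h, measure_univ]
  rw [← ENNReal.eq_inv_of_mul_eq_one_left h1, ← h]

variable {𝕂 : Type} [NormedDivisionRing 𝕂] [NormedAlgebra ℝ 𝕂] [StarRing 𝕂]
  [hK : IsCompositionField 𝕂]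

theorem exists_sum_equiv_of_add_eq {N m L : ℕ} (h : N + m = L) (f : Fin N ↪ Fin L) :
    ∃ e : Fin N ⊕ Fin m ≃ Fin L, ∀ j, e (Sum.inl j) = f j := by
  obtain rfl : m = L - N := by omega
  exact exists_sum_equiv_of_embedding f

theorem sqSingularValues_submatrix_cast {m N k : ℕ} (h : k = N) (X : Matrix (Fin m) (Fin N) 𝕂) :
    sqSingularValues (X.submatrix id (Fin.cast h)) = sqSingularValues X ∘ Fin.cast h := by
  subst h
  rfl

/-- X* X = 1 - Z Z*, and Z Z* has the eigenvalues of Z* Z together with N - k zeros. Subtracting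
from one reverses the order. -/
theorem sqSingularValues_complement {n N k : ℕ} (hk : k ≤ N) {X : Matrix (Fin n) (Fin N) 𝕂}
    {Z : Matrix (Fin N) (Fin k) 𝕂} (h : Xᴴ * X + Z * Zᴴ = 1) (i : Fin N) :
    sqSingularValues X i = 1 - if h : (i.rev : ℕ) < k then sqSingularValues Z ⟨i.rev, h⟩ else 0 := by
  obtain ⟨W, hW, V, hV, hZ⟩ := exists_singular_value_decomposition hk Z
  set z := sqSingularValues Z with hz
  set D := rectDiag 𝕂 N (fun i => √(z i)) with hD
  set p : Fin N → ℝ := fun i => if h : (i : ℕ) < k then z ⟨i, h⟩ else 0 with hp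
  have hWs := Unitary.mem_iff.1 hW
  have hVs := Unitary.mem_iff.1 hV
  simp only [Matrix.star_eq_conjTranspose] at hWs hVs
  have hDD : D * Dᴴ = realDiag 𝕂 p := by
    ext i j
    rw [Matrix.mul_apply, realDiag, Matrix.diagonal_apply]
    by_cases h : (i : ℕ) < k
    · rw [Finset.sum_eq_single ⟨i, h⟩]
      · by_cases hij : i = j
        · subst hij
          simp [hD, rectDiag, Matrix.conjTranspose_apply, star_algebraMap_real, h, ← map_mul,
            Real.mul_self_sqrt (sqSingularValues_nonneg Z _), hz, hp]
        · have : (j : ℕ) ≠ i := fun h' => hij (Fin.ext h'.symm)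
          simp [hD, rectDiag, Matrix.conjTranspose_apply, hij, this]
      · intro l _ hl
        have : (i : ℕ) ≠ l := fun h => hl (Fin.ext h.symm)
        simp [hD, rectDiag, this]
      · simp
    · rw [Finset.sum_eq_zero]
      · simp [h, hp]
      · intro l _
        have : (i : ℕ) ≠ l := fun h' => h (h' ▸ l.2)
        simp [hD, rectDiag, this]
  have hZZ : Z * Zᴴ = W * realDiag 𝕂 p * Wᴴ := by
    rw [hZ, ← hDD]
    simp only [Matrix.conjTranspose_mul, Matrix.mul_assoc]
    rw [← Matrix.mul_assoc V, hVs.2, Matrix.one_mul]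
  have hXX : Xᴴ * X = W * realDiag 𝕂 (fun i => 1 - p i) * Wᴴ := by
    have h1 : realDiag 𝕂 (fun i => 1 - p i) = 1 - realDiag 𝕂 p := by
      ext i j
      by_cases hij : i = j
      · simp [realDiag, hij]
      · simp [realDiag, hij]
    rw [h1, Matrix.mul_sub, Matrix.sub_mul, Matrix.mul_one, hWs.2, ← hZZ, ← h, add_sub_cancel_right]
  have hanti : Antitone p := by
    intro i j hij
    simp only [hp]
    split_ifs with h1 h2 h2
    · exact sqSingularValues_antitone Z (by simpa using hij)
    · exact absurd (lt_of_le_of_lt (Fin.le_def.1 hij) h1) h2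
    · exact sqSingularValues_nonneg Z _
    · exact le_rfl
  have key : sqSingularValues X = fun i => 1 - p i.rev := by
    -- R is the order reversing permutation matrix, which puts the eigenvalues 1 - p back in
    -- decreasing order.
    set R : Matrix (Fin N) (Fin N) 𝕂 := (1 : Matrix (Fin N) (Fin N) 𝕂).submatrix id Fin.revPerm
      with hR
    have hRu : R ∈ UGroup 𝕂 N := by
      refine mem_unitary_of_conjTranspose_mul_self ?_
      rw [hR, Matrix.conjTranspose_submatrix, Matrix.conjTranspose_one,
        ← Matrix.submatrix_mul _ _ _ id _ Function.bijective_id, Matrix.one_mul]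
      exact Matrix.submatrix_one _ Fin.revPerm.injective
    have hRe : ∀ i j, R i j = if i = j.rev then 1 else 0 := fun i j => by
      rw [hR, Matrix.submatrix_apply, Matrix.one_apply]
      rfl
    refine sqSingularValues_eq ⟨fun i j hij => ?_, W * R, mul_mem hW hRu, ?_⟩
    · have := hanti (Fin.rev_le_rev.2 hij)
      simp only
      linarith
    · have h2 : R * Matrix.diagonal (fun i => algebraMap ℝ 𝕂 (1 - p i.rev)) * star R =
          realDiag 𝕂 (fun i => 1 - p i) := by
        ext i j
        rw [Matrix.mul_apply]
        simp only [Matrix.mul_diagonal, Matrix.star_eq_conjTranspose,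
          Matrix.conjTranspose_apply, hRe]
        rw [Finset.sum_eq_single i.rev]
        · by_cases hij : i = j
          · subst hij
            simp [realDiag]
          · have : j ≠ i := fun h => hij h.symm
            simp [realDiag, hij, this]
        · intro l _ hl
          have : i ≠ l.rev := fun h => hl (by rw [h, Fin.rev_rev])
          simp [this]
        · simp
      rw [star_mul, hXX, ← h2]
      simp only [Matrix.mul_assoc, Matrix.star_eq_conjTranspose]
  exact congrFun key i

variable [MeasurableSpace 𝕂] [BorelSpace 𝕂]

theorem measurable_padOnes (M N : ℕ) : Measurable (padOnes M N) := by
  refine measurable_pi_iff.2 fun i => ?_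
  unfold padOnes
  split_ifs
  · exact measurable_const
  · exact measurable_pi_apply _

/-- The squared singular values of a corner of a Haar distributed unitary matrix form a Jacobi
ensemble. -/
theorem map_corner_haarU_eq_jacobiEnsemble {N n L : ℕ} (hN : N ≤ n) (hn : n ≤ L)
    (row : Fin n ↪ Fin L) (col : Fin N ↪ Fin L) :
    (haarU 𝕂 L).map (fun U : UGroup 𝕂 L =>
      sqSingularValues ((U : Matrix (Fin L) (Fin L) 𝕂).submatrix row col)) =
    jacobiEnsemble ((Module.finrank ℝ 𝕂 : ℝ) / 2) ((n : ℝ) - N + 1) (L - n) N := by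
  set θ := (Module.finrank ℝ 𝕂 : ℝ) / 2 with hθ
  have hLn : ((L - n : ℕ) : ℝ) = L - n := Nat.cast_sub hn
  rw [jacobiEnsemble, jacobiUnnormalized_eq]
  -- In the first case no particle is frozen and the corner itself has a density. In the second, the
  -- complementary corner of size N × (L - n) has one, and N - (L - n) singular values of X equal
  -- one.
  rcases le_total N (L - n) with hM | hM
  · have hmin : min (L - n) N = N := min_eq_right hM
    obtain ⟨c, hc⟩ := exists_map_corner_eq (𝕂 := 𝕂) (min (L - n) N) (by omega) (by omega) row
      ((finCongr hmin).toEmbedding.trans col)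
    have hm := measurable_sqSingularValues_submatrix (𝕂 := 𝕂) row
      ((finCongr hmin).toEmbedding.trans col)
    have := Measure.isProbabilityMeasure_map (μ := haarU 𝕂 L) hm.aemeasurable
    have hc' := eq_inv_smul_of_eq_smul hc
    have hminR : ((min (L - n) N : ℕ) : ℝ) = N := by rw [hmin]
    have hab : |((L - n : ℕ) : ℝ) - N| = L - n - N := by
      have : (N : ℝ) ≤ (L - n : ℕ) := by exact_mod_cast hM
      rw [abs_of_nonneg (by linarith), hLn]
    rw [hminR, show θ * (L - n - N + 1) = θ * |((L - n : ℕ) : ℝ) - N| + θ by rw [hab]; ring] at hc'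
    rw [← hc', Measure.map_map (measurable_padOnes _ _) hm]
    congr 1
    ext U i
    have h1 := sqSingularValues_submatrix_cast hmin
      ((U : Matrix (Fin L) (Fin L) 𝕂).submatrix row col)
    have h2 : ¬ (i : ℕ) < N - min (L - n) N := by omega
    simp only [Function.comp_apply, padOnes, dif_neg h2]
    have h3 := congrFun h1 ⟨i - (N - min (L - n) N), by omega⟩
    refine Eq.trans ?_ h3.symm
    simp only [Function.comp_apply]
    congr 1
    ext
    simp only [Fin.val_cast]
    omega
  · have hmin : min (L - n) N = L - n := min_eq_left hM
    obtain ⟨e, he⟩ := exists_sum_equiv_of_add_eq (m := min (L - n) N) (by omega) row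
    let rowc : Fin (min (L - n) N) ↪ Fin L :=
      ⟨fun j => e (Sum.inr j), fun i j h => Sum.inr_injective (e.injective h)⟩
    obtain ⟨c, hc⟩ := exists_map_corner_eq (𝕂 := 𝕂) (min (L - n) N) (n := N) (by omega) (by omega)
      col rowc
    have hm := measurable_sqSingularValues_submatrix (𝕂 := 𝕂) col rowc
    have := Measure.isProbabilityMeasure_map (μ := haarU 𝕂 L) hm.aemeasurable
    have hr := (measurePreserving_reflect (min (L - n) N)).measurable
    have hp := Measure.isProbabilityMeasure_map (μ := (haarU 𝕂 L).map fun U : UGroup 𝕂 L =>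
      sqSingularValues ((U : Matrix (Fin L) (Fin L) 𝕂).submatrix col rowc)) hr.aemeasurable
    have hc2 := congrArg (Measure.map reflect) hc
    rw [Measure.map_smul, map_reflect_selbergMeasure] at hc2
    have hc' := eq_inv_smul_of_eq_smul hc2
    have hminR : ((min (L - n) N : ℕ) : ℝ) = L - n := by rw [hmin, hLn]
    have hab : |((L - n : ℕ) : ℝ) - N| = N - (L - n) := by
      have : ((L - n : ℕ) : ℝ) ≤ N := by exact_mod_cast hM
      rw [abs_of_nonpos (by linarith), hLn]
      ring
    rw [hminR, show θ * (L - N - (L - n) + 1) = θ * (n - N + 1) by ring,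
      show θ * (N - (L - n) + 1) = θ * |((L - n : ℕ) : ℝ) - N| + θ by rw [hab]; ring] at hc'
    rw [← hc', Measure.map_map (measurable_padOnes _ _) hr,
      Measure.map_map ((measurable_padOnes _ _).comp hr) hm]
    have hm' := (((measurable_padOnes (L - n) N).comp hr).comp hm)
    -- In U⁻¹ = U* the rows `col` consist of X* and of the complementary corner Z, so their
    -- orthonormality reads X* X + Z Z* = 1.
    rw [← (measurePreserving_inv_haarU (𝕂 := 𝕂) L).map_eq, Measure.map_map hm' measurable_inv,
      (measurePreserving_inv_haarU (𝕂 := 𝕂) L).map_eq]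
    congr 1
    ext U i
    have hU := (Unitary.mem_iff.1 (U⁻¹).2).2
    have h1 := submatrix_mul_conjTranspose_add e hU col
    have h2 : ((U⁻¹ : UGroup 𝕂 L) : Matrix (Fin L) (Fin L) 𝕂) =
      (U : Matrix (Fin L) (Fin L) 𝕂)ᴴ := rfl
    have h3 : ((U⁻¹ : UGroup 𝕂 L) : Matrix (Fin L) (Fin L) 𝕂).submatrix col
        (fun j => e (Sum.inl j)) = ((U : Matrix (Fin L) (Fin L) 𝕂).submatrix row col)ᴴ := by
      rw [h2, Matrix.conjTranspose_submatrix]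
      simp only [he]
    rw [h3, Matrix.conjTranspose_conjTranspose] at h1
    rw [sqSingularValues_complement (by omega) h1 i]
    simp only [Function.comp_apply, padOnes, reflect]
    by_cases hi : (i : ℕ) < N - min (L - n) N
    · rw [dif_pos hi, dif_neg (by rw [Fin.val_rev]; omega), sub_zero]
    · rw [dif_neg hi, dif_pos (show (i.rev : ℕ) < min (L - n) N by rw [Fin.val_rev]; omega)]
      congr 2
      ext
      simp only [Fin.val_rev]
      omega

end jacobi

/-! ### One step of the chain -/

section step

variable {𝕂 : Type} [NormedDivisionRing 𝕂] [NormedAlgebra ℝ 𝕂] [StarRing 𝕂]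
  [hK : IsCompositionField 𝕂]

/-- The squared singular values of `diag(√x) V diag(√r)`. -/
noncomputable def stepMap {N : ℕ} (r : Fin N → ℝ) (v : (Fin N → ℝ) × UGroup 𝕂 N) : Fin N → ℝ :=
  sqSingularValues (realDiag 𝕂 (fun i => √(v.1 i)) * (v.2 : Matrix (Fin N) (Fin N) 𝕂) *
    realDiag 𝕂 fun i => √(r i))

theorem sqSingularValues_rectDiag_mul {m N k : ℕ} (h : N ≤ m) (d : Fin N → ℝ)
    (B : Matrix (Fin N) (Fin k) 𝕂) :
    sqSingularValues (rectDiag 𝕂 m d * B) = sqSingularValues (realDiag 𝕂 d * B) := by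
  refine sqSingularValues_congr ?_
  rw [Matrix.conjTranspose_mul, Matrix.conjTranspose_mul, Matrix.mul_assoc, Matrix.mul_assoc,
    ← Matrix.mul_assoc _ _ B, rectDiag_conjTranspose_mul_self h, ← realDiag_mul,
    realDiag_conjTranspose, Matrix.mul_assoc]

theorem continuous_realDiag_sqrt (N : ℕ) :
    Continuous fun x : Fin N → ℝ => realDiag 𝕂 fun i => √(x i) := by
  unfold realDiag
  refine Continuous.matrix_diagonal (continuous_pi fun i => ?_)
  exact (continuous_algebraMap ℝ 𝕂).comp (Real.continuous_sqrt.comp (continuous_apply i))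

variable [MeasurableSpace 𝕂] [BorelSpace 𝕂]

theorem continuous_stepMap (N : ℕ) :
    Continuous fun q : (Fin N → ℝ) × (Fin N → ℝ) × UGroup 𝕂 N => stepMap q.1 q.2 := by
  refine continuous_sqSingularValues.comp (Continuous.matrix_mul (Continuous.matrix_mul ?_ ?_) ?_)
  · exact (continuous_realDiag_sqrt N).comp (continuous_fst.comp continuous_snd)
  · exact continuous_subtype_val.comp (continuous_snd.comp continuous_snd)
  · exact (continuous_realDiag_sqrt N).comp continuous_fst

theorem measurable_uncurry_stepMap (N : ℕ) : Measurable
    (Function.uncurry (stepMap : (Fin N → ℝ) → (Fin N → ℝ) × UGroup 𝕂 N → Fin N → ℝ)) :=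
  (continuous_stepMap N).measurable

theorem measurable_stepMap {N : ℕ} (r : Fin N → ℝ) :
    Measurable (stepMap r : (Fin N → ℝ) × UGroup 𝕂 N → Fin N → ℝ) :=
  (measurable_uncurry_stepMap N).of_uncurry_left

theorem lintegral_haarU_eq_average {N L : ℕ} {Φ : UGroup 𝕂 L → ENNReal} (hΦ : Measurable Φ) (ψ : UGroup 𝕂 N → UGroup 𝕂 L)
    (hψ : Measurable ψ) :
    ∫⁻ U, Φ U ∂haarU 𝕂 L = ∫⁻ U, ∫⁻ V, Φ (U * ψ V) ∂haarU 𝕂 N ∂haarU 𝕂 L := by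
  have : ∀ V, ∫⁻ U, Φ (U * ψ V) ∂haarU 𝕂 L = ∫⁻ U, Φ U ∂haarU 𝕂 L := fun V =>
    (measurePreserving_mul_right_haarU (ψ V)).lintegral_comp hΦ
  rw [lintegral_lintegral_swap (f := fun U V => Φ (U * ψ V))
    (hΦ.comp (measurable_fst.mul (hψ.comp measurable_snd))).aemeasurable]
  simp [this]

/-- The matrix `V ⊕ 1` as a unitary matrix. -/
def blockUL {N m L : ℕ} (e : Fin N ⊕ Fin m ≃ Fin L) (V : UGroup 𝕂 N) : UGroup 𝕂 L :=
  ⟨blockDiag e (V : Matrix (Fin N) (Fin N) 𝕂) 1, blockDiag_mem_unitary e V.2 (one_mem _)⟩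

theorem measurable_blockUL {N m L : ℕ} (e : Fin N ⊕ Fin m ≃ Fin L) :
    Measurable (blockUL (𝕂 := 𝕂) e) := by
  refine Continuous.measurable (Continuous.subtype_mk ?_ _)
  exact (Continuous.matrix_fromBlocks continuous_subtype_val continuous_const continuous_const
    continuous_const).matrix_submatrix _ _

theorem submatrix_mul_blockUL {ρ : Type*} {N m L : ℕ} (e : Fin N ⊕ Fin m ≃ Fin L) {f : Fin N ↪ Fin L}
    (he : ∀ j, e (Sum.inl j) = f j) (U : UGroup 𝕂 L) (V : UGroup 𝕂 N) (row : ρ → Fin L) :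
    ((U * blockUL e V : UGroup 𝕂 L) : Matrix (Fin L) (Fin L) 𝕂).submatrix row f =
      (U : Matrix (Fin L) (Fin L) 𝕂).submatrix row f * (V : Matrix (Fin N) (Fin N) 𝕂) := by
  have h := submatrix_mul_blockDiag_inl e (U : Matrix (Fin L) (Fin L) 𝕂)
    (V : Matrix (Fin N) (Fin N) 𝕂) 1 row (id : Fin N → Fin N)
  have hf : (f : Fin N → Fin L) = fun j => e (Sum.inl j) := funext fun j => (he j).symm
  rw [hf]
  exact h

theorem sqSingularValues_mul_mul_realDiag {m N : ℕ} (h : N ≤ m) (X : Matrix (Fin m) (Fin N) 𝕂) :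
    ∃ W : UGroup 𝕂 N, ∀ (V : UGroup 𝕂 N) (r : Fin N → ℝ),
      sqSingularValues (X * (V : Matrix (Fin N) (Fin N) 𝕂) * realDiag 𝕂 fun i => √(r i)) =
        stepMap r (sqSingularValues X, W * V) := by
  obtain ⟨W, hW, V', hV', hX⟩ := exists_singular_value_decomposition h X
  refine ⟨⟨V', hV'⟩, fun V r => ?_⟩
  conv_lhs => rw [hX]
  simp only [Matrix.mul_assoc]
  rw [sqSingularValues_unitary_mul hW, sqSingularValues_rectDiag_mul h, stepMap]
  simp only [Matrix.mul_assoc, Submonoid.coe_mul]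

theorem measurable_sqSingularValues_submatrix_mul {n N m L : ℕ} (row : Fin n → Fin L)
    (col : Fin m → Fin L) (Y : Matrix (Fin m) (Fin N) 𝕂) : Measurable fun U : UGroup 𝕂 L =>
      sqSingularValues ((U : Matrix (Fin L) (Fin L) 𝕂).submatrix row col * Y) :=
  (continuous_sqSingularValues.comp (Continuous.matrix_mul
    (continuous_subtype_val.matrix_submatrix _ _) continuous_const)).measurable

/-- Apart from unitary factors Y is a rectangular diagonal matrix, so only the first N of the
columns `col` matter. A Haar unitary on those columns makes the corner enter only through its
singular values. -/
theorem map_sqSingularValues_corner_mul {n N m L : ℕ} (hm : N ≤ m) (hn : N ≤ n)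
    (row : Fin n ↪ Fin L) (col : Fin m ↪ Fin L) (Y : Matrix (Fin m) (Fin N) 𝕂) :
    (haarU 𝕂 L).map (fun U : UGroup 𝕂 L =>
      sqSingularValues ((U : Matrix (Fin L) (Fin L) 𝕂).submatrix row col * Y)) =
    (((haarU 𝕂 L).map (fun U : UGroup 𝕂 L => sqSingularValues ((U : Matrix (Fin L) (Fin L) 𝕂).submatrix
      row ((Fin.castLEEmb hm).trans col)))).prod (haarU 𝕂 N)).map (stepMap (sqSingularValues Y)) := by
  set r := sqSingularValues Y with hr
  have hstep : Measurable (stepMap (𝕂 := 𝕂) r) := measurable_stepMap r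
  refine Measure.ext_of_lintegral _ fun F hF => ?_
  have hX := measurable_sqSingularValues_submatrix (𝕂 := 𝕂) row ((Fin.castLEEmb hm).trans col)
  have hG : Measurable fun v : (Fin N → ℝ) × UGroup 𝕂 N => F (stepMap r v) := hF.comp hstep
  have hK : Measurable fun x => ∫⁻ V, F (stepMap r (x, V)) ∂haarU 𝕂 N := hG.lintegral_prod_right'
  rw [lintegral_map hF (measurable_sqSingularValues_submatrix_mul _ _ _), lintegral_map hF hstep,
    lintegral_prod (fun v => F (stepMap r v)) hG.aemeasurable, lintegral_map hK hX]
  obtain ⟨W, hW, V', hV', hY⟩ := exists_singular_value_decomposition hm Y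
  obtain ⟨e₁, he₁⟩ := exists_sum_equiv_of_embedding col
  -- The left factor W of Y is moved into U, the right factor V' does not affect singular values,
  -- and the diagonal part selects N columns.
  have h1 : ∀ U : UGroup 𝕂 L,
      sqSingularValues ((U : Matrix (Fin L) (Fin L) 𝕂).submatrix row col * Y) =
      sqSingularValues (((U * blockUL e₁ ⟨W, hW⟩ : UGroup 𝕂 L) : Matrix (Fin L) (Fin L) 𝕂).submatrix
        row ((Fin.castLEEmb hm).trans col) * realDiag 𝕂 fun i => √(r i)) := by
    intro U
    conv_lhs => rw [hY]
    rw [← Matrix.mul_assoc, sqSingularValues_mul_unitary _ hV', ← Matrix.mul_assoc]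
    have h2 := submatrix_mul_blockUL e₁ he₁ U ⟨W, hW⟩ row
    rw [← h2, rectDiag_eq_submatrix_mul hm, ← Matrix.mul_assoc]
    congr 2
    ext i j
    simp [Matrix.mul_apply, Matrix.one_apply]
  simp only [h1]
  have h3 := measurable_sqSingularValues_submatrix_mul (𝕂 := 𝕂) row
    ((Fin.castLEEmb hm).trans col) (realDiag 𝕂 fun i => √(r i))
  have h4 : Measurable fun U : UGroup 𝕂 L =>
      F (sqSingularValues ((U : Matrix (Fin L) (Fin L) 𝕂).submatrix row
        ((Fin.castLEEmb hm).trans col) * realDiag 𝕂 fun i => √(r i))) := hF.comp h3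
  rw [(measurePreserving_mul_right_haarU (blockUL e₁ ⟨W, hW⟩)).lintegral_comp h4]
  obtain ⟨e₂, he₂⟩ := exists_sum_equiv_of_embedding ((Fin.castLEEmb hm).trans col)
  -- Averaging over V ⊕ 1 on the N selected columns; the right singular factor of the corner is then
  -- absorbed into V.
  rw [lintegral_haarU_eq_average h4 (blockUL e₂) (measurable_blockUL e₂)]
  refine lintegral_congr fun U => ?_
  obtain ⟨V'', hV''⟩ := sqSingularValues_mul_mul_realDiag hn
    ((U : Matrix (Fin L) (Fin L) 𝕂).submatrix row ((Fin.castLEEmb hm).trans col))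
  simp only [submatrix_mul_blockUL e₂ he₂, hV'']
  exact (measurePreserving_mul_left_haarU V'').lintegral_comp (f := fun V => F (stepMap r
    (sqSingularValues ((U : Matrix (Fin L) (Fin L) 𝕂).submatrix row ((Fin.castLEEmb hm).trans col)),
      V))) (hF.comp (hstep.comp measurable_prodMk_left))

/-- In `stepMap` the current vector stands on the right, but B stands on the left. Taking the
adjoint exchanges the two diagonals, and inversion preserves Haar measure. -/
theorem map_sqSingularValues_mul_haarU_mul {N : ℕ} (B A : Matrix (Fin N) (Fin N) 𝕂) :
    (haarU 𝕂 N).map (fun V : UGroup 𝕂 N =>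
      sqSingularValues (B * (V : Matrix (Fin N) (Fin N) 𝕂) * A)) =
    (haarU 𝕂 N).map fun V => stepMap (sqSingularValues B) (sqSingularValues A, V) := by
  obtain ⟨W, hW, V', hV', hB⟩ := exists_singular_value_decomposition le_rfl B
  obtain ⟨W₂, hW₂, V₂, hV₂, hA⟩ := exists_singular_value_decomposition le_rfl A
  set b := sqSingularValues B with hb
  set a := sqSingularValues A with ha
  clear_value a b
  rw [rectDiag_square] at hA hB
  have hstep : Measurable fun V : UGroup 𝕂 N => stepMap b (a, V) :=
    (measurable_stepMap b).comp measurable_prodMk_left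
  have h1 : ∀ V : UGroup 𝕂 N, sqSingularValues (B * (V : Matrix (Fin N) (Fin N) 𝕂) * A) =
      stepMap b (a, (⟨V', hV'⟩ * V * ⟨W₂, hW₂⟩)⁻¹) := by
    intro V
    have h2 : B * (V : Matrix (Fin N) (Fin N) 𝕂) * A = W * ((realDiag 𝕂 (fun i => √(b i)) *
        (V' * (V : Matrix (Fin N) (Fin N) 𝕂) * W₂) * realDiag 𝕂 (fun i => √(a i))) * V₂) := by
      rw [hA, hB]
      simp only [Matrix.mul_assoc]
    rw [h2, sqSingularValues_unitary_mul hW, sqSingularValues_mul_unitary _ hV₂,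
      ← sqSingularValues_conjTranspose, Matrix.conjTranspose_mul, Matrix.conjTranspose_mul,
      realDiag_conjTranspose, realDiag_conjTranspose, ← Matrix.mul_assoc, stepMap]
    rfl
  simp only [h1]
  have h3 : MeasurePreserving (fun V : UGroup 𝕂 N =>
      ((⟨V', hV'⟩ : UGroup 𝕂 N) * V * (⟨W₂, hW₂⟩ : UGroup 𝕂 N))⁻¹) (haarU 𝕂 N) (haarU 𝕂 N) :=
    (measurePreserving_inv_haarU N).comp ((measurePreserving_mul_right_haarU ⟨W₂, hW₂⟩).comp
      (measurePreserving_mul_left_haarU ⟨V', hV'⟩))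
  have h4 := Measure.map_map (μ := haarU 𝕂 N) hstep h3.measurable
  rw [h3.map_eq] at h4
  exact h4.symm

end step

/-! ### Markov chains with a hidden state -/

section markov

theorem measurable_snoc_step {E M S : Type*} [MeasurableSpace E] [MeasurableSpace M]
    [MeasurableSpace S] (T : ℕ) {y : M → S → E} (hy : Measurable (Function.uncurry y)) :
    Measurable fun q : ((Fin (T + 1) → E) × M) × S =>
      (Fin.snoc q.1.1 (y q.1.2 q.2) : Fin (T + 1 + 1) → E) :=
  measurable_snoc (measurable_fst.comp measurable_fst)
    (hy.comp ((measurable_snd.comp measurable_fst).prodMk measurable_snd))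

/-- If the law of the next value given the hidden state depends only on the last observed value, the
hidden state can be forgotten: condition on it and integrate. -/
theorem map_snoc_prod_eq {E M S V : Type*} [MeasurableSpace E] [MeasurableSpace M]
    [MeasurableSpace S] [MeasurableSpace V] {T : ℕ} (π : Measure ((Fin (T + 1) → E) × M)) [SFinite π]
    (e : Measure S) [SFinite e] (ε : Measure V) [SFinite ε] {k : E → V → E}
    (hk : Measurable (Function.uncurry k)) {y : M → S → E} (hy : Measurable (Function.uncurry y))
    (h : ∀ᵐ s ∂π, e.map (y s.2) = ε.map (k (s.1 (Fin.last T)))) :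
    (π.prod e).map (fun q => (Fin.snoc q.1.1 (y q.1.2 q.2) : Fin (T + 1 + 1) → E)) =
      ((π.map Prod.fst).prod ε).map
        (fun q => (Fin.snoc q.1 (k (q.1 (Fin.last T)) q.2) : Fin (T + 1 + 1) → E)) := by
  have hm1 := measurable_snoc_step T hy
  have h0 : Measurable fun q : (Fin (T + 1) → E) × V => (q.1 (Fin.last T), q.2) :=
    ((measurable_pi_apply _).comp measurable_fst).prodMk measurable_snd
  have hm2 : Measurable fun q : (Fin (T + 1) → E) × V =>
      (Fin.snoc q.1 (k (q.1 (Fin.last T)) q.2) : Fin (T + 1 + 1) → E) :=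
    measurable_snoc measurable_fst (hk.comp h0)
  refine Measure.ext_of_lintegral _ fun F hF => ?_
  have hF1 := hF.comp hm1
  have hF2 := hF.comp hm2
  simp only [Function.comp_def] at hF1 hF2
  rw [lintegral_map hF hm1, lintegral_map hF hm2, lintegral_prod _ hF1.aemeasurable,
    lintegral_prod _ hF2.aemeasurable, lintegral_map hF2.lintegral_prod_right' measurable_fst]
  refine lintegral_congr_ae ?_
  filter_upwards [h] with s hs
  have hG : Measurable fun x : E => F (Fin.snoc s.1 x : Fin (T + 1 + 1) → E) :=
    hF.comp (measurable_snoc measurable_const measurable_id)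
  have h1 := lintegral_map (μ := e) hG (hy.of_uncurry_left (x := s.2))
  have h2 := lintegral_map (μ := ε) hG (hk.of_uncurry_left (x := s.1 (Fin.last T)))
  rw [hs] at h1
  exact h1.symm.trans h2

theorem indepFun_of_measurable_iSup {Ω γ : Type*} {β : ℕ → Type*} [mΩ : MeasurableSpace Ω]
    [mγ : MeasurableSpace γ] [mβ : ∀ t, MeasurableSpace (β t)] {P : Measure Ω}
    {U : ∀ t, Ω → β t} (hU : iIndepFun U P) (hm : ∀ t, Measurable (U t)) (T : ℕ) {f : Ω → γ}
    (hf : Measurable[⨆ i ∈ Set.Iio T, (mβ i).comap (U i)] f) : IndepFun f (U T) P := by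
  have h1 := indep_iSup_of_disjoint (fun t => (hm t).comap_le) hU
    (S := Set.Iio T) (T := {T}) (by simp)
  rw [IndepFun_iff_Indep]
  refine indep_of_indep_of_le_left (indep_of_indep_of_le_right h1 ?_) hf.comap_le
  simp

theorem measurable_iSup_comap_mono {Ω γ : Type*} {β : ℕ → Type*}
    [mγ : MeasurableSpace γ] [mβ : ∀ t, MeasurableSpace (β t)]
    {U : ∀ t, Ω → β t} {S T : ℕ} (h : S ≤ T) {f : Ω → γ}
    (hf : Measurable[⨆ i ∈ Set.Iio S, (mβ i).comap (U i)] f) :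
    Measurable[⨆ i ∈ Set.Iio T, (mβ i).comap (U i)] f :=
  hf.mono (biSup_mono fun _ hi => lt_of_lt_of_le hi h) le_rfl

theorem measurable_iSup_comap_self {Ω : Type*} {β : ℕ → Type*}
    [mβ : ∀ t, MeasurableSpace (β t)] (U : ∀ t, Ω → β t) (T : ℕ) :
    Measurable[⨆ i ∈ Set.Iio (T + 1), (mβ i).comap (U i)] (U T) := by
  refine Measurable.mono (comap_measurable (U T)) ?_ le_rfl
  exact le_iSup₂_of_le T (Nat.lt_succ_self T) le_rfl

/-- A law on sequences is determined by the laws of the prefixes. -/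
theorem eq_of_map_prefix_eq {E : Type*} [MeasurableSpace E] {μ ν : Measure (ℕ → E)}
    [IsProbabilityMeasure μ] [IsProbabilityMeasure ν]
    (h : ∀ T, μ.map (fun x (i : Fin (T + 1)) => x i) = ν.map (fun x (i : Fin (T + 1)) => x i)) :
    μ = ν := by
  refine IsProjectiveLimit.unique (P := fun I : Finset ℕ => ν.map I.restrict) (fun I => ?_)
    fun I => rfl
  obtain ⟨T, hT⟩ := I.exists_le
  have hφ : Measurable fun (p : Fin (T + 1) → E) (i : I) =>
      p ⟨i, Nat.lt_succ_of_le (hT i i.2)⟩ := measurable_pi_iff.2 fun i => measurable_pi_apply _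
  have hp : Measurable fun (x : ℕ → E) (i : Fin (T + 1)) => x i :=
    measurable_pi_iff.2 fun i => measurable_pi_apply _
  have h1 := congrArg (Measure.map fun (p : Fin (T + 1) → E) (i : I) =>
      p ⟨i, Nat.lt_succ_of_le (hT i i.2)⟩) (h T)
  rw [Measure.map_map hφ hp, Measure.map_map hφ hp] at h1
  exact h1

end markov

/-! ### The products of truncations follow the chain -/

section chain

variable {𝕂 : Type} [NormedDivisionRing 𝕂] [NormedAlgebra ℝ 𝕂] [StarRing 𝕂]
  [hK : IsCompositionField 𝕂] [MeasurableSpace 𝕂] [BorelSpace 𝕂]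

/-- The law of the first `T + 1` vectors of the Markov chain with steps `stepMap`. -/
noncomputable def prefixLaw (𝕂 : Type) [NormedDivisionRing 𝕂] [NormedAlgebra ℝ 𝕂] [StarRing 𝕂]
    [IsCompositionField 𝕂] [MeasurableSpace 𝕂] [BorelSpace 𝕂] {N : ℕ}
    (ρ : ℕ → Measure (Fin N → ℝ)) : ∀ T : ℕ, Measure (Fin (T + 1) → Fin N → ℝ)
  | 0 => (ρ 0).map fun x _ => x
  | T + 1 => ((prefixLaw 𝕂 ρ T).prod ((ρ (T + 1)).prod (haarU 𝕂 N))).map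
      fun q => Fin.snoc q.1 (stepMap (q.1 (Fin.last T)) q.2)

theorem measurable_matrix_mul {α : Type*} {_ : MeasurableSpace α} {l m n : ℕ}
    {f : α → Matrix (Fin l) (Fin m) 𝕂} {g : α → Matrix (Fin m) (Fin n) 𝕂} (hf : Measurable f)
    (hg : Measurable g) : Measurable fun a => f a * g a :=
  (Continuous.matrix_mul continuous_fst continuous_snd).measurable.comp (hf.prodMk hg)

theorem measurable_submatrix {n N L : ℕ} (row : Fin n → Fin L) (col : Fin N → Fin L) :
    Measurable fun U : UGroup 𝕂 L => (U : Matrix (Fin L) (Fin L) 𝕂).submatrix row col :=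
  (continuous_subtype_val.matrix_submatrix _ _).measurable

theorem measurable_of_forall_apply {α ι γ : Type*} {_ : MeasurableSpace α} [MeasurableSpace γ]
    {f : α → ι → γ} (h : ∀ i, Measurable fun a => f a i) : Measurable f := measurable_pi_iff.2 h

theorem snoc_prefix {E : Type*} (y : ℕ → E) (T : ℕ) :
    (Fin.snoc (fun i : Fin (T + 1) => y i) (y (T + 1)) : Fin (T + 1 + 1) → E) =
      fun i : Fin (T + 1 + 1) => y i := by
  ext i
  induction i using Fin.lastCases with
  | last => simp
  | cast i => simp

/-- The partial product is carried as a hidden state beside the observed singular values. It depends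
on the earlier U only, hence is independent of the next one, and by
`map_sqSingularValues_corner_mul` it influences the next vector only through its own singular
values, which are the last observed ones. -/
theorem map_prefix_leftProd {n L : ℕ → ℕ} (hn : ∀ t, n 0 ≤ n t)
    (row : ∀ t, Fin (n (t + 1)) ↪ Fin (L t)) (col : ∀ t, Fin (n t) ↪ Fin (L t))
    {Ω : Type*} [MeasurableSpace Ω] {P : Measure Ω} [IsProbabilityMeasure P]
    {U : ∀ t, Ω → UGroup 𝕂 (L t)} (hm : ∀ t, Measurable (U t))
    (hU : ∀ t, P.map (U t) = haarU 𝕂 (L t)) (hind : iIndepFun U P)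
    {ρ : ℕ → Measure (Fin (n 0) → ℝ)}
    (hρ : ∀ t, (haarU 𝕂 (L t)).map (fun U : UGroup 𝕂 (L t) => sqSingularValues
      ((U : Matrix (Fin (L t)) (Fin (L t)) 𝕂).submatrix (row t)
        ((Fin.castLEEmb (hn t)).trans (col t)))) = ρ t) (T : ℕ) :
    P.map (fun ω (i : Fin (T + 1)) => sqSingularValues (leftProd (fun s =>
      (U s ω : Matrix (Fin (L s)) (Fin (L s)) 𝕂).submatrix (row s) (col s)) (i + 1))) =
    prefixLaw 𝕂 ρ T := by
  set B : ∀ t, Ω → Matrix (Fin (n t)) (Fin (n 0)) 𝕂 := fun t ω => leftProd (fun s =>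
      (U s ω : Matrix (Fin (L s)) (Fin (L s)) 𝕂).submatrix (row s) (col s)) t with hB
  have hBm : ∀ t, Measurable[⨆ i ∈ Set.Iio t, MeasurableSpace.comap (U i) inferInstance] (B t) := by
    intro t
    induction t with
    | zero => exact measurable_const
    | succ t ih =>
      exact measurable_matrix_mul
        ((measurable_submatrix (row t) (col t)).comp (measurable_iSup_comap_self U t))
        (measurable_iSup_comap_mono (Nat.le_succ t) ih)
  have hle : ∀ t, (⨆ i ∈ Set.Iio t, MeasurableSpace.comap (U i) inferInstance) ≤ ‹MeasurableSpace Ω› :=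
    fun t => iSup₂_le fun i _ => (hm i).comap_le
  induction T with
  | zero =>
    have hY := measurable_sqSingularValues_submatrix (𝕂 := 𝕂) (row 0) (col 0)
    have hc : (Fin.castLEEmb (hn 0)).trans (col 0) = col 0 := by ext; rfl
    have h0 := hρ 0
    rw [hc] at h0
    have hc1 : Measurable fun (x : Fin (n 0) → ℝ) (_ : Fin (0 + 1)) => x :=
      measurable_pi_iff.2 fun _ => measurable_id
    rw [prefixLaw, ← h0, ← hU 0, Measure.map_map hY (hm 0), Measure.map_map hc1 (hY.comp (hm 0))]
    congr 1
    ext ω i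
    obtain rfl : i = 0 := Fin.ext (by omega)
    change sqSingularValues (_ * 1) _ = _
    rw [Matrix.mul_one]
    rfl
  | succ T ih =>
    set p : Ω → Fin (T + 1) → Fin (n 0) → ℝ := fun ω i => sqSingularValues (B (i + 1) ω) with hp
    have hpm : Measurable[⨆ i ∈ Set.Iio (T + 1), MeasurableSpace.comap (U i) inferInstance] p := by
      refine measurable_of_forall_apply fun i => measurable_sqSingularValues.comp ?_
      exact measurable_iSup_comap_mono i.2 (hBm (i + 1))
    have hpB := hpm.prodMk (hBm (T + 1))
    have hpB' : Measurable fun ω => (p ω, B (T + 1) ω) := hpB.mono (hle _) le_rfl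
    have hi := (indepFun_iff_map_prod_eq_prod_map_map hpB'.aemeasurable (hm (T + 1)).aemeasurable).1
      (indepFun_of_measurable_iSup hind hm (T + 1) hpB)
    set π := P.map fun ω => (p ω, B (T + 1) ω) with hπ
    have hπp : IsProbabilityMeasure π := Measure.isProbabilityMeasure_map hpB'.aemeasurable
    have hρp : IsProbabilityMeasure (ρ (T + 1)) := by
      rw [← hρ]
      exact Measure.isProbabilityMeasure_map
        (measurable_sqSingularValues_submatrix _ _).aemeasurable
    set Y : Matrix (Fin (n (T + 1))) (Fin (n 0)) 𝕂 → UGroup 𝕂 (L (T + 1)) → Fin (n 0) → ℝ :=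
      fun b u => sqSingularValues ((u : Matrix (Fin (L (T + 1))) (Fin (L (T + 1))) 𝕂).submatrix
        (row (T + 1)) (col (T + 1)) * b) with hY
    have hYm : Measurable (Function.uncurry Y) := measurable_sqSingularValues.comp
      (measurable_matrix_mul ((measurable_submatrix _ _).comp measurable_snd) measurable_fst)
    have hset : MeasurableSet {s : (Fin (T + 1) → Fin (n 0) → ℝ) ×
        Matrix (Fin (n (T + 1))) (Fin (n 0)) 𝕂 | s.1 (Fin.last T) = sqSingularValues s.2} :=
      measurableSet_eq_fun ((measurable_pi_apply _).comp measurable_fst)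
        (measurable_sqSingularValues.comp measurable_snd)
    have hlast : ∀ᵐ s ∂π, s.1 (Fin.last T) = sqSingularValues s.2 :=
      (ae_map_iff hpB'.aemeasurable hset).2 (Filter.Eventually.of_forall fun ω => rfl)
    have hm1 := measurable_snoc_step T hYm
    have key := map_snoc_prod_eq π (haarU 𝕂 (L (T + 1))) ((ρ (T + 1)).prod (haarU 𝕂 (n 0)))
      (measurable_uncurry_stepMap (𝕂 := 𝕂) (n 0)) hYm (by
        filter_upwards [hlast] with s hs
        rw [hs, ← hρ]
        exact map_sqSingularValues_corner_mul (hn _) (hn _) (row _) (col _) s.2)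
    rw [prefixLaw, ← ih]
    have hfst : π.map Prod.fst = P.map p := Measure.map_map measurable_fst hpB'
    rw [hfst, ← hU, ← hi, Measure.map_map hm1 (hpB'.prodMk (hm _))] at key
    rw [← key]
    congr 1
    ext1 ω
    exact (snoc_prefix (fun i => sqSingularValues (B (i + 1) ω)) T).symm

end chain

/-! ### Inserting a random symmetry of the hidden state -/

section average

/-- The joint law of past and hidden state is invariant under each v acting on the hidden state, so
v may be averaged over any independent law η. -/
theorem map_snoc_prod_average {E M S V : Type*} [MeasurableSpace E] [MeasurableSpace M]
    [MeasurableSpace S] [MeasurableSpace V] {T : ℕ} (π : Measure ((Fin (T + 1) → E) × M)) [SFinite π]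
    (μ : Measure S) [SFinite μ] (η : Measure V) [IsProbabilityMeasure η] {y : M → S → E}
    (hy : Measurable (Function.uncurry y)) {act : M → V → M}
    (hact : Measurable (Function.uncurry act))
    (hinv : ∀ v, π.map (fun s => (s.1, act s.2 v)) = π) :
    (π.prod μ).map (fun q => (Fin.snoc q.1.1 (y q.1.2 q.2) : Fin (T + 1 + 1) → E)) =
      (π.prod (μ.prod η)).map
        (fun q => (Fin.snoc q.1.1 (y (act q.1.2 q.2.2) q.2.1) : Fin (T + 1 + 1) → E)) := by
  have hya : Measurable (Function.uncurry fun b (q : S × V) => y (act b q.2) q.1) :=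
    hy.comp ((hact.comp (measurable_fst.prodMk (measurable_snd.comp measurable_snd))).prodMk
      (measurable_fst.comp measurable_snd))
  have hm0 := measurable_snoc_step T hy
  have hm1 := measurable_snoc_step T hya
  refine Measure.ext_of_lintegral _ fun F hF => ?_
  have hF0 := hF.comp hm0
  have hF1 := hF.comp hm1
  simp only [Function.comp_def] at hF0 hF1
  rw [lintegral_map hF hm0, lintegral_map hF hm1, lintegral_prod _ hF0.aemeasurable,
    lintegral_prod _ hF1.aemeasurable]
  set Φ : (Fin (T + 1) → E) × M → ENNReal := fun s =>
    ∫⁻ a, F (Fin.snoc s.1 (y s.2 a) : Fin (T + 1 + 1) → E) ∂μ with hΦ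
  have hΦm : Measurable Φ := hF0.lintegral_prod_right'
  have hmulm : Measurable fun q : ((Fin (T + 1) → E) × M) × V => (q.1.1, act q.1.2 q.2) :=
    (measurable_fst.comp measurable_fst).prodMk
      (hact.comp ((measurable_snd.comp measurable_fst).prodMk measurable_snd))
  have h1 : ∀ s : (Fin (T + 1) → E) × M,
      ∫⁻ q, F (Fin.snoc s.1 (y (act s.2 q.2) q.1) : Fin (T + 1 + 1) → E) ∂μ.prod η =
      ∫⁻ v, Φ (s.1, act s.2 v) ∂η := by
    intro s
    have hs : Measurable fun q : S × V =>
        F (Fin.snoc s.1 (y (act s.2 q.2) q.1) : Fin (T + 1 + 1) → E) :=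
      hF1.comp (measurable_prodMk_left (x := s))
    rw [lintegral_prod_symm _ hs.aemeasurable]
  have h2 : ∀ v, ∫⁻ s, Φ (s.1, act s.2 v) ∂π = ∫⁻ s, Φ s ∂π := by
    intro v
    have hmv : Measurable fun s : (Fin (T + 1) → E) × M => (s.1, act s.2 v) :=
      hmulm.comp (measurable_prodMk_right (y := v))
    rw [← lintegral_map hΦm hmv, hinv]
  simp only [h1]
  rw [lintegral_lintegral_swap (f := fun (s : (Fin (T + 1) → E) × M) v => Φ (s.1, act s.2 v))
    (hΦm.comp hmulm).aemeasurable]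
  simp only [h2, lintegral_const, measure_univ, mul_one]

end average

/-! ### The products of right-invariant matrices follow the chain -/

section chain

variable {𝕂 : Type} [NormedDivisionRing 𝕂] [NormedAlgebra ℝ 𝕂] [StarRing 𝕂]
  [hK : IsCompositionField 𝕂] [MeasurableSpace 𝕂] [BorelSpace 𝕂]

theorem map_mul_haarU_mul {N : ℕ} {μ : Measure (Matrix (Fin N) (Fin N) 𝕂)} [IsProbabilityMeasure μ]
    (b : Matrix (Fin N) (Fin N) 𝕂) :
    (μ.prod (haarU 𝕂 N)).map (fun q =>
      sqSingularValues (b * (q.2 : Matrix (Fin N) (Fin N) 𝕂) * q.1)) =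
    ((μ.map sqSingularValues).prod (haarU 𝕂 N)).map (stepMap (sqSingularValues b)) := by
  have hs := measurable_stepMap (𝕂 := 𝕂) (sqSingularValues b)
  have hm : Measurable fun q : Matrix (Fin N) (Fin N) 𝕂 × UGroup 𝕂 N =>
      sqSingularValues (b * (q.2 : Matrix (Fin N) (Fin N) 𝕂) * q.1) :=
    measurable_sqSingularValues.comp (measurable_matrix_mul (measurable_matrix_mul measurable_const
      (measurable_subtype_coe.comp measurable_snd)) measurable_fst)
  refine Measure.ext_of_lintegral _ fun F hF => ?_
  have hG : Measurable fun v : (Fin N → ℝ) × UGroup 𝕂 N => F (stepMap (sqSingularValues b) v) :=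
    hF.comp hs
  have hH : Measurable fun q : Matrix (Fin N) (Fin N) 𝕂 × UGroup 𝕂 N =>
      F (sqSingularValues (b * (q.2 : Matrix (Fin N) (Fin N) 𝕂) * q.1)) := hF.comp hm
  rw [lintegral_map hF hm, lintegral_map hF hs, lintegral_prod _ hH.aemeasurable,
    lintegral_prod _ hG.aemeasurable, lintegral_map hG.lintegral_prod_right'
      measurable_sqSingularValues]
  refine lintegral_congr fun a => ?_
  have h1 := lintegral_map (μ := haarU 𝕂 N) hF (hm.comp (measurable_prodMk_left (x := a)))
  have h2 := lintegral_map (μ := haarU 𝕂 N) hF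
    (hs.comp (measurable_prodMk_left (x := sqSingularValues a)))
  simp only [Function.comp_def] at h1 h2
  rw [map_sqSingularValues_mul_haarU_mul b a] at h1
  exact h1.symm.trans h2

/-- Right multiplication of the product by V is right multiplication of its last factor, which
preserves the law of that factor and its independence from the past; the singular values observed so
far do not change. -/
theorem map_prefix_rightProd_mul {N : ℕ} {Ω : Type*} [MeasurableSpace Ω] {Q : Measure Ω}
    [IsProbabilityMeasure Q] {A : ℕ → Ω → Matrix (Fin N) (Fin N) 𝕂} (hm : ∀ t, Measurable (A t))
    (hind : iIndepFun A Q)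
    (hinv : ∀ t, ∀ V ∈ UGroup 𝕂 N, Q.map (fun ω => A t ω * V) = Q.map (A t)) (T : ℕ) :
    Measurable[⨆ i ∈ Set.Iio (T + 1), MeasurableSpace.comap (A i) inferInstance]
      (fun ω => ((fun i : Fin (T + 1) => sqSingularValues (rightProd (fun t => A t ω) i)),
        rightProd (fun t => A t ω) T)) ∧
    ∀ V ∈ UGroup 𝕂 N, Q.map (fun ω =>
      ((fun i : Fin (T + 1) => sqSingularValues (rightProd (fun t => A t ω) i)),
        rightProd (fun t => A t ω) T * V)) =
      Q.map fun ω => ((fun i : Fin (T + 1) => sqSingularValues (rightProd (fun t => A t ω) i)),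
        rightProd (fun t => A t ω) T) := by
  set B : ℕ → Ω → Matrix (Fin N) (Fin N) 𝕂 := fun T ω => rightProd (fun t => A t ω) T with hB
  have hle : ∀ t, (⨆ i ∈ Set.Iio t, MeasurableSpace.comap (A i) inferInstance) ≤ ‹MeasurableSpace Ω› :=
    fun t => iSup₂_le fun i _ => (hm i).comap_le
  have hBm : ∀ t, Measurable[⨆ i ∈ Set.Iio (t + 1), MeasurableSpace.comap (A i) inferInstance]
      (B t) := by
    intro t
    induction t with
    | zero => exact measurable_iSup_comap_self A 0
    | succ t ih =>
      exact measurable_matrix_mul (measurable_iSup_comap_mono (Nat.le_succ _) ih)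
        (measurable_iSup_comap_self A (t + 1))
  have hpm : ∀ T, Measurable[⨆ i ∈ Set.Iio (T + 1), MeasurableSpace.comap (A i) inferInstance]
      (fun ω (i : Fin (T + 1)) => sqSingularValues (B i ω)) := fun T =>
    measurable_of_forall_apply fun i => measurable_sqSingularValues.comp
      (measurable_iSup_comap_mono i.2 (hBm i))
  refine ⟨(hpm T).prodMk (hBm T), ?_⟩
  intro V hV
  have hmV : ∀ t, Measurable fun ω => A t ω * V := fun t =>
    measurable_matrix_mul (hm t) measurable_const
  cases T with
  | zero =>
    have hΨ : Measurable fun a : Matrix (Fin N) (Fin N) 𝕂 =>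
        ((fun _ : Fin (0 + 1) => sqSingularValues a), a) :=
      (measurable_pi_iff.2 fun _ => measurable_sqSingularValues).prodMk measurable_id
    have h := congrArg (Measure.map fun a : Matrix (Fin N) (Fin N) 𝕂 =>
        ((fun _ : Fin (0 + 1) => sqSingularValues a), a)) (hinv 0 V hV)
    rw [Measure.map_map hΨ (hmV 0), Measure.map_map hΨ (hm 0)] at h
    have e1 : ∀ ω : Ω, (fun i : Fin (0 + 1) => sqSingularValues (B i ω)) =
        fun _ => sqSingularValues (A 0 ω) := fun ω => by
      ext1 i
      obtain rfl : i = 0 := Fin.ext (by omega)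
      rfl
    simp only [Function.comp_def, sqSingularValues_mul_unitary _ hV] at h
    change Q.map (fun ω => ((fun i : Fin (0 + 1) => sqSingularValues (B i ω)), A 0 ω * V)) =
      Q.map fun ω => ((fun i : Fin (0 + 1) => sqSingularValues (B i ω)), A 0 ω)
    simp only [e1]
    exact h
  | succ T =>
    have hpB := (hpm T).prodMk (hBm T)
    have hpB' : Measurable fun ω => ((fun i : Fin (T + 1) => sqSingularValues (B i ω)), B T ω) :=
      hpB.mono (hle _) le_rfl
    have hi := indepFun_of_measurable_iSup hind hm (T + 1) hpB
    have hiV : IndepFun (fun ω => ((fun i : Fin (T + 1) => sqSingularValues (B i ω)), B T ω))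
        (fun ω => A (T + 1) ω * V) Q :=
      hi.comp measurable_id (measurable_matrix_mul measurable_id (measurable_const (a := V)))
    have h1 := (indepFun_iff_map_prod_eq_prod_map_map hpB'.aemeasurable
      (hm (T + 1)).aemeasurable).1 hi
    have h2 := (indepFun_iff_map_prod_eq_prod_map_map hpB'.aemeasurable
      (hmV (T + 1)).aemeasurable).1 hiV
    rw [hinv _ V hV, ← h1] at h2
    have hba : Measurable fun q : ((Fin (T + 1) → Fin N → ℝ) × Matrix (Fin N) (Fin N) 𝕂) ×
        Matrix (Fin N) (Fin N) 𝕂 => q.1.2 * q.2 :=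
      measurable_matrix_mul (measurable_snd.comp measurable_fst) measurable_snd
    have hΨ : Measurable fun q : ((Fin (T + 1) → Fin N → ℝ) × Matrix (Fin N) (Fin N) 𝕂) ×
        Matrix (Fin N) (Fin N) 𝕂 => ((Fin.snoc q.1.1 (sqSingularValues (q.1.2 * q.2)) :
          Fin (T + 1 + 1) → Fin N → ℝ), q.1.2 * q.2) :=
      (measurable_snoc (measurable_fst.comp measurable_fst)
        (measurable_sqSingularValues.comp hba)).prodMk hba
    have h3 := congrArg (Measure.map fun q : ((Fin (T + 1) → Fin N → ℝ) ×
        Matrix (Fin N) (Fin N) 𝕂) × Matrix (Fin N) (Fin N) 𝕂 =>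
        ((Fin.snoc q.1.1 (sqSingularValues (q.1.2 * q.2)) :
          Fin (T + 1 + 1) → Fin N → ℝ), q.1.2 * q.2)) h2
    rw [Measure.map_map hΨ (hpB'.prodMk (hmV _)), Measure.map_map hΨ (hpB'.prodMk (hm _))] at h3
    have e1 : ∀ ω, (Fin.snoc (fun i : Fin (T + 1) => sqSingularValues (B i ω))
        (sqSingularValues (B T ω * A (T + 1) ω)) : Fin (T + 1 + 1) → Fin N → ℝ) =
        fun i : Fin (T + 1 + 1) => sqSingularValues (B i ω) := fun ω =>
      snoc_prefix (fun i => sqSingularValues (B i ω)) T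
    simp only [Function.comp_def, ← Matrix.mul_assoc, sqSingularValues_mul_unitary _ hV, e1] at h3
    exact h3

/-- The invariance of `map_prefix_rightProd_mul` allows a Haar unitary between the partial product
and the next factor. Then `map_mul_haarU_mul` shows that only the two vectors of singular values
matter. -/
theorem map_prefix_rightProd {N : ℕ} {Ω : Type*} [MeasurableSpace Ω] {Q : Measure Ω}
    [IsProbabilityMeasure Q] {A : ℕ → Ω → Matrix (Fin N) (Fin N) 𝕂} (hm : ∀ t, Measurable (A t))
    (hind : iIndepFun A Q)
    (hinv : ∀ t, ∀ V ∈ UGroup 𝕂 N, Q.map (fun ω => A t ω * V) = Q.map (A t))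
    {ρ : ℕ → Measure (Fin N → ℝ)} (hρ : ∀ t, Q.map (fun ω => sqSingularValues (A t ω)) = ρ t)
    (T : ℕ) :
    Q.map (fun ω (i : Fin (T + 1)) => sqSingularValues (rightProd (fun t => A t ω) i)) =
      prefixLaw 𝕂 ρ T := by
  induction T with
  | zero =>
    have hc1 : Measurable fun (x : Fin N → ℝ) (_ : Fin (0 + 1)) => x :=
      measurable_pi_iff.2 fun _ => measurable_id
    have hA : Measurable fun ω => sqSingularValues (A 0 ω) := measurable_sqSingularValues.comp (hm 0)
    rw [prefixLaw, ← hρ 0, Measure.map_map hc1 hA]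
    congr 1
    ext ω i
    obtain rfl : i = 0 := Fin.ext (by omega)
    rfl
  | succ T ih =>
    obtain ⟨hpB, hV⟩ := map_prefix_rightProd_mul hm hind hinv T
    set p : Ω → Fin (T + 1) → Fin N → ℝ := fun ω i =>
      sqSingularValues (rightProd (fun t => A t ω) i) with hp
    set B : Ω → Matrix (Fin N) (Fin N) 𝕂 := fun ω => rightProd (fun t => A t ω) T with hB
    change ∀ V ∈ UGroup 𝕂 N, Q.map (fun ω => (p ω, B ω * V)) = Q.map fun ω => (p ω, B ω) at hV
    have hpB' : Measurable fun ω => (p ω, B ω) :=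
      hpB.mono (iSup₂_le fun i _ => (hm i).comap_le) le_rfl
    have hi := (indepFun_iff_map_prod_eq_prod_map_map hpB'.aemeasurable (hm (T + 1)).aemeasurable).1
      (indepFun_of_measurable_iSup hind hm (T + 1) hpB)
    set π := Q.map fun ω => (p ω, B ω) with hπ
    set μ := Q.map (A (T + 1)) with hμ
    have hπp : IsProbabilityMeasure π := Measure.isProbabilityMeasure_map hpB'.aemeasurable
    have hμp : IsProbabilityMeasure μ := Measure.isProbabilityMeasure_map (hm _).aemeasurable
    have hμρ : μ.map sqSingularValues = ρ (T + 1) := by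
      rw [hμ, Measure.map_map measurable_sqSingularValues (hm _), ← hρ]
      rfl
    have hρp : IsProbabilityMeasure (ρ (T + 1)) := by
      rw [← hμρ]
      exact Measure.isProbabilityMeasure_map measurable_sqSingularValues.aemeasurable
    set Y : Matrix (Fin N) (Fin N) 𝕂 → Matrix (Fin N) (Fin N) 𝕂 × UGroup 𝕂 N → Fin N → ℝ :=
      fun b q => sqSingularValues (b * (q.2 : Matrix (Fin N) (Fin N) 𝕂) * q.1) with hY
    have hYm : Measurable (Function.uncurry Y) := measurable_sqSingularValues.comp
      (measurable_matrix_mul (measurable_matrix_mul measurable_fst (measurable_subtype_coe.comp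
        (measurable_snd.comp measurable_snd))) (measurable_fst.comp measurable_snd))
    set Y₀ : Matrix (Fin N) (Fin N) 𝕂 → Matrix (Fin N) (Fin N) 𝕂 → Fin N → ℝ :=
      fun b a => sqSingularValues (b * a) with hY₀
    have hY₀m : Measurable (Function.uncurry Y₀) := measurable_sqSingularValues.comp
      (measurable_matrix_mul measurable_fst measurable_snd)
    have hset : MeasurableSet {s : (Fin (T + 1) → Fin N → ℝ) × Matrix (Fin N) (Fin N) 𝕂 |
        s.1 (Fin.last T) = sqSingularValues s.2} :=
      measurableSet_eq_fun ((measurable_pi_apply _).comp measurable_fst)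
        (measurable_sqSingularValues.comp measurable_snd)
    have hlast : ∀ᵐ s ∂π, s.1 (Fin.last T) = sqSingularValues s.2 :=
      (ae_map_iff hpB'.aemeasurable hset).2 (Filter.Eventually.of_forall fun ω => rfl)
    have hm1 := measurable_snoc_step T hYm
    have hm0 := measurable_snoc_step T hY₀m
    have key := map_snoc_prod_eq π (μ.prod (haarU 𝕂 N)) ((ρ (T + 1)).prod (haarU 𝕂 N))
      (measurable_uncurry_stepMap (𝕂 := 𝕂) N) hYm (by
        filter_upwards [hlast] with s hs
        rw [hs, ← hμρ]
        exact map_mul_haarU_mul s.2)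
    have hfst : π.map Prod.fst = Q.map p := Measure.map_map measurable_fst hpB'
    have havg : (π.prod μ).map (fun q => (Fin.snoc q.1.1 (Y₀ q.1.2 q.2) :
          Fin (T + 1 + 1) → Fin N → ℝ)) =
        (π.prod (μ.prod (haarU 𝕂 N))).map (fun q => (Fin.snoc q.1.1 (Y q.1.2 q.2) :
          Fin (T + 1 + 1) → Fin N → ℝ)) :=
      map_snoc_prod_average π μ (haarU 𝕂 N) hY₀m (act := fun b V => b * (V : Matrix (Fin N) (Fin N) 𝕂))
        (measurable_matrix_mul measurable_fst (measurable_subtype_coe.comp measurable_snd)) fun V => by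
          have hmV : Measurable fun s : (Fin (T + 1) → Fin N → ℝ) × Matrix (Fin N) (Fin N) 𝕂 =>
              (s.1, s.2 * (V : Matrix (Fin N) (Fin N) 𝕂)) :=
            measurable_fst.prodMk (measurable_matrix_mul measurable_snd measurable_const)
          rw [hπ, Measure.map_map hmV hpB']
          exact hV V V.2
    rw [prefixLaw, ← ih]
    rw [hfst, ← havg, ← hi, Measure.map_map hm0 (hpB'.prodMk (hm _))] at key
    refine Eq.trans ?_ key
    congr 1
    ext1 ω
    exact (snoc_prefix (fun i => sqSingularValues (rightProd (fun t => A t ω) i)) T).symm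

end chain

/-! ### Existence of iterated products -/

section existence

variable {𝕂 : Type} [NormedDivisionRing 𝕂] [NormedAlgebra ℝ 𝕂] [StarRing 𝕂]
  [hK : IsCompositionField 𝕂] [MeasurableSpace 𝕂] [BorelSpace 𝕂]

theorem measurable_leftProd {n : ℕ → ℕ} {Ω : Type*} [MeasurableSpace Ω]
    {X : ∀ t, Ω → Matrix (Fin (n (t + 1))) (Fin (n t)) 𝕂} (hX : ∀ t, Measurable (X t)) (T : ℕ) :
    Measurable fun ω => leftProd (fun t => X t ω) T := by
  induction T with
  | zero => exact measurable_const
  | succ T ih => exact measurable_matrix_mul (hX T) ih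

theorem measurable_rightProd {N : ℕ} {Ω : Type*} [MeasurableSpace Ω]
    {A : ℕ → Ω → Matrix (Fin N) (Fin N) 𝕂} (hA : ∀ t, Measurable (A t)) (T : ℕ) :
    Measurable fun ω => rightProd (fun t => A t ω) T := by
  induction T with
  | zero => exact hA 0
  | succ T ih => exact measurable_matrix_mul ih (hA (T + 1))

theorem sqSingularValues_realDiag_sqrt {N : ℕ} {x : Fin N → ℝ} (hx : Antitone x)
    (h0 : ∀ i, 0 ≤ x i) : sqSingularValues (realDiag 𝕂 fun i => √(x i)) = x := by
  refine sqSingularValues_eq ⟨hx, 1, one_mem _, ?_⟩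
  rw [realDiag_conjTranspose, realDiag_mul, Matrix.one_mul, star_one, Matrix.mul_one]
  simp only [Real.mul_self_sqrt (h0 _)]
  rfl

/-- Existence of iterated products of random vectors with given laws. -/
theorem exists_isIteratedBoxtimes {N : ℕ} (ρ : ℕ → Measure (Fin N → ℝ))
    [∀ t, IsProbabilityMeasure (ρ t)]
    (hρ : ∀ t, ∀ᵐ x ∂ρ t, sqSingularValues (realDiag 𝕂 fun i => √(x i)) = x) :
    ∃ (Ω : Type) (_ : MeasurableSpace Ω) (Q : Measure Ω) (_ : IsProbabilityMeasure Q)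
      (x z : ℕ → Ω → Fin N → ℝ), (∀ t, AEMeasurable (x t) Q) ∧ iIndepFun x Q ∧
      (∀ t, Q.map (x t) = ρ t) ∧ IsIteratedBoxtimes 𝕂 Q x z := by
  -- The factor diag(√x) V with V Haar and independent of x is right invariant and has squared
  -- singular values x for almost every x.
  set g : (Fin N → ℝ) × UGroup 𝕂 N → Matrix (Fin N) (Fin N) 𝕂 := fun v =>
    realDiag 𝕂 (fun i => √(v.1 i)) * (v.2 : Matrix (Fin N) (Fin N) 𝕂) with hg
  have hgm : Measurable g := measurable_matrix_mul
    ((continuous_realDiag_sqrt N).measurable.comp measurable_fst)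
    (measurable_subtype_coe.comp measurable_snd)
  set e : ℕ → Measure ((Fin N → ℝ) × UGroup 𝕂 N) := fun t => (ρ t).prod (haarU 𝕂 N) with he
  have hev : ∀ t, (Measure.infinitePi e).map (fun ω => ω t) = e t := fun t =>
    Measure.infinitePi_map_eval e t
  refine ⟨ℕ → (Fin N → ℝ) × UGroup 𝕂 N, inferInstance, Measure.infinitePi e, inferInstance,
    fun t ω => (ω t).1, fun t ω => sqSingularValues (rightProd (fun s => g (ω s)) t), ?_, ?_, ?_,
    fun t ω => g (ω t), ?_, ?_, ?_, ?_, ?_⟩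
  · exact fun t => (measurable_fst.comp (measurable_pi_apply t)).aemeasurable
  · exact iIndepFun_infinitePi fun _ => measurable_fst
  · intro t
    have h := congrArg (Measure.map Prod.fst) (hev t)
    rw [Measure.map_map measurable_fst (measurable_pi_apply t), he, Measure.map_fst_prod,
      measure_univ, one_smul] at h
    exact h
  · exact fun t => hgm.comp (measurable_pi_apply t)
  · exact iIndepFun_infinitePi fun _ => hgm
  · intro t V hV
    have hmV : Measurable fun v => g v * V := measurable_matrix_mul hgm measurable_const
    have hp : MeasurePreserving (Prod.map id fun u : UGroup 𝕂 N => u * ⟨V, hV⟩) (e t) (e t) :=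
      (MeasurePreserving.id _).prod (measurePreserving_mul_right_haarU ⟨V, hV⟩)
    have h1 := Measure.map_map (μ := Measure.infinitePi e) hmV (measurable_pi_apply t)
    have h2 := Measure.map_map (μ := Measure.infinitePi e) hgm (measurable_pi_apply t)
    have h3 := Measure.map_map (μ := e t) hgm hp.measurable
    refine h1.symm.trans (Eq.trans ?_ h2)
    rw [hev, hp.map_eq] at *
    rw [h3]
    congr 1
    ext1 v
    simp only [hg, Function.comp_apply, Prod.map, id, Submonoid.coe_mul, Matrix.mul_assoc]
  · intro t
    have h1 : ∀ᵐ v ∂e t, v.1 = sqSingularValues (g v) := by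
      have h2 : ∀ᵐ v ∂e t, sqSingularValues (realDiag 𝕂 fun i => √(v.1 i)) = v.1 :=
        Measure.quasiMeasurePreserving_fst.ae (hρ t)
      filter_upwards [h2] with v hv
      rw [hg, sqSingularValues_mul_unitary _ v.2.2, hv]
    rw [← hev t] at h1
    exact ae_of_ae_map (measurable_pi_apply t).aemeasurable h1
  · exact fun t => Filter.Eventually.of_forall fun ω => rfl

end existence

/-! ### The theorem -/

/-- Here `N_T` is `n T` (so `N = N_0 = n 0`), while `L t`, `U t`, `row t`, `col t`, `y t`, `x t`,
`z t` are the objects with index `T = t + 1 = 1, 2, …`. -/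
theorem theoremA1 {𝕂 : Type} [NormedDivisionRing 𝕂] [NormedAlgebra ℝ 𝕂] [StarRing 𝕂]
    [MeasurableSpace 𝕂] [BorelSpace 𝕂] (β : ℕ) (h𝕂 : IsDysonField 𝕂 β)
    (n L : ℕ → ℕ) (hpos : 0 < n 0) (hn : ∀ t, n 0 ≤ n (t + 1))
    (hL : ∀ t, max (n t) (n (t + 1)) ≤ L t)
    (row : ∀ t, Fin (n (t + 1)) ↪ Fin (L t)) (col : ∀ t, Fin (n t) ↪ Fin (L t))
    {Ω : Type*} [MeasurableSpace Ω] (P : Measure Ω) [IsProbabilityMeasure P]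
    (U : ∀ t, Ω → UGroup 𝕂 (L t)) (hUmeas : ∀ t, Measurable (U t))
    (hUhaar : ∀ t, (P.map (U t)).IsHaarMeasure) (hUindep : iIndepFun U P)
    (y : ℕ → Ω → Fin (n 0) → ℝ)
    (hy : ∀ t ω, y t ω = sqSingularValues
      (leftProd (fun s => (U s ω : Matrix (Fin (L s)) (Fin (L s)) 𝕂).submatrix (row s) (col s))
        (t + 1))) :
    (∀ (Ω' : Type*) [MeasurableSpace Ω'] (Q : Measure Ω') [IsProbabilityMeasure Q]
      (x z : ℕ → Ω' → Fin (n 0) → ℝ), (∀ t, AEMeasurable (x t) Q) → iIndepFun x Q →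
      (∀ t, Q.map (x t) = jacobiEnsemble ((β : ℝ) / 2) ((n (t + 1) : ℝ) - n 0 + 1)
        (L t - n (t + 1)) (n 0)) →
      IsIteratedBoxtimes 𝕂 Q x z →
      P.map (fun ω t => y t ω) = Q.map (fun ω t => z t ω)) ∧
    (∃ (Ω' : Type) (_ : MeasurableSpace Ω') (Q : Measure Ω') (_ : IsProbabilityMeasure Q)
      (x z : ℕ → Ω' → Fin (n 0) → ℝ), (∀ t, AEMeasurable (x t) Q) ∧ iIndepFun x Q ∧
      (∀ t, Q.map (x t) = jacobiEnsemble ((β : ℝ) / 2) ((n (t + 1) : ℝ) - n 0 + 1)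
        (L t - n (t + 1)) (n 0)) ∧
      IsIteratedBoxtimes 𝕂 Q x z) := by
  have := IsCompositionField.of_isDysonField h𝕂
  have hn0 : ∀ t, n 0 ≤ n t := fun t => by cases t with
    | zero => exact le_rfl
    | succ t => exact hn t
  have hLt : ∀ t, n (t + 1) ≤ L t := fun t => (le_max_right _ _).trans (hL t)
  have hprob : ∀ t, IsProbabilityMeasure (P.map (U t)) := fun t =>
    Measure.isProbabilityMeasure_map (hUmeas t).aemeasurable
  have hU : ∀ t, P.map (U t) = haarU 𝕂 (L t) := fun t =>
    haveI := hUhaar t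
    haveI := hprob t
    eq_haarU _
  set ρ : ℕ → Measure (Fin (n 0) → ℝ) := fun t => jacobiEnsemble ((β : ℝ) / 2)
    ((n (t + 1) : ℝ) - n 0 + 1) (L t - n (t + 1)) (n 0) with hρdef
  -- Only the first n 0 of the n t columns are kept, so the Jacobi parameters do not involve n t.
  have hρ : ∀ t, (haarU 𝕂 (L t)).map (fun U : UGroup 𝕂 (L t) => sqSingularValues
      ((U : Matrix (Fin (L t)) (Fin (L t)) 𝕂).submatrix (row t)
        ((Fin.castLEEmb (hn0 t)).trans (col t)))) = ρ t := fun t => by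
    rw [map_corner_haarU_eq_jacobiEnsemble (hn t) (hLt t), h𝕂.finrank_eq]
  -- That the Jacobi weight has finite nonzero mass is not checked directly: the ensemble is the law
  -- of a corner.
  have hρp : ∀ t, IsProbabilityMeasure (ρ t) := fun t => by
    rw [← hρ t]
    exact Measure.isProbabilityMeasure_map (measurable_sqSingularValues_submatrix _ _).aemeasurable
  constructor
  · intro Ω' _ Q _ x z hx _ hxρ ⟨A, hAm, hAind, hAinv, hxA, hzA⟩
    have hym : Measurable fun ω t => y t ω := by
      refine measurable_pi_iff.2 fun t => ?_
      simp only [hy]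
      exact measurable_sqSingularValues.comp (measurable_leftProd (fun s =>
        (measurable_submatrix (row s) (col s)).comp (hUmeas s)) (t + 1))
    have hzm : Measurable fun ω t => sqSingularValues (rightProd (fun s => A s ω) t) :=
      measurable_pi_iff.2 fun t => measurable_sqSingularValues.comp (measurable_rightProd hAm t)
    have hz : Q.map (fun ω t => z t ω) =
        Q.map fun ω t => sqSingularValues (rightProd (fun s => A s ω) t) := by
      refine Measure.map_congr ?_
      filter_upwards [ae_all_iff.2 hzA] with ω hω
      exact funext hω
    have hAρ : ∀ t, Q.map (fun ω => sqSingularValues (A t ω)) = ρ t := fun t => by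
      rw [← Measure.map_congr (hxA t), hxρ t]
    rw [hz]
    have := Measure.isProbabilityMeasure_map (μ := P) hym.aemeasurable
    have := Measure.isProbabilityMeasure_map (μ := Q) hzm.aemeasurable
    refine eq_of_map_prefix_eq fun T => ?_
    have hp : Measurable fun (x : ℕ → Fin (n 0) → ℝ) (i : Fin (T + 1)) => x i :=
      measurable_pi_iff.2 fun i => measurable_pi_apply _
    rw [Measure.map_map hp hym, Measure.map_map hp hzm]
    refine Eq.trans ?_ ((map_prefix_leftProd hn0 row col hUmeas hU hUindep hρ T).trans
      (map_prefix_rightProd hAm hAind hAinv hAρ T).symm)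
    congr 1
    ext1 ω
    exact funext fun i => hy i ω
  -- As the law of a vector of squared singular values, ρ t is carried by decreasing nonnegative
  -- vectors, and these are the squared singular values of diag(√x).
  · refine exists_isIteratedBoxtimes ρ fun t => ?_
    rw [← hρ t]
    have hset : MeasurableSet {x : Fin (n 0) → ℝ |
        sqSingularValues (realDiag 𝕂 fun i => √(x i)) = x} :=
      measurableSet_eq_fun
        (measurable_sqSingularValues.comp (continuous_realDiag_sqrt _).measurable) measurable_id
    exact (ae_map_iff (measurable_sqSingularValues_submatrix _ _).aemeasurable hset).2
      (Filter.Eventually.of_forall fun V => sqSingularValues_realDiag_sqrt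
        (sqSingularValues_antitone _) (sqSingularValues_nonneg _))
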